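/- **Setting.** Let $V$ be a finite set of $K=|V|\ge 1$ arms and let $G_1,G_2,\dots$ be an arbitrary (oblivious) sequence of directed graphs on $V$ containing all self-loops; $G_t$ is revealed at the start of round $t$. In round $t$ the learner plays $I_t\in V$, suffers $\ell_{t,I_t}$ and observes $\ell_{t,j}$ for all $j$ with $(I_t,j)\in E(G_t)$, where $\ell_{t,i}\in[0,1]$. The pseudo-regret is $\mathcal R_T=\mathbb E\big[\sum_{t\le T}\ell_{t,I_t}\big]-\min_{i}\mathbb E\big[\sum_{t\le T}\ell_{t,i}\big]$. The independence number $\alpha_t$ of $G_t$ is the largest size of a set of arms no two distinct elements of which are joined by an edge in either direction; its strong independence number $\tilde\alpha(G_t)$ is the largest size of a set of arms no two distinct elements $i,j$ of which satisfy both $(i,j)\in E(G_t)$ and $(j,i)\in E(G_t)$. **Algorithm (EXP3.G++, $\lambda=1$, $\gamma=4$, $\beta=320$).** Play each arm once in rounds $1,\dots,K$. Let $O_{t,i}$ and $\hat L_{t,i}$ be the number of observations of arm $i$, and the sum of its observed losses, up to round $t$; put $\tilde L_{K}=0$ and $\theta_K=K$. In each round $t>K$ set $$\mathrm{UCB}_{t,i}=\min\Big\{1,\tfrac{\hat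 L_{t-1,i}}{O_{t-1,i}}+\sqrt{\tfrac{\gamma\ln(tK^{1/\gamma})}{2O_{t-1,i}}}\Big\},\quad \mathrm{LCB}_{t,i}=\max\Big\{0,\tfrac{\hat L_{t-1,i}}{O_{t-1,i}}-\sqrt{\tfrac{\gamma\ln(tK^{1/\gamma})}{2O_{t-1,i}}}\Big\},$$ $\hat\Delta_{t,i}=\max\{0,\mathrm{LCB}_{t,i}-\min_j\mathrm{UCB}_{t,j}\}$. Build the exploration set $S_t$ by going through the arms in ascending order of $\hat\Delta_{t,i}$ (ties broken arbitrarily), adding an arm unless it is an out-neighbour in $G_t$ of an arm added before. Let $\varepsilon_{t,i}=\min\big\{\frac1{2K},\frac12\sqrt{\frac{\lambda\ln K}{tK^2}},\xi_{t,i}\big\}$ with $\xi_{t,i}=\frac{\beta\ln t}{t\hat\Delta_{t,i}^2}$ for $i\in S_t$ ($+\infty$ if $\hat\Delta_{t,i}=0$) and $\xi_{t,i}=4/t^2$ for $i\notin S_t$. With $\eta_t=\sqrt{\ln K/(2\sum_{s=K}^{t-1}\theta_s)}$ let $q_{t,i}\propto\exp(-\eta_t\tilde L_{t-1,i})$ and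 $p_{t,i}=(1-\sum_j\varepsilon_{t,j})q_{t,i}+\varepsilon_{t,i}$. Draw $I_t\sim p_t$, and with $P_{t,i}=\sum_{j:(j,i)\in E(G_t)}p_{t,j}$ set $\theta_t=\sum_i p_{t,i}/P_{t,i}$ and $\tilde L_{t,i}=\tilde L_{t-1,i}+\ell_{t,i}\mathbf 1[(I_t,i)\in E(G_t)]/P_{t,i}$. **Theorem.** For every $T\ge1$ this algorithm satisfies simultaneously: (a) for every oblivious (deterministic) loss sequence in $[0,1]$, $$\mathcal R_T\le 9\sqrt{\ln K}\,\sqrt{\ln(KT)}\,\sqrt{\textstyle\sum_{t=1}^T\alpha_t}+2K;$$ (b) if the loss vectors $(\ell_{t,i})_{i\in V}$, $t\ge1$, are independent over $t$ and identically distributed on $[0,1]^V$, then with $\Delta_i=\mathbb E[\ell_{1,i}]-\min_j\mathbb E[\ell_{1,j}]$ and $\Delta_{\min}=\min_{i:\Delta_i>0}\Delta_i$, $$\mathcal R_T\le\inf_{0\le n\le T}\Big\{\max_{S\subseteq V:\,|S|=\tilde\alpha_n}\sum_{i\in S:\Delta_i>0}\frac{4\beta\ln^2T}{\Delta_i}+n\Big\}+2\ln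 T+\sum_{i:\Delta_i>0}\frac{16K}{\Delta_i}+\frac{181\,\beta K^{3/2}}{\Delta_{\min}^2}\Big(\ln\frac{20\beta^2K^{5/2}}{\Delta_{\min}^4}\Big)^2,$$ where $\tilde\alpha_n$ is the entry number $n$, counted from $0$ and with multiplicity, of $\tilde\alpha(G_1),\dots,\tilde\alpha(G_T)$ in descending order ($\tilde\alpha_0$ is the maximum; $\tilde\alpha_T=0$). If all $\Delta_i=0$, the last term is read as $0$. -/

import Mathlib

open MeasureTheory ProbabilityTheory

namespace FeedbackGraph

noncomputable section

/-! ## Graph-theoretic quantities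

A feedback graph is a `Digraph V`; `G.Adj i j` means that playing `i` reveals the loss of `j`. -/

/-- The independence number of a directed graph: the largest size of a set of vertices no two
distinct elements of which are joined by an edge, in either direction. -/
def indepNumber {V : Type*} (G : Digraph V) : ℕ := G.toSimpleGraphInclusive.indepNum

/-- The strong independence number of a directed graph: the independence number of the graph that
keeps an edge between `i` and `j` iff both `(i, j)` and `(j, i)` are edges. -/
def strongIndepNumber {V : Type*} (G : Digraph V) : ℕ := G.toSimpleGraphStrict.indepNum

/-- Entry number `n` (counted from `0`, with multiplicity) of the list `a 1, …, a T` sorted in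
descending order, and `0` if `T ≤ n`. Thus `n = 0` gives the maximum, and in general the maximum
that remains once the `n` largest entries are deleted. -/
def nthLargest (a : ℕ → ℕ) (T n : ℕ) : ℕ :=
  (((Finset.Icc 1 T).val.map a).sort (fun x y => y ≤ x)).getD n 0

/-! ## The exploration set -/

open scoped Classical in
/-- Scan a list of arms from left to right; an arm is skipped iff it lies in the out-neighbourhood
of an arm that was selected before it, and is selected otherwise. -/
def greedySet {V : Type*} (G : Digraph V) (arms : List V) : Finset V :=
  arms.foldl (fun S j => if ∃ i ∈ S, G.Adj i j then S else insert j S) ∅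

/-- `S` is a possible output of the exploration set construction on `G` with gaps `gap`: it is the
greedy set of a list of all the arms in ascending order of their gaps (ties in any order). -/
def IsExplorationSet {V : Type*} (G : Digraph V) (gap : V → ℝ) (S : Finset V) : Prop :=
  ∃ arms : List V, arms.Nodup ∧ (∀ i, i ∈ arms) ∧ arms.Pairwise (fun i j => gap i ≤ gap j) ∧
    greedySet G arms = S

/-! ## The algorithm EXP3.G++ with adaptive learning rate -/

/-- The variables maintained by the algorithm at the end of a round. -/
structure State (V : Type*) where
  /-- cumulative importance-weighted loss estimates -/
  Ltilde : V → ℝ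
  /-- cumulative observed losses -/
  Lhat : V → ℝ
  /-- numbers of observations -/
  obs : V → ℕ
  /-- the sum of `θ_s` over `K ≤ s ≤ t`, where `θ_K = K` -/
  Theta : ℝ

section Round

/-! In this section `st` is the state at the end of round `t - 1`, and the quantities defined are
those of round `t`. -/

variable {V : Type*} [Fintype V]

/-- The upper confidence bound of arm `i` at round `t`. -/
def ucb (γ : ℝ) (t : ℕ) (st : State V) (i : V) : ℝ :=
  min 1 (st.Lhat i / st.obs i +
    √(γ * Real.log (t * (Fintype.card V : ℝ) ^ (1 / γ)) / (2 * st.obs i)))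

/-- The lower confidence bound of arm `i` at round `t`. -/
def lcb (γ : ℝ) (t : ℕ) (st : State V) (i : V) : ℝ :=
  max 0 (st.Lhat i / st.obs i -
    √(γ * Real.log (t * (Fintype.card V : ℝ) ^ (1 / γ)) / (2 * st.obs i)))

/-- The estimated suboptimality gap of arm `i` at round `t`. -/
def gapEst (γ : ℝ) (t : ℕ) (st : State V) (i : V) : ℝ :=
  max 0 (lcb γ t st i - ⨅ j, ucb γ t st j)

open scoped Classical in
/-- The exploration rate `min {1/(2K), (1/2) √(lam ln K / (t K²)), ξ i}`, with
`ξ i = β ln t / (t (gap i)²)` for `i ∈ S`, read as `+∞` when `gap i = 0`, and `ξ i = 4 / t²` for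
`i ∉ S`. -/
def explRate (lam β : ℝ) (t : ℕ) (gap : V → ℝ) (S : Finset V) (i : V) : ℝ :=
  let K : ℝ := Fintype.card V
  let base : ℝ := min (1 / (2 * K)) (1 / 2 * √(lam * Real.log K / (t * K ^ 2)))
  if i ∈ S then
    if gap i = 0 then base else min base (β * Real.log t / (t * gap i ^ 2))
  else min base (4 / (t : ℝ) ^ 2)

/-- The adaptive learning rate `η_t = √(ln K / (2 ∑_{s = K}^{t - 1} θ_s))`. -/
def learningRate (st : State V) : ℝ := √(Real.log (Fintype.card V) / (2 * st.Theta))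

/-- The exponential weights `q_{t, i}`. -/
def expWeight (st : State V) (i : V) : ℝ :=
  Real.exp (-learningRate st * st.Ltilde i) / ∑ j, Real.exp (-learningRate st * st.Ltilde j)

/-- The probability `p_{t, i}` of playing arm `i` at round `t`, with exploration set `S`. -/
def playProb (lam γ β : ℝ) (t : ℕ) (S : Finset V) (st : State V) (i : V) : ℝ :=
  (1 - ∑ j, explRate lam β t (gapEst γ t st) S j) * expWeight st i +
    explRate lam β t (gapEst γ t st) S i

open scoped Classical in
/-- The probability `P_{t, i}` of observing arm `i` at round `t`, when arms are drawn from `p` and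
the graph of the round is `G`. -/
def obsProb (G : Digraph V) (p : V → ℝ) (i : V) : ℝ := ∑ j with G.Adj j i, p j

open scoped Classical in
/-- The update at the end of round `t`, in which the graph is `G`, the exploration set is `S`, the
arm played is `a` and the losses are `l` (which are only read at the out-neighbours of `a`). The
observed losses are recorded in every round, whereas the importance-weighted estimates and the sum
of the `θ_s` are updated only after the `K` initialization rounds. -/
def step (lam γ β : ℝ) (G : Digraph V) (t : ℕ) (S : Finset V) (a : V) (l : V → ℝ)
    (st : State V) : State V :=
  let p := playProb lam γ β t S st
  { Ltilde := fun i =>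
      if Fintype.card V < t then
        st.Ltilde i + (if G.Adj a i then l i else 0) / obsProb G p i
      else st.Ltilde i
    Lhat := fun i => st.Lhat i + if G.Adj a i then l i else 0
    obs := fun i => st.obs i + if G.Adj a i then 1 else 0
    Theta := if Fintype.card V < t then st.Theta + ∑ i, p i / obsProb G p i else st.Theta }

/-- The state at the end of round `t` (rounds are numbered from `1`) along the sequences of graphs
`G`, exploration sets `S`, played arms `a` and losses `l`. -/
def stateAt (lam γ β : ℝ) (G : ℕ → Digraph V) (S : ℕ → Finset V) (a : ℕ → V)
    (l : ℕ → V → ℝ) : ℕ → State V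
  | 0 => { Ltilde := 0, Lhat := 0, obs := 0, Theta := Fintype.card V }
  | t + 1 => step lam γ β (G (t + 1)) (t + 1) (S (t + 1)) (a (t + 1)) (l (t + 1))
      (stateAt lam γ β G S a l t)

end Round

section Run

variable {V Ω : Type*} [Fintype V] {mΩ : MeasurableSpace Ω}

/-- The random sequence `I` of played arms is produced by running EXP3.G++ with parameters
`lam, γ, β` on the graphs `G` and the (possibly random) losses `ℓ`, with exploration sets `S`.
`ℱ t` is the information available at the end of round `t`. -/
structure IsRun (lam γ β : ℝ) (μ : Measure Ω) (ℱ : Filtration ℕ mΩ) (G : ℕ → Digraph V)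
    (ℓ : ℕ → Ω → V → ℝ) (S : ℕ → Ω → Finset V) (I : ℕ → Ω → V) : Prop where
  losses_adapted : ∀ t, Measurable[ℱ (t + 1)] (ℓ (t + 1))
  arms_adapted : ∀ t i, MeasurableSet[ℱ (t + 1)] {ω | I (t + 1) ω = i}
  /-- in the first `K` rounds each arm is played once, in a deterministic order -/
  init : ∃ e : ℕ → V, Set.BijOn e (Set.Icc 1 (Fintype.card V)) Set.univ ∧
    ∀ t ∈ Set.Icc 1 (Fintype.card V), ∀ ω, I t ω = e t
  /-- in each later round an exploration set is computed before an arm is drawn -/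
  explorationSet_predictable : ∀ t, Fintype.card V ≤ t → ∀ i,
    MeasurableSet[ℱ t] {ω | i ∈ S (t + 1) ω}
  isExplorationSet : ∀ t, Fintype.card V ≤ t → ∀ ω,
    IsExplorationSet (G (t + 1))
      (gapEst γ (t + 1) (stateAt lam γ β G (S · ω) (I · ω) (ℓ · ω) t)) (S (t + 1) ω)
  /-- the arm is drawn from `p_{t + 1}`, given the past and the losses of the round -/
  sampling : ∀ t, Fintype.card V ≤ t → ∀ i,
    μ[Set.indicator {ω | I (t + 1) ω = i} (fun _ => (1 : ℝ)) |
        ℱ t ⊔ MeasurableSpace.comap (ℓ (t + 1)) inferInstance] =ᵐ[μ]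
      fun ω => playProb lam γ β (t + 1) (S (t + 1) ω)
        (stateAt lam γ β G (S · ω) (I · ω) (ℓ · ω) t) i

/-- The stochastic regime: the loss vectors take values in `[0, 1]^V`, all have the same law, and
the losses of each round are independent of all that happened before it (in particular of the
losses of the earlier rounds). -/
structure IsStochastic (μ : Measure Ω) (ℱ : Filtration ℕ mΩ) (ℓ : ℕ → Ω → V → ℝ) : Prop where
  mem_Icc : ∀ t ω i, ℓ (t + 1) ω i ∈ Set.Icc (0 : ℝ) 1
  identDistrib : ∀ t, IdentDistrib (ℓ (t + 1)) (ℓ 1) μ μ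
  indep : ∀ t, Indep (MeasurableSpace.comap (ℓ (t + 1)) inferInstance) (ℱ t) μ

/-- The pseudo-regret after `T` rounds. -/
def pseudoRegret (μ : Measure Ω) (ℓ : ℕ → Ω → V → ℝ) (I : ℕ → Ω → V) (T : ℕ) : ℝ :=
  (∫ ω, ∑ t ∈ Finset.Icc 1 T, ℓ t ω (I t ω) ∂μ) -
    ⨅ i, ∫ ω, ∑ t ∈ Finset.Icc 1 T, ℓ t ω i ∂μ

/-- The suboptimality gap of arm `i` in the stochastic regime. -/
def gap (μ : Measure Ω) (ℓ : ℕ → Ω → V → ℝ) (i : V) : ℝ :=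
  (∫ ω, ℓ 1 ω i ∂μ) - ⨅ j, ∫ ω, ℓ 1 ω j ∂μ

/-- The smallest positive value of `Δ` (and `0` if there is none). -/
def minGap (Δ : V → ℝ) : ℝ := sInf {d | 0 < d ∧ ∃ i, Δ i = d}

end Run

end

end FeedbackGraph

/-! One algorithm serves both regimes because exploration is capped. The cap makes the total
exploration of round $t$ of order $\sqrt{\ln K/t}$, which the worst case tolerates; below the cap it
follows the estimated gaps, as stochastic losses require.

Arbitrary losses. The normalised log-sum-exp potential grows in each round by at least the estimated
loss of $q_t$ minus $\frac{\eta_t}{2}\sum_i q_{t,i}x_{t,i}^2$, where $x_t$ is the loss estimate, and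
it does not drop when the learning rate is lowered (`sum_expWeights_le`). The estimates are unbiased
with conditional second moment at most $1/P_{t,i}$, and $q\le 2p$, so the quadratic terms have mean
at most $\mathbb E[\eta_t\theta_t]$. Since $\theta_t\le K=\theta_K$, the adaptive rate makes
$\sum_t\eta_t\theta_t$ telescope to $O(\sqrt{\ln K\sum_t\theta_t})$ (`sum_regret_le`). A weighted
Caro–Wei argument gives $\theta_t\le\alpha_t(2\ln(1/c)+1)$ when all playing probabilities are at
least $c$ (`sum_div_obsProb_le`), and here $c=(Kt)^{-2}$.

Stochastic losses. The greedy scan gives two facts: $S_t$ is strongly independent, so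
$|S_t|\le\tilde\alpha(G_t)$; and every arm has an in-neighbour in $S_t$ of no larger estimated gap,
so it is observed at least as often as if it explored for itself. Fix an arm of gap $d$ and a round
$N$ after a burn-in phase. From about round $dN/4$ on, all confidence intervals hold outside an
event of probability $O(1/(d^3N^2))$. Estimated gaps then do not exceed true ones, so the arm and an
optimal arm are observed with probability at least $\beta\ln N/(Nd^2)$ in each round. This has two
effects, outside another rare event: both empirical means are accurate enough for the estimated gap
to be at least $d/2$; and the cumulative loss estimates, whose total conditional variance is
$O(N^2d^2/\ln N)$, are separated by $Nd/4$, so the exponential weight of the arm is at most $1/N^2$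
(`exists_rare_event`). Hence the arm costs at most $4\beta\ln N/(Nd)+O(1/N^2)$ if it lies in $S_N$,
and $O(1/N^2)$ otherwise.

Summing $\ln N/N$ gives $\ln^2T$. At most $n$ rounds have $\tilde\alpha(G_t)>\tilde\alpha_n$, and
each costs at most 1 up to a summable remainder (`sum_regret_late_le`). The burn-in phase is paid
for by the worst-case bound with the crude estimate $\sum_t\theta_t\le KT$. -/

namespace FeedbackGraph

section Graph

open scoped Classical

variable {V : Type*}

/-! ## The exploration set -/

/-- Invariant of the scan, with an arbitrary starting set for the induction. An arm is inserted only
if no earlier selected arm points to it, so no two selected arms are joined both ways. A skipped arm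
has an earlier selected in-neighbour, whose gap is no larger because the list is sorted. -/
lemma foldl_greedy_spec (G : Digraph V) (g : V → ℝ) (arms : List V) (A : Finset V)
    (hA : G.toSimpleGraphStrict.IsIndepSet (A : Set V))
    (hle : ∀ i ∈ A, ∀ j ∈ arms, g i ≤ g j) (hs : arms.Pairwise (fun i j => g i ≤ g j)) :
    let R := arms.foldl (fun S j => if ∃ i ∈ S, G.Adj i j then S else insert j S) A
    G.toSimpleGraphStrict.IsIndepSet (R : Set V) ∧ A ⊆ R ∧
      ∀ j ∈ arms, j ∉ R → ∃ i ∈ R, G.Adj i j ∧ g i ≤ g j := by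
  induction arms generalizing A with
  | nil => simpa using hA
  | cons a l ih =>
    rw [List.pairwise_cons] at hs
    simp only [List.foldl_cons]
    by_cases h : ∃ i ∈ A, G.Adj i a
    · rw [if_pos h]
      obtain ⟨h1, h2, h3⟩ := ih A hA (fun i hi j hj => hle i hi j (by simp [hj])) hs.2
      refine ⟨h1, h2, fun j hj hjR => ?_⟩
      rcases List.mem_cons.1 hj with rfl | hj
      · obtain ⟨i, hi, hij⟩ := h
        exact ⟨i, h2 hi, hij, hle i hi j (by simp)⟩
      · exact h3 j hj hjR
    · rw [if_neg h]
      push Not at h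
      have hins : G.toSimpleGraphStrict.IsIndepSet ((insert a A : Finset V) : Set V) := by
        rw [Finset.coe_insert]
        exact Set.Pairwise.insert hA fun b hb _ =>
          ⟨fun hh => h b hb hh.2.2, fun hh => h b hb hh.2.1⟩
      obtain ⟨h1, h2, h3⟩ := ih (insert a A) hins (fun i hi j hj => by
        rcases Finset.mem_insert.1 hi with rfl | hi
        · exact hs.1 j hj
        · exact hle i hi j (by simp [hj])) hs.2
      refine ⟨h1, (Finset.subset_insert _ _).trans h2, fun j hj hjR => ?_⟩
      rcases List.mem_cons.1 hj with rfl | hj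
      · exact absurd (h2 (Finset.mem_insert_self _ _)) hjR
      · exact h3 j hj hjR

/-- Exploring the set suffices for all arms: a skipped arm is covered by an in-neighbour that looks
at least as good, a selected arm by its own self-loop. -/
lemma IsExplorationSet.exists_adj {G : Digraph V} {g : V → ℝ} {A : Finset V}
    (hG : ∀ i, G.Adj i i) (h : IsExplorationSet G g A) (j : V) :
    ∃ i ∈ A, G.Adj i j ∧ g i ≤ g j := by
  obtain ⟨arms, -, hmem, hs, rfl⟩ := h
  by_cases hj : j ∈ greedySet G arms
  · exact ⟨j, hj, hG j, le_rfl⟩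
  · exact (foldl_greedy_spec G g arms ∅ (by simp) (by simp) hs).2.2 j (hmem j) hj

/-! ## Independent sets and weighted neighbourhoods -/

/-- Weighted Caro–Wei bound. Delete the closed neighbourhood of a vertex `i₀` whose closed
neighbourhood has the least weight. The deleted terms add up to at most 1, since every denominator
is at least that of `i₀`; the denominators of the surviving vertices can only shrink, so induction
applies to the rest. -/
lemma exists_isIndepSet_sum_div_le_card (H : SimpleGraph V) (p : V → ℝ) (W : Finset V)
    (hp : ∀ i ∈ W, 0 < p i) :
    ∃ A ⊆ W, H.IsIndepSet (A : Set V) ∧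
      ∑ i ∈ W, p i / (∑ j ∈ W with j = i ∨ H.Adj i j, p j) ≤ A.card := by
  induction W using Finset.strongInduction with
  | H W ih =>
  rcases W.eq_empty_or_nonempty with rfl | hW
  · exact ⟨∅, by simp, by simp, by simp⟩
  set N : V → ℝ := fun i => ∑ j ∈ W with j = i ∨ H.Adj i j, p j with hN
  have hNpos : ∀ i ∈ W, 0 < N i := fun i hi =>
    Finset.sum_pos (fun j hj => hp j (Finset.mem_filter.1 hj).1) ⟨i, by simp [hi]⟩
  obtain ⟨i₀, hi₀, hmin⟩ := W.exists_min_image N hW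
  set B := W.filter (fun j => j = i₀ ∨ H.Adj i₀ j) with hB
  have hBW : B ⊆ W := Finset.filter_subset _ _
  have hi₀B : i₀ ∈ B := by simp [hB, hi₀]
  obtain ⟨A, hAW, hA, hsum⟩ := ih (W \ B)
    (Finset.sdiff_ssubset hBW ⟨i₀, hi₀B⟩) (fun i hi => hp i (Finset.mem_sdiff.1 hi).1)
  have hA' : ∀ a ∈ A, a ≠ i₀ ∧ ¬ H.Adj i₀ a := by
    intro a ha
    have := Finset.mem_sdiff.1 (hAW ha)
    simp only [hB, Finset.mem_filter, not_and, not_or] at this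
    exact this.2 this.1
  have hnot : i₀ ∉ A := fun h => (hA' i₀ h).1 rfl
  refine ⟨insert i₀ A, ?_, ?_, ?_⟩
  · exact Finset.insert_subset hi₀ (hAW.trans Finset.sdiff_subset)
  · rw [Finset.coe_insert]
    refine Set.Pairwise.insert hA fun b hb _ => ⟨(hA' b hb).2, fun h => (hA' b hb).2 h.symm⟩
  · rw [Finset.card_insert_of_notMem hnot, ← Finset.sum_sdiff hBW]
    push_cast
    refine add_le_add ?_ ?_
    · refine le_trans (Finset.sum_le_sum fun i hi => ?_) hsum
      have hiW := (Finset.mem_sdiff.1 hi).1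
      refine div_le_div_of_nonneg_left (hp i hiW).le ?_ ?_
      · exact Finset.sum_pos (fun j hj => hp j (Finset.mem_sdiff.1 (Finset.mem_filter.1 hj).1).1)
          ⟨i, by simpa using hi⟩
      · refine Finset.sum_le_sum_of_subset_of_nonneg
          (Finset.filter_subset_filter _ Finset.sdiff_subset) fun j hj _ => ?_
        exact (hp j (Finset.mem_filter.1 hj).1).le
    · calc ∑ i ∈ B, p i / N i ≤ ∑ i ∈ B, p i / N i₀ := Finset.sum_le_sum fun i hi =>
            div_le_div_of_nonneg_left (hp i (hBW hi)).le (hNpos i₀ hi₀) (hmin i (hBW hi))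
        _ = 1 := by rw [← Finset.sum_div]; exact div_self (hNpos i₀ hi₀).ne'

variable [Fintype V]

/-- Cauchy–Schwarz for $p=\sqrt{p/N}\sqrt{pN}$, where $N$ is the weight of the closed neighbourhood
and $\sum p/N$ is at most the independence number. -/
lemma sq_sum_le_indepNum_mul (H : SimpleGraph V) (p : V → ℝ) (W : Finset V)
    (hp : ∀ i ∈ W, 0 < p i) :
    (∑ i ∈ W, p i) ^ 2 ≤
      H.indepNum * ∑ i ∈ W, p i * (∑ j ∈ W with j = i ∨ H.Adj i j, p j) := by
  obtain ⟨A, -, hA, hsum⟩ := exists_isIndepSet_sum_div_le_card H p W hp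
  have hcard : (A.card : ℝ) ≤ H.indepNum := by exact_mod_cast hA.card_le_indepNum
  set N : V → ℝ := fun i => ∑ j ∈ W with j = i ∨ H.Adj i j, p j with hN
  have hNpos : ∀ i ∈ W, 0 < N i := fun i hi =>
    Finset.sum_pos (fun j hj => hp j (Finset.mem_filter.1 hj).1) ⟨i, by simp [hi]⟩
  calc (∑ i ∈ W, p i) ^ 2 ≤ (∑ i ∈ W, p i / N i) * ∑ i ∈ W, p i * N i := by
        refine Finset.sum_sq_le_sum_mul_sum_of_sq_le_mul W (fun i hi => ?_) (fun i hi => ?_)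
          fun i hi => ?_
        · exact (div_pos (hp i hi) (hNpos i hi)).le
        · exact (mul_pos (hp i hi) (hNpos i hi)).le
        · have := (hNpos i hi).ne'
          exact le_of_eq (by field_simp)
    _ ≤ _ := mul_le_mul_of_nonneg_right (hsum.trans hcard)
        (Finset.sum_nonneg fun i hi => (mul_pos (hp i hi) (hNpos i hi)).le)

/-- Some vertex of a weighted digraph is observed with a probability at least the `2α`-th part of
the total weight. -/
lemma exists_sum_le_mul_sum_adj (G : Digraph V) (hG : ∀ i, G.Adj i i) (p : V → ℝ) (W : Finset V)
    (hW : W.Nonempty) (hp : ∀ i ∈ W, 0 < p i) :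
    ∃ i ∈ W, ∑ j ∈ W, p j ≤ 2 * indepNumber G * ∑ j ∈ W with G.Adj j i, p j := by
  set P : V → ℝ := fun i => ∑ j ∈ W with G.Adj j i, p j with hP
  obtain ⟨i₀, hi₀, hmax⟩ := W.exists_max_image P hW
  refine ⟨i₀, hi₀, ?_⟩
  have hpW : 0 < ∑ j ∈ W, p j := Finset.sum_pos hp hW
  have h1 := sq_sum_le_indepNum_mul G.toSimpleGraphInclusive p W hp
  -- The sum of `p i * P i` is written once by in-arcs and once by out-arcs; an undirected edge
  -- comes from an arc in at least one of the two directions.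
  have h2 : ∑ i ∈ W, p i * (∑ j ∈ W with j = i ∨ G.toSimpleGraphInclusive.Adj i j, p j) ≤
      2 * ∑ i ∈ W, p i * P i := by
    have e1 : ∑ i ∈ W, p i * P i = ∑ i ∈ W, ∑ j ∈ W, if G.Adj j i then p i * p j else 0 := by
      refine Finset.sum_congr rfl fun i _ => ?_
      rw [hP, Finset.mul_sum, Finset.sum_filter]
    have e2 : ∑ i ∈ W, p i * P i = ∑ i ∈ W, ∑ j ∈ W, if G.Adj i j then p i * p j else 0 := by
      rw [e1, Finset.sum_comm]
      simp only [mul_comm]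
    rw [two_mul]
    nth_rewrite 1 [e1]
    rw [e2, ← Finset.sum_add_distrib]
    refine Finset.sum_le_sum fun i hi => ?_
    rw [Finset.mul_sum, Finset.sum_filter, ← Finset.sum_add_distrib]
    refine Finset.sum_le_sum fun j hj => ?_
    have hij := (mul_pos (hp i hi) (hp j hj)).le
    by_cases h : j = i
    · subst h
      simp only [true_or, if_true, hG]
      linarith
    · simp only [Digraph.toSimpleGraphInclusive, SimpleGraph.fromRel_adj, h, false_or]
      split_ifs with a b c c <;> first | linarith | (exfalso; tauto)
  have h3 : ∑ i ∈ W, p i * P i ≤ (∑ j ∈ W, p j) * P i₀ := by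
    rw [Finset.sum_mul]
    exact Finset.sum_le_sum fun i hi => mul_le_mul_of_nonneg_left (hmax i hi) (hp i hi).le
  have hα : (0 : ℝ) ≤ G.toSimpleGraphInclusive.indepNum := Nat.cast_nonneg _
  have h4 : (∑ i ∈ W, p i) * (∑ i ∈ W, p i) ≤
      (∑ i ∈ W, p i) * (2 * indepNumber G * P i₀) := by
    calc (∑ i ∈ W, p i) * (∑ i ∈ W, p i) = (∑ i ∈ W, p i) ^ 2 := by ring
      _ ≤ _ := h1
      _ ≤ G.toSimpleGraphInclusive.indepNum * (2 * ((∑ j ∈ W, p j) * P i₀)) := by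
        gcongr
        exact h2.trans (by linarith)
      _ = _ := by rw [indepNumber]; ring
  exact le_of_mul_le_mul_left h4 hpW

/-- Peel off a well observed vertex `i₀`. Its term is at most $2\alpha\,p_{i_0}/p(W)$, and $\ln x\le
x-1$ bounds this by $2\alpha(\ln p(W)-\ln p(W\setminus i_0))$. These differences telescope down to a
single vertex, whose term is 1 and whose weight is at least `c`. -/
lemma sum_div_sum_adj_le (G : Digraph V) (hG : ∀ i, G.Adj i i) (p : V → ℝ) (c : ℝ) (hc : 0 < c)
    (W : Finset V) (hW : W.Nonempty) (hp : ∀ i ∈ W, c ≤ p i) :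
    ∑ i ∈ W, p i / (∑ j ∈ W with G.Adj j i, p j) ≤
      2 * indepNumber G * Real.log ((∑ i ∈ W, p i) / c) + 1 := by
  induction W using Finset.strongInduction with
  | H W ih =>
  have hp0 : ∀ i ∈ W, 0 < p i := fun i hi => hc.trans_le (hp i hi)
  have hPpos : ∀ i ∈ W, 0 < ∑ j ∈ W with G.Adj j i, p j := fun i hi =>
    Finset.sum_pos (fun j hj => hp0 j (Finset.mem_filter.1 hj).1) ⟨i, by simp [hi, hG]⟩
  have hpW : 0 < ∑ j ∈ W, p j := Finset.sum_pos hp0 hW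
  have hα : (0 : ℝ) ≤ indepNumber G := Nat.cast_nonneg _
  obtain ⟨i₀, hi₀, hmax⟩ := exists_sum_le_mul_sum_adj G hG p W hW hp0
  rcases (W.erase i₀).eq_empty_or_nonempty with he | hne
  · have hWe : W = {i₀} := by
      rw [← Finset.insert_erase hi₀, he]; rfl
    have h1 : 0 ≤ Real.log ((∑ i ∈ W, p i) / c) := by
      apply Real.log_nonneg
      rw [le_div_iff₀ hc, hWe]
      simpa using hp i₀ hi₀
    have h2 : ∑ i ∈ W, p i / (∑ j ∈ W with G.Adj j i, p j) = 1 := by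
      rw [hWe]
      simp [Finset.filter_singleton, hG, (hp0 i₀ hi₀).ne']
    rw [h2]
    have : 0 ≤ 2 * indepNumber G * Real.log ((∑ i ∈ W, p i) / c) := by positivity
    linarith
  · have hpE : 0 < ∑ j ∈ W.erase i₀, p j :=
      Finset.sum_pos (fun j hj => hp0 j (Finset.mem_of_mem_erase hj)) hne
    have hIH := ih (W.erase i₀) (Finset.erase_ssubset hi₀) hne
      (fun i hi => hp i (Finset.mem_of_mem_erase hi))
    have hsplit := Finset.sum_erase_add W p hi₀
    rw [← Finset.sum_erase_add W _ hi₀]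
    have h1 : ∑ i ∈ W.erase i₀, p i / (∑ j ∈ W with G.Adj j i, p j) ≤
        ∑ i ∈ W.erase i₀, p i / (∑ j ∈ W.erase i₀ with G.Adj j i, p j) := by
      refine Finset.sum_le_sum fun i hi => ?_
      refine div_le_div_of_nonneg_left (hp0 i (Finset.mem_of_mem_erase hi)).le ?_ ?_
      · exact Finset.sum_pos
          (fun j hj => hp0 j (Finset.mem_of_mem_erase (Finset.mem_filter.1 hj).1))
          ⟨i, by simp [Finset.mem_of_mem_erase hi, hG, Finset.ne_of_mem_erase hi]⟩
      · exact Finset.sum_le_sum_of_subset_of_nonneg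
          (Finset.filter_subset_filter _ (Finset.erase_subset _ _))
          fun j hj _ => (hp0 j (Finset.mem_filter.1 hj).1).le
    have h2 : p i₀ / (∑ j ∈ W with G.Adj j i₀, p j) ≤
        2 * indepNumber G * (p i₀ / ∑ j ∈ W, p j) := by
      rw [div_le_iff₀ (hPpos i₀ hi₀), mul_comm (2 * (indepNumber G : ℝ)), mul_assoc,
        div_mul_eq_mul_div, le_div_iff₀ hpW]
      exact mul_le_mul_of_nonneg_left hmax (hp0 i₀ hi₀).le
    have h3 : p i₀ / ∑ j ∈ W, p j ≤
        Real.log ((∑ i ∈ W, p i) / c) - Real.log ((∑ i ∈ W.erase i₀, p i) / c) := by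
      rw [Real.log_div hpW.ne' hc.ne', Real.log_div hpE.ne' hc.ne']
      have h := Real.log_le_sub_one_of_pos (div_pos hpE hpW)
      rw [Real.log_div hpE.ne' hpW.ne'] at h
      have : p i₀ / ∑ j ∈ W, p j = 1 - (∑ j ∈ W.erase i₀, p j) / ∑ j ∈ W, p j := by
        rw [eq_sub_iff_add_eq, ← add_div, add_comm, hsplit, div_self hpW.ne']
      linarith
    have h4 := mul_le_mul_of_nonneg_left h3 (by positivity : (0 : ℝ) ≤ 2 * indepNumber G)
    linarith

lemma one_le_indepNumber [Nonempty V] (G : Digraph V) : 1 ≤ indepNumber G := by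
  obtain ⟨v⟩ := ‹Nonempty V›
  have : G.toSimpleGraphInclusive.IsIndepSet (({v} : Finset V) : Set V) := by simp
  simpa [indepNumber] using this.card_le_indepNum

lemma strongIndepNumber_le_card (G : Digraph V) : strongIndepNumber G ≤ Fintype.card V := by
  obtain ⟨s, hs⟩ := G.toSimpleGraphStrict.exists_isNIndepSet_indepNum
  rw [strongIndepNumber, ← hs.card_eq]
  exact s.card_le_univ

/-- The ratio of playing to observation probabilities is controlled by the independence number. -/
lemma sum_div_obsProb_le [Nonempty V] (G : Digraph V) (hG : ∀ i, G.Adj i i) (p : V → ℝ) (c : ℝ)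
    (hc : 0 < c) (hp : ∀ i, c ≤ p i) (hsum : ∑ i, p i = 1) :
    ∑ i, p i / obsProb G p i ≤ indepNumber G * (2 * Real.log (1 / c) + 1) := by
  have h := sum_div_sum_adj_le G hG p c hc Finset.univ Finset.univ_nonempty (fun i _ => hp i)
  rw [hsum] at h
  have h1 : (1 : ℝ) ≤ indepNumber G := by exact_mod_cast one_le_indepNumber G
  unfold obsProb
  linarith

lemma le_obsProb (G : Digraph V) (p : V → ℝ) (hp : ∀ i, 0 ≤ p i) {i j : V} (h : G.Adj j i) :
    p j ≤ obsProb G p i :=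
  Finset.single_le_sum (f := p) (fun k _ => hp k) (by simp [h])

lemma obsProb_le_one (G : Digraph V) (p : V → ℝ) (hp : ∀ i, 0 ≤ p i) (hsum : ∑ i, p i = 1)
    (i : V) : obsProb G p i ≤ 1 := by
  rw [← hsum]
  exact Finset.sum_le_sum_of_subset_of_nonneg (Finset.filter_subset _ _) fun j _ _ => hp j

lemma sum_div_obsProb_le_card (G : Digraph V) (hG : ∀ i, G.Adj i i) (p : V → ℝ)
    (hp : ∀ i, 0 < p i) : ∑ i, p i / obsProb G p i ≤ Fintype.card V := by
  calc ∑ i, p i / obsProb G p i ≤ ∑ _i : V, (1 : ℝ) := Finset.sum_le_sum fun i _ => by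
        have := le_obsProb G p (fun k => (hp k).le) (hG i)
        rw [div_le_one ((hp i).trans_le this)]
        exact this
    _ = _ := by simp

lemma IsExplorationSet.card_le {G : Digraph V} {g : V → ℝ} {A : Finset V}
    (h : IsExplorationSet G g A) : A.card ≤ strongIndepNumber G := by
  obtain ⟨arms, -, -, hs, rfl⟩ := h
  exact (foldl_greedy_spec G g arms ∅ (by simp) (by simp) hs).1.card_le_indepNum

end Graph


section RoundBounds

variable {V : Type*} [Fintype V]

/-! ## Exploration rates -/

variable (V) in
/-- The cap `(1/2) √(ln K / (t K²))` of the exploration rates at round `t`. -/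
noncomputable def rateCap (t : ℕ) : ℝ :=
  1 / 2 * √(Real.log (Fintype.card V) / (t * (Fintype.card V : ℝ) ^ 2))

lemma rateCap_antitone {s t : ℕ} (hs : 0 < s) (hst : s ≤ t) (hK : 2 ≤ Fintype.card V) :
    rateCap V t ≤ rateCap V s := by
  have hK' : (1 : ℝ) ≤ Fintype.card V := by exact_mod_cast (by omega : 1 ≤ Fintype.card V)
  have := Real.log_nonneg hK'
  have hs' : (0 : ℝ) < s := by exact_mod_cast hs
  unfold rateCap
  gcongr

lemma rateCap_eq (hK : 1 ≤ Fintype.card V) (t : ℕ) :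
    rateCap V t = √(Real.log (Fintype.card V)) / (2 * Fintype.card V * √t) := by
  unfold rateCap
  have hK' : (0 : ℝ) < Fintype.card V := by exact_mod_cast hK
  rw [mul_comm (t : ℝ), ← div_div, Real.sqrt_div' _ (by positivity),
    Real.sqrt_div' _ (by positivity),
    Real.sqrt_sq hK'.le]
  field_simp

lemma rateCap_le (hK : 1 ≤ Fintype.card V) {t : ℕ} (ht : Fintype.card V ≤ t) :
    rateCap V t ≤ 1 / (2 * Fintype.card V) := by
  have hK' : (1 : ℝ) ≤ Fintype.card V := by exact_mod_cast hK
  have ht' : (Fintype.card V : ℝ) ≤ t := by exact_mod_cast ht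
  have h : Real.log (Fintype.card V) ≤ t := (Real.log_le_self (by linarith)).trans ht'
  rw [rateCap_eq hK, ← div_div, div_right_comm]
  gcongr
  rw [div_le_one (by apply Real.sqrt_pos.2; linarith)]
  exact Real.sqrt_le_sqrt h

lemma explRate_nonneg {β : ℝ} (hβ : 0 ≤ β) (t : ℕ) (g : V → ℝ) (A : Finset V) (i : V) :
    0 ≤ explRate 1 β t g A i := by
  have := Real.log_natCast_nonneg t
  unfold explRate
  split_ifs <;> positivity

lemma explRate_le_rateCap (β : ℝ) (t : ℕ) (g : V → ℝ) (A : Finset V) (i : V) :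
    explRate 1 β t g A i ≤ rateCap V t := by
  unfold explRate rateCap
  simp only [one_mul]
  split_ifs <;> simp

lemma explRate_le_half_inv (β : ℝ) (t : ℕ) (g : V → ℝ) (A : Finset V) (i : V) :
    explRate 1 β t g A i ≤ 1 / (2 * Fintype.card V) := by
  unfold explRate
  simp only [one_mul]
  split_ifs
  · exact min_le_left _ _
  · exact (min_le_left _ _).trans (min_le_left _ _)
  · exact (min_le_left _ _).trans (min_le_left _ _)

lemma sum_explRate_le_half [Nonempty V] (β : ℝ) (t : ℕ) (g : V → ℝ) (A : Finset V) :
    ∑ i, explRate 1 β t g A i ≤ 1 / 2 := by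
  calc ∑ i, explRate 1 β t g A i ≤ ∑ _i : V, 1 / (2 * (Fintype.card V : ℝ)) :=
        Finset.sum_le_sum fun i _ => explRate_le_half_inv β t g A i
    _ = 1 / 2 := by
        have : (Fintype.card V : ℝ) ≠ 0 := by exact_mod_cast Fintype.card_ne_zero
        simp only [Finset.sum_const, Finset.card_univ, nsmul_eq_mul]
        field_simp

lemma explRate_le_of_mem {β : ℝ} (hβ : 0 ≤ β) (t : ℕ) (g : V → ℝ) (A : Finset V) {i : V}
    (hi : i ∈ A) {d : ℝ} (hd : 0 < d) (hg : d ≤ g i) :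
    explRate 1 β t g A i ≤ β * Real.log t / (t * d ^ 2) := by
  have hlog := Real.log_natCast_nonneg t
  unfold explRate
  simp only [if_pos hi, if_neg (hd.trans_le hg).ne']
  refine (min_le_right _ _).trans ?_
  rcases Nat.eq_zero_or_pos t with rfl | ht
  · simp
  · gcongr

lemma explRate_le_of_notMem (β : ℝ) (t : ℕ) (g : V → ℝ) (A : Finset V) {i : V}
    (hi : i ∉ A) : explRate 1 β t g A i ≤ 4 / (t : ℝ) ^ 2 := by
  unfold explRate
  simp only [if_neg hi]
  exact min_le_right _ _

lemma le_explRate_of_mem {β : ℝ} (hβ : 0 ≤ β) {t : ℕ} (hK : 1 ≤ Fintype.card V)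
    (ht : Fintype.card V ≤ t) {g : V → ℝ} (hg0 : ∀ i, 0 ≤ g i) {A : Finset V} {i : V}
    (hi : i ∈ A) {d : ℝ} (hg : g i ≤ d) :
    min (rateCap V t) (β * Real.log t / (t * d ^ 2)) ≤ explRate 1 β t g A i := by
  have hcap := rateCap_le hK ht
  have hlog := Real.log_natCast_nonneg t
  have hmin : rateCap V t ≤
      min (1 / (2 * (Fintype.card V : ℝ)))
        (1 / 2 * √(1 * Real.log (Fintype.card V) / (t * (Fintype.card V : ℝ) ^ 2))) := by
    rw [one_mul]
    exact le_min hcap le_rfl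
  unfold explRate
  simp only [if_pos hi]
  split_ifs with h0
  · exact (min_le_left _ _).trans hmin
  · refine le_min ((min_le_left _ _).trans hmin) ((min_le_right _ _).trans ?_)
    have hpos : 0 < g i := lt_of_le_of_ne (hg0 i) (Ne.symm h0)
    have ht' : (0 : ℝ) < t := by exact_mod_cast (by omega : 0 < t)
    gcongr

/-- This is the purpose of the rate $4/t^2$ outside the exploration set. A polynomially small
probability enters the bound on `θ` only through its logarithm, and it keeps the importance weights
bounded, as integrability requires. -/
lemma inv_sq_le_explRate {β : ℝ} (hβ : 2 ≤ β) {t : ℕ} (hK : 2 ≤ Fintype.card V)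
    (ht : Fintype.card V < t) {g : V → ℝ} (hg0 : ∀ i, 0 ≤ g i) (hg1 : ∀ i, g i ≤ 1)
    (A : Finset V) (i : V) :
    1 / ((Fintype.card V : ℝ) * t) ^ 2 ≤ explRate 1 β t g A i := by
  have hK' : (2 : ℝ) ≤ Fintype.card V := by exact_mod_cast hK
  have ht' : (3 : ℝ) ≤ t := by exact_mod_cast (by omega : 3 ≤ t)
  set k : ℝ := (Fintype.card V : ℝ) with hk
  have hlogk : 1 / 2 ≤ Real.log k :=
    (by linarith [Real.log_two_gt_d9] : 1 / 2 ≤ Real.log 2).trans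
      (Real.log_le_log (by norm_num) hK')
  have hlogt : 1 / 2 ≤ Real.log t :=
    (by linarith [Real.log_two_gt_d9] : 1 / 2 ≤ Real.log 2).trans
      (Real.log_le_log (by norm_num) (by linarith))
  have hcap : 1 / (k * t) ^ 2 ≤ rateCap V t := by
    rw [rateCap_eq (by omega), div_le_div_iff₀ (by positivity) (by positivity), one_mul]
    have h1 : √t ≤ t := by
      rw [Real.sqrt_le_left (by linarith)]
      nlinarith
    have h2 : 1 / 2 ≤ √(Real.log k) := Real.le_sqrt_of_sq_le (by linarith)
    have h3 : 2 * k * √t ≤ 2 * k * t := by gcongr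
    have h4 : 1 / 2 * (k * t) ^ 2 ≤ √(Real.log k) * (k * t) ^ 2 := by gcongr
    have h5 : 6 ≤ k * t := by nlinarith
    have h6 : 6 * (k * t) ≤ (k * t) ^ 2 := by nlinarith
    linarith
  by_cases hi : i ∈ A
  · refine le_trans (le_min hcap ?_)
      (le_explRate_of_mem (by linarith) (by omega) ht.le hg0 hi (hg1 i))
    rw [one_pow, mul_one, div_le_div_iff₀ (by positivity) (by positivity), one_mul]
    have h1 : 1 ≤ β * Real.log t := by nlinarith
    have h2 : (t : ℝ) ≤ k * t := le_mul_of_one_le_left (by linarith) (by linarith)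
    have h3 : (t : ℝ) ≤ (k * t) ^ 2 := by nlinarith
    exact h3.trans (le_mul_of_one_le_left (by positivity) h1)
  · unfold explRate
    simp only [if_neg hi, one_mul]
    refine le_min (le_min (hcap.trans (rateCap_le (by omega) ht.le)) hcap) ?_
    rw [div_le_div_iff₀ (by positivity) (by positivity), mul_pow]
    have : 1 * (t : ℝ) ^ 2 ≤ k ^ 2 * t ^ 2 := by gcongr; nlinarith
    nlinarith

/-! ## Gap estimates -/

/-- Every cumulative observed loss lies between `0` and the number of observations. -/
def State.IsValid (st : State V) : Prop := ∀ i, 0 ≤ st.Lhat i ∧ st.Lhat i ≤ st.obs i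

lemma gapEst_nonneg (γ : ℝ) (t : ℕ) (st : State V) (i : V) : 0 ≤ gapEst γ t st i :=
  le_max_left _ _

lemma ucb_nonneg {γ : ℝ} {t : ℕ} {st : State V} (h : st.IsValid) (i : V) : 0 ≤ ucb γ t st i :=
  le_min zero_le_one
    (add_nonneg (div_nonneg (h i).1 (Nat.cast_nonneg _)) (Real.sqrt_nonneg _))

lemma gapEst_le_one (γ : ℝ) (t : ℕ) {st : State V} (h : st.IsValid) (i : V) :
    gapEst γ t st i ≤ 1 := by
  have h1 : lcb γ t st i ≤ 1 := max_le zero_le_one (by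
    have h2 := div_le_one_of_le₀ (h i).2 (Nat.cast_nonneg _)
    linarith [Real.sqrt_nonneg
      (γ * Real.log (t * (Fintype.card V : ℝ) ^ (1 / γ)) / (2 * st.obs i))])
  have h3 : 0 ≤ ⨅ j, ucb γ t st j := Real.iInf_nonneg fun j => ucb_nonneg h j
  exact max_le zero_le_one (by linarith)

/-! ## Playing and observation probabilities -/

variable [Nonempty V]

lemma expWeight_pos (st : State V) (i : V) : 0 < expWeight st i :=
  div_pos (Real.exp_pos _) (Finset.sum_pos (fun _ _ => Real.exp_pos _) Finset.univ_nonempty)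

lemma sum_expWeight (st : State V) : ∑ i, expWeight st i = 1 := by
  unfold expWeight
  rw [← Finset.sum_div]
  exact div_self (Finset.sum_pos (fun _ _ => Real.exp_pos _) Finset.univ_nonempty).ne'

lemma expWeight_le_one (st : State V) (i : V) : expWeight st i ≤ 1 := by
  rw [← sum_expWeight st]
  exact Finset.single_le_sum (fun j _ => (expWeight_pos st j).le) (Finset.mem_univ i)

lemma expWeight_le_exp (st : State V) (i j : V) :
    expWeight st i ≤ Real.exp (-learningRate st * (st.Ltilde i - st.Ltilde j)) := by
  unfold expWeight
  rw [div_le_iff₀ (Finset.sum_pos (fun _ _ => Real.exp_pos _) Finset.univ_nonempty)]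
  calc Real.exp (-learningRate st * st.Ltilde i) =
        Real.exp (-learningRate st * (st.Ltilde i - st.Ltilde j)) *
          Real.exp (-learningRate st * st.Ltilde j) := by rw [← Real.exp_add]; ring_nf
    _ ≤ _ := by
        gcongr
        exact Finset.single_le_sum (f := fun j => Real.exp (-learningRate st * st.Ltilde j))
          (fun j _ => (Real.exp_pos _).le) (Finset.mem_univ j)

lemma sum_playProb (β γ : ℝ) (t : ℕ) (A : Finset V) (st : State V) :
    ∑ i, playProb 1 γ β t A st i = 1 := by
  unfold playProb
  rw [Finset.sum_add_distrib, ← Finset.mul_sum, sum_expWeight]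
  ring

lemma half_expWeight_add_le_playProb (β γ : ℝ) (t : ℕ) (A : Finset V) (st : State V)
    (i : V) :
    1 / 2 * expWeight st i + explRate 1 β t (gapEst γ t st) A i ≤ playProb 1 γ β t A st i := by
  have h1 := sum_explRate_le_half β t (gapEst γ t st) A
  have h2 := (expWeight_pos st i).le
  unfold playProb
  nlinarith

lemma playProb_pos {β : ℝ} (hβ : 0 ≤ β) (γ : ℝ) (t : ℕ) (A : Finset V) (st : State V) (i : V) :
    0 < playProb 1 γ β t A st i := by
  have := half_expWeight_add_le_playProb β γ t A st i
  have := expWeight_pos st i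
  have := explRate_nonneg hβ t (gapEst γ t st) A i
  linarith

lemma explRate_le_playProb (β γ : ℝ) (t : ℕ) (A : Finset V) (st : State V) (i : V) :
    explRate 1 β t (gapEst γ t st) A i ≤ playProb 1 γ β t A st i := by
  have := half_expWeight_add_le_playProb β γ t A st i
  have := expWeight_pos st i
  linarith

lemma expWeight_le_two_mul_playProb {β : ℝ} (hβ : 0 ≤ β) (γ : ℝ) (t : ℕ) (A : Finset V)
    (st : State V) (i : V) : expWeight st i ≤ 2 * playProb 1 γ β t A st i := by
  have := half_expWeight_add_le_playProb β γ t A st i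
  have := explRate_nonneg hβ t (gapEst γ t st) A i
  linarith

lemma playProb_le_add {β : ℝ} (hβ : 0 ≤ β) (γ : ℝ) (t : ℕ) (A : Finset V) (st : State V) (i : V) :
    playProb 1 γ β t A st i ≤ expWeight st i + explRate 1 β t (gapEst γ t st) A i := by
  have h1 : 0 ≤ ∑ j, explRate 1 β t (gapEst γ t st) A j :=
    Finset.sum_nonneg fun j _ => explRate_nonneg hβ t (gapEst γ t st) A j
  have := expWeight_pos st i
  unfold playProb
  nlinarith

lemma playProb_le_one {β : ℝ} (hβ : 0 ≤ β) (γ : ℝ) (t : ℕ) (A : Finset V) (st : State V) (i : V) :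
    playProb 1 γ β t A st i ≤ 1 := by
  exact (Finset.single_le_sum (fun j _ => (playProb_pos hβ γ t A st j).le)
    (Finset.mem_univ i)).trans (sum_playProb β γ t A st).le

/-- Every arm is observed at least as often as it would be if it were explored itself. -/
lemma min_le_obsProb {β γ : ℝ} (hβ : 0 ≤ β) {t : ℕ} (ht : Fintype.card V ≤ t) {G : Digraph V}
    (hG : ∀ i, G.Adj i i) {A : Finset V} {st : State V}
    (hA : IsExplorationSet G (gapEst γ t st) A) {i : V} {d : ℝ} (hd : gapEst γ t st i ≤ d) :
    min (rateCap V t) (β * Real.log t / (t * d ^ 2)) ≤ obsProb G (playProb 1 γ β t A st) i := by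
  obtain ⟨j, hjA, hji, hle⟩ := hA.exists_adj hG i
  calc _ ≤ explRate 1 β t (gapEst γ t st) A j :=
        le_explRate_of_mem hβ Fintype.card_pos ht (gapEst_nonneg γ t st) hjA (hle.trans hd)
    _ ≤ playProb 1 γ β t A st j := explRate_le_playProb β γ t A st j
    _ ≤ _ := le_obsProb G _ (fun k => (playProb_pos hβ γ t A st k).le) hji

lemma obsProb_pos {β : ℝ} (hβ : 0 ≤ β) (γ : ℝ) (t : ℕ) {G : Digraph V} (hG : ∀ i, G.Adj i i)
    (A : Finset V) (st : State V) (i : V) : 0 < obsProb G (playProb 1 γ β t A st) i :=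
  (playProb_pos hβ γ t A st i).trans_le
    (le_obsProb G _ (fun k => (playProb_pos hβ γ t A st k).le) (hG i))

lemma inv_sq_le_obsProb {β : ℝ} (hβ : 2 ≤ β) (γ : ℝ) {t : ℕ} (hK : 2 ≤ Fintype.card V)
    (ht : Fintype.card V < t) {G : Digraph V} (hG : ∀ i, G.Adj i i)
    (A : Finset V) {st : State V} (hst : st.IsValid) (i : V) :
    1 / ((Fintype.card V : ℝ) * t) ^ 2 ≤ obsProb G (playProb 1 γ β t A st) i :=
  ((inv_sq_le_explRate hβ hK ht (gapEst_nonneg γ t st) (gapEst_le_one γ t hst) A i).trans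
    (explRate_le_playProb β γ t A st i)).trans
    (le_obsProb G _ (fun k => (playProb_pos (by linarith) γ t A st k).le) (hG i))

lemma sum_playProb_div_obsProb_le {β : ℝ} (hβ : 2 ≤ β) (γ : ℝ) {t : ℕ} (hK : 2 ≤ Fintype.card V)
    (ht : Fintype.card V < t) {G : Digraph V} (hG : ∀ i, G.Adj i i)
    (A : Finset V) {st : State V} (hst : st.IsValid) :
    ∑ i, playProb 1 γ β t A st i / obsProb G (playProb 1 γ β t A st) i ≤
      indepNumber G * (4 * Real.log (Fintype.card V * t) + 1) := by
  have hK' : (0 : ℝ) < Fintype.card V := by exact_mod_cast (by omega : 0 < Fintype.card V)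
  have ht' : (0 : ℝ) < t := by exact_mod_cast (by omega : 0 < t)
  have h := sum_div_obsProb_le G hG (playProb 1 γ β t A st)
    (1 / ((Fintype.card V : ℝ) * t) ^ 2) (by positivity)
    (fun i => (inv_sq_le_explRate hβ hK ht (gapEst_nonneg γ t st) (gapEst_le_one γ t hst) A i).trans
      (explRate_le_playProb β γ t A st i)) (sum_playProb β γ t A st)
  rw [one_div_one_div, Real.log_pow] at h
  refine h.trans (le_of_eq ?_)
  push_cast
  ring

end RoundBounds


section ExponentialWeights

variable {V : Type*} [Fintype V]

/-! ## The potential of exponential weights with a decreasing learning rate -/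

/-- Since $(1-y+y^2/2)(1+y+y^2/2)=1+y^4/4\ge1$ and the second factor is at most $e^y$. -/
lemma exp_neg_le_quadratic {y : ℝ} (hy : 0 ≤ y) : Real.exp (-y) ≤ 1 - y + y ^ 2 / 2 := by
  have h := Real.quadratic_le_exp_of_nonneg hy
  rw [Real.exp_neg, inv_le_iff_one_le_mul₀ (Real.exp_pos y)]
  have h1 : 0 ≤ 1 - y + y ^ 2 / 2 := by nlinarith [sq_nonneg (y - 1)]
  calc (1 : ℝ) ≤ (1 - y + y ^ 2 / 2) * (1 + y + y ^ 2 / 2) := by nlinarith [sq_nonneg (y ^ 2)]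
    _ ≤ _ := mul_le_mul_of_nonneg_left h h1

/-- The potential `-(1/η) ln ((1/K) ∑ exp (-η L i))`. -/
noncomputable def expPotential (η : ℝ) (L : V → ℝ) : ℝ :=
  -(1 / η) * Real.log ((∑ i, Real.exp (-η * L i)) / Fintype.card V)

variable [Nonempty V]

lemma sum_exp_pos (η : ℝ) (L : V → ℝ) : 0 < ∑ i, Real.exp (-η * L i) :=
  Finset.sum_pos (fun _ _ => Real.exp_pos _) Finset.univ_nonempty

lemma expPotential_zero (η : ℝ) : expPotential η (0 : V → ℝ) = 0 := by
  have : (Fintype.card V : ℝ) ≠ 0 := by exact_mod_cast Fintype.card_ne_zero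
  simp [expPotential, this]

lemma expPotential_le {η : ℝ} (hη : 0 < η) (L : V → ℝ) (i : V) :
    expPotential η L ≤ L i + Real.log (Fintype.card V) / η := by
  have hK : (0 : ℝ) < Fintype.card V := by exact_mod_cast Fintype.card_pos
  have h1 : -η * L i ≤ Real.log (∑ j, Real.exp (-η * L j)) := by
    rw [Real.le_log_iff_exp_le (sum_exp_pos η L)]
    exact Finset.single_le_sum (f := fun j => Real.exp (-η * L j))
      (fun j _ => (Real.exp_pos _).le) (Finset.mem_univ i)
  unfold expPotential
  rw [Real.log_div (sum_exp_pos η L).ne' hK.ne', one_div, div_eq_inv_mul (Real.log _) η]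
  have h2 := mul_le_mul_of_nonneg_left h1 (inv_pos.2 hη).le
  have h3 : η⁻¹ * (-η * L i) = -L i := by field_simp
  rw [h3] at h2
  linarith

/-- The power mean inequality with exponent `η / η'`. The normalisation by the number of arms makes
it applicable, so that lowering the learning rate costs nothing. -/
lemma expPotential_antitone {η η' : ℝ} (hη' : 0 < η') (h : η' ≤ η) (L : V → ℝ) :
    expPotential η L ≤ expPotential η' L := by
  have hK : (0 : ℝ) < Fintype.card V := by exact_mod_cast Fintype.card_pos
  have hη : 0 < η := hη'.trans_le h
  have h1 := Real.rpow_arith_mean_le_arith_mean_rpow Finset.univ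
    (fun _ : V => 1 / (Fintype.card V : ℝ)) (fun i => Real.exp (-η' * L i))
    (fun _ _ => by positivity) (by simp [hK.ne']) (fun _ _ => (Real.exp_pos _).le)
    (p := η / η') ((one_le_div hη').2 h)
  simp only [← Real.exp_mul, one_div, ← div_eq_inv_mul, ← Finset.sum_div] at h1
  have h2 : ∀ i, -η' * L i * (η / η') = -η * L i := fun i => by field_simp
  simp only [h2] at h1
  have hpos' := div_pos (sum_exp_pos η' L) hK
  have h3 := Real.log_le_log (Real.rpow_pos_of_pos hpos' _) h1
  rw [Real.log_rpow hpos'] at h3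
  unfold expPotential
  have h4 := mul_le_mul_of_nonneg_left h3 (one_div_pos.2 hη).le
  have h5 : 1 / η * (η / η' * Real.log ((∑ i, Real.exp (-η' * L i)) / Fintype.card V)) =
      1 / η' * Real.log ((∑ i, Real.exp (-η' * L i)) / Fintype.card V) := by field_simp
  rw [h5] at h4
  linarith

/-- The increment is $-\frac1\eta\ln\sum_i q_ie^{-\eta x_i}$; apply $e^{-y}\le1-y+y^2/2$ and then
$\ln r\le r-1$. Only $x\ge0$ is needed, so the estimates may be arbitrarily large. -/
lemma le_expPotential_add_sub {η : ℝ} (hη : 0 < η) (L x : V → ℝ) (hx : ∀ i, 0 ≤ x i) (q : V → ℝ)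
    (hq : ∀ i, q i = Real.exp (-η * L i) / ∑ j, Real.exp (-η * L j)) :
    ∑ i, q i * x i - η / 2 * ∑ i, q i * x i ^ 2 ≤
      expPotential η (fun i => L i + x i) - expPotential η L := by
  have hK : (0 : ℝ) < Fintype.card V := by exact_mod_cast Fintype.card_pos
  have hS := sum_exp_pos η L
  have hq0 : ∀ i, 0 ≤ q i := fun i => by rw [hq]; positivity
  have hq1 : ∑ i, q i = 1 := by
    simp only [hq, ← Finset.sum_div]
    exact div_self hS.ne'
  have hfac : ∑ i, Real.exp (-η * (L i + x i)) =
      (∑ i, Real.exp (-η * L i)) * ∑ i, q i * Real.exp (-(η * x i)) := by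
    rw [Finset.mul_sum]
    refine Finset.sum_congr rfl fun i _ => ?_
    rw [hq, show -η * (L i + x i) = -η * L i + -(η * x i) by ring, Real.exp_add]
    field_simp
  have hR : 0 < ∑ i, q i * Real.exp (-(η * x i)) := by
    have := sum_exp_pos η (fun i => L i + x i)
    rw [hfac] at this
    exact pos_of_mul_pos_right this hS.le
  have hle : ∑ i, q i * Real.exp (-(η * x i)) ≤
      1 + (-(η * ∑ i, q i * x i) + η ^ 2 / 2 * ∑ i, q i * x i ^ 2) := by
    calc ∑ i, q i * Real.exp (-(η * x i)) ≤ ∑ i, q i * (1 - η * x i + (η * x i) ^ 2 / 2) :=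
          Finset.sum_le_sum fun i _ => mul_le_mul_of_nonneg_left
            (exp_neg_le_quadratic (mul_nonneg hη.le (hx i))) (hq0 i)
      _ = ∑ i, (q i + (-(η * (q i * x i)) + η ^ 2 / 2 * (q i * x i ^ 2))) :=
          Finset.sum_congr rfl fun i _ => by ring
      _ = _ := by
          rw [Finset.sum_add_distrib, Finset.sum_add_distrib, Finset.sum_neg_distrib,
            ← Finset.mul_sum, ← Finset.mul_sum, hq1]
  have hlog := Real.log_le_sub_one_of_pos hR
  have hdiff : expPotential η (fun i => L i + x i) - expPotential η L =
      -(1 / η) * Real.log (∑ i, q i * Real.exp (-(η * x i))) := by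
    unfold expPotential
    rw [hfac, mul_div_right_comm, Real.log_mul (div_pos hS hK).ne' hR.ne']
    ring
  rw [hdiff]
  have h1 : Real.log (∑ i, q i * Real.exp (-(η * x i))) ≤
      -(η * ∑ i, q i * x i) + η ^ 2 / 2 * ∑ i, q i * x i ^ 2 := by linarith
  have h2 := mul_le_mul_of_nonneg_left h1 (one_div_pos.2 hη).le
  have h3 : 1 / η * (-(η * ∑ i, q i * x i) + η ^ 2 / 2 * ∑ i, q i * x i ^ 2) =
      -(∑ i, q i * x i - η / 2 * ∑ i, q i * x i ^ 2) := by field_simp; ring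
  rw [h3] at h2
  linarith

/-- The regret bound of exponential weights with nonincreasing learning rates. -/
lemma sum_expWeights_le (η : ℕ → ℝ) (hη : ∀ n, 0 < η n) (hanti : ∀ n, η (n + 1) ≤ η n)
    (L x q : ℕ → V → ℝ) (hL0 : L 0 = 0) (hL : ∀ n i, L (n + 1) i = L n i + x n i)
    (hx : ∀ n i, 0 ≤ x n i)
    (hq : ∀ n i, q n i = Real.exp (-η n * L n i) / ∑ j, Real.exp (-η n * L n j)) (n : ℕ) (i : V) :
    ∑ s ∈ Finset.range n, (∑ i, q s i * x s i - η s / 2 * ∑ i, q s i * x s i ^ 2) ≤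
      L n i + Real.log (Fintype.card V) / η n := by
  suffices h : ∑ s ∈ Finset.range n, (∑ i, q s i * x s i - η s / 2 * ∑ i, q s i * x s i ^ 2) ≤
      expPotential (η n) (L n) from h.trans (expPotential_le (hη n) _ i)
  induction n with
  | zero => simp [hL0, expPotential_zero]
  | succ n ih =>
    rw [Finset.sum_range_succ]
    have h1 := le_expPotential_add_sub (hη n) (L n) (x n) (hx n) (q n) (hq n)
    have h2 := expPotential_antitone (hη (n + 1)) (hanti n) (L (n + 1))
    have h3 : L (n + 1) = fun i => L n i + x n i := funext (hL n)
    rw [← h3] at h1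
    linarith

/-- The learning rate lags: its sum does not contain the current `θ`. As $\theta\le a$, one has
$\sqrt{a+\theta}\le\frac32\sqrt a$, so the lag only turns the usual factor 2 into $1+\frac32$. -/
lemma div_sqrt_le {a θ : ℝ} (ha : 0 < a) (hθ : 0 ≤ θ) (h : θ ≤ a) :
    θ / √a ≤ 5 / 2 * (√(a + θ) - √a) := by
  have h1 := Real.sqrt_pos.2 ha
  have h2 : √a ≤ √(a + θ) := Real.sqrt_le_sqrt (by linarith)
  have h3 : √(a + θ) ≤ 3 / 2 * √a := by
    rw [Real.sqrt_le_left (by positivity), mul_pow, Real.sq_sqrt ha.le]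
    linarith
  have h4 := Real.sq_sqrt ha.le
  have h5 := Real.sq_sqrt (by linarith : 0 ≤ a + θ)
  rw [div_le_iff₀ h1]
  calc θ = (√(a + θ) - √a) * (√(a + θ) + √a) := by nlinarith
    _ ≤ (√(a + θ) - √a) * (5 / 2 * √a) :=
        mul_le_mul_of_nonneg_left (by linarith) (by linarith)
    _ = _ := by ring

lemma sum_div_sqrt_le (Θ θ : ℕ → ℝ) (h0 : 0 < Θ 0) (hΘ : ∀ n, Θ (n + 1) = Θ n + θ n)
    (hθ0 : ∀ n, 0 ≤ θ n) (hθ : ∀ n, θ n ≤ Θ 0) (n : ℕ) :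
    ∑ s ∈ Finset.range n, θ s / √(Θ s) ≤ 5 / 2 * √(Θ n) := by
  have hge : ∀ n, Θ 0 ≤ Θ n := fun n => by
    induction n with
    | zero => exact le_rfl
    | succ n ih => rw [hΘ]; linarith [hθ0 n]
  induction n with
  | zero => simp
  | succ n ih =>
    rw [Finset.sum_range_succ, hΘ]
    have := div_sqrt_le (h0.trans_le (hge n)) (hθ0 n) ((hθ n).trans (hge n))
    linarith

lemma sum_inv_sqrt_le (n : ℕ) : ∑ s ∈ Finset.range n, 1 / √((s : ℝ) + 1) ≤ 2 * √n := by
  induction n with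
  | zero => simp
  | succ n ih =>
    rw [Finset.sum_range_succ]
    push_cast
    have h1 : (0 : ℝ) < √((n : ℝ) + 1) := Real.sqrt_pos.2 (by positivity)
    have h2 := Real.sq_sqrt (by positivity : (0 : ℝ) ≤ (n : ℝ) + 1)
    have h3 := Real.sq_sqrt (by positivity : (0 : ℝ) ≤ (n : ℝ))
    have h4 : 1 / √((n : ℝ) + 1) ≤ 2 * √((n : ℝ) + 1) - 2 * √n := by
      rw [div_le_iff₀ h1]
      nlinarith [sq_nonneg (√((n : ℝ) + 1) - √n)]
    linarith

end ExponentialWeights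


section BoundedMeasurable

/-! ## Bounded measurable functions -/

variable {Ω : Type*}

/-- A real function that is measurable with respect to `m` and bounded. -/
def BddMeas (m : MeasurableSpace Ω) (f : Ω → ℝ) : Prop :=
  Measurable[m] f ∧ ∃ C, ∀ ω, |f ω| ≤ C

namespace BddMeas

variable {m m' mΩ : MeasurableSpace Ω} {f g : Ω → ℝ}

lemma const (c : ℝ) : BddMeas m (fun _ => c) := ⟨measurable_const, |c|, fun _ => le_rfl⟩

lemma mono (hm : m ≤ m') (hf : BddMeas m f) : BddMeas m' f := ⟨hf.1.mono hm le_rfl, hf.2⟩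

lemma of_mem_Icc (hf : Measurable[m] f) {a b : ℝ} (h : ∀ ω, f ω ∈ Set.Icc a b) : BddMeas m f :=
  ⟨hf, max |a| |b|, fun ω => abs_le_max_abs_abs (h ω).1 (h ω).2⟩

lemma add (hf : BddMeas m f) (hg : BddMeas m g) : BddMeas m (fun ω => f ω + g ω) := by
  obtain ⟨C, hC⟩ := hf.2
  obtain ⟨D, hD⟩ := hg.2
  exact ⟨hf.1.add hg.1, C + D, fun ω => (abs_add_le _ _).trans (add_le_add (hC ω) (hD ω))⟩

lemma mul (hf : BddMeas m f) (hg : BddMeas m g) : BddMeas m (fun ω => f ω * g ω) := by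
  obtain ⟨C, hC⟩ := hf.2
  obtain ⟨D, hD⟩ := hg.2
  refine ⟨hf.1.mul hg.1, C * D, fun ω => ?_⟩
  rw [abs_mul]
  exact mul_le_mul (hC ω) (hD ω) (abs_nonneg _) ((abs_nonneg _).trans (hC ω))

lemma const_mul (c : ℝ) (hf : BddMeas m f) : BddMeas m (fun ω => c * f ω) := (const c).mul hf

lemma neg (hf : BddMeas m f) : BddMeas m (fun ω => -f ω) := by
  simpa using hf.const_mul (-1)

lemma sub (hf : BddMeas m f) (hg : BddMeas m g) : BddMeas m (fun ω => f ω - g ω) := by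
  simpa [sub_eq_add_neg] using hf.add hg.neg

lemma pow_two (hf : BddMeas m f) : BddMeas m (fun ω => f ω ^ 2) := by
  simpa [sq] using hf.mul hf

lemma sum {ι : Type*} (s : Finset ι) {f : ι → Ω → ℝ} (hf : ∀ i ∈ s, BddMeas m (f i)) :
    BddMeas m (fun ω => ∑ i ∈ s, f i ω) := by
  classical
  induction s using Finset.induction_on with
  | empty => simpa using const 0
  | insert a s ha ih =>
    simp only [Finset.sum_insert ha]
    exact (hf a (by simp)).add (ih fun i hi => hf i (by simp [hi]))

lemma exp (hf : BddMeas m f) : BddMeas m (fun ω => Real.exp (f ω)) := by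
  obtain ⟨C, hC⟩ := hf.2
  refine ⟨hf.1.exp, Real.exp C, fun ω => ?_⟩
  rw [abs_of_pos (Real.exp_pos _)]
  exact Real.exp_le_exp.2 ((le_abs_self _).trans (hC ω))

lemma inv_of_le (hf : Measurable[m] f) {c : ℝ} (hc : 0 < c) (h : ∀ ω, c ≤ f ω) :
    BddMeas m (fun ω => (f ω)⁻¹) := by
  refine ⟨hf.inv, c⁻¹, fun ω => ?_⟩
  rw [abs_of_pos (inv_pos.2 (hc.trans_le (h ω)))]
  exact inv_anti₀ hc (h ω)

lemma ite {p : Ω → Prop} [DecidablePred p] (hp : MeasurableSet[m] {ω | p ω}) (hf : BddMeas m f)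
    (hg : BddMeas m g) : BddMeas m (fun ω => if p ω then f ω else g ω) := by
  obtain ⟨C, hC⟩ := hf.2
  obtain ⟨D, hD⟩ := hg.2
  refine ⟨Measurable.ite hp hf.1 hg.1, max C D, fun ω => ?_⟩
  dsimp only
  split_ifs
  · exact (hC ω).trans (le_max_left _ _)
  · exact (hD ω).trans (le_max_right _ _)

lemma integrable {μ : Measure Ω} [IsFiniteMeasure μ] (hm : m ≤ mΩ) (hf : BddMeas m f) :
    Integrable f μ := by
  obtain ⟨C, hC⟩ := hf.2
  exact Integrable.of_bound (hf.1.mono hm le_rfl).aestronglyMeasurable C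
    (Filter.Eventually.of_forall hC)

end BddMeas

end BoundedMeasurable

section Measurability

/-! ## Measurability of the variables of the algorithm -/

variable {V Ω : Type*} [Fintype V] {m : MeasurableSpace Ω} {st : Ω → State V}

lemma measurable_gapEst (γ : ℝ) (t : ℕ) (hL : ∀ i, Measurable[m] fun ω => (st ω).Lhat i)
    (hO : ∀ i, Measurable[m] fun ω => ((st ω).obs i : ℝ)) (i : V) :
    Measurable[m] fun ω => gapEst γ t (st ω) i := by
  have h1 : ∀ i, Measurable[m] fun ω => √(γ * Real.log (t * (Fintype.card V : ℝ) ^ (1 / γ)) /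
      (2 * (st ω).obs i)) := fun i => (measurable_const.div ((hO i).const_mul 2)).sqrt
  have hu : ∀ i, Measurable[m] fun ω => ucb γ t (st ω) i := fun i =>
    measurable_const.min (((hL i).div (hO i)).add (h1 i))
  have hl : ∀ i, Measurable[m] fun ω => lcb γ t (st ω) i := fun i =>
    measurable_const.max (((hL i).div (hO i)).sub (h1 i))
  exact measurable_const.max ((hl i).sub (Measurable.iInf hu))

lemma measurable_explRate (β : ℝ) (t : ℕ) {g : Ω → V → ℝ} {A : Ω → Finset V}
    (hg : ∀ i, Measurable[m] fun ω => g ω i) (hA : ∀ i, MeasurableSet[m] {ω | i ∈ A ω}) (i : V) :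
    Measurable[m] fun ω => explRate 1 β t (g ω) (A ω) i := by
  unfold explRate
  refine Measurable.ite (hA i) (Measurable.ite ((hg i) (measurableSet_singleton 0))
    measurable_const (measurable_const.min ?_)) measurable_const
  exact measurable_const.div (((hg i).pow_const 2).const_mul _)

lemma measurable_expWeight (hL : ∀ i, Measurable[m] fun ω => (st ω).Ltilde i)
    (hT : Measurable[m] fun ω => (st ω).Theta) (i : V) :
    Measurable[m] fun ω => expWeight (st ω) i := by
  have h1 : Measurable[m] fun ω => learningRate (st ω) :=
    (measurable_const.div (hT.const_mul 2)).sqrt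
  have h2 : ∀ i, Measurable[m] fun ω => Real.exp (-learningRate (st ω) * (st ω).Ltilde i) :=
    fun i => (h1.neg.mul (hL i)).exp
  exact (h2 i).div (Finset.measurable_sum _ fun j _ => h2 j)

end Measurability

section RunBasics

variable {V Ω : Type*} [Fintype V] {mΩ : MeasurableSpace Ω} {μ : Measure Ω}
  {ℱ : Filtration ℕ mΩ} {G : ℕ → Digraph V} {ℓ : ℕ → Ω → V → ℝ} {S : ℕ → Ω → Finset V}
  {I : ℕ → Ω → V} {β : ℝ}

namespace IsRun

/-! ## The random variables of a run -/

/-- The state at the end of round `t`. -/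
noncomputable def state (_ : IsRun 1 4 β μ ℱ G ℓ S I) (t : ℕ) (ω : Ω) : State V :=
  stateAt 1 4 β G (S · ω) (I · ω) (ℓ · ω) t

/-- The distribution from which the arm of round `t + 1` is drawn. -/
noncomputable def prob (run : IsRun 1 4 β μ ℱ G ℓ S I) (t : ℕ) (ω : Ω) (i : V) : ℝ :=
  playProb 1 4 β (t + 1) (S (t + 1) ω) (run.state t ω) i

/-- The exploration rates of round `t + 1`. -/
noncomputable def expl (run : IsRun 1 4 β μ ℱ G ℓ S I) (t : ℕ) (ω : Ω) (i : V) : ℝ :=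
  explRate 1 β (t + 1) (gapEst 4 (t + 1) (run.state t ω)) (S (t + 1) ω) i

/-- The exponential weights of round `t + 1`. -/
noncomputable def weight (run : IsRun 1 4 β μ ℱ G ℓ S I) (t : ℕ) (ω : Ω) (i : V) : ℝ :=
  expWeight (run.state t ω) i

/-- The observation probabilities of round `t + 1`. -/
noncomputable def obsP (run : IsRun 1 4 β μ ℱ G ℓ S I) (t : ℕ) (ω : Ω) (i : V) : ℝ :=
  obsProb (G (t + 1)) (run.prob t ω) i

open scoped Classical in
/-- The conditional distribution of the arm of round `t + 1`, which is deterministic in the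
initialization rounds. -/
noncomputable def law (run : IsRun 1 4 β μ ℱ G ℓ S I) (t : ℕ) (ω : Ω) (i : V) : ℝ :=
  if Fintype.card V ≤ t then run.prob t ω i else if I (t + 1) ω = i then 1 else 0

open scoped Classical in
/-- The indicator that arm `i` is observed in round `t + 1`. -/
noncomputable def seen (_ : IsRun 1 4 β μ ℱ G ℓ S I) (t : ℕ) (ω : Ω) (i : V) : ℝ :=
  if (G (t + 1)).Adj (I (t + 1) ω) i then 1 else 0

variable (run : IsRun 1 4 β μ ℱ G ℓ S I)

lemma seen_nonneg (t : ℕ) (ω : Ω) (i : V) : 0 ≤ run.seen t ω i := by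
  unfold seen; split_ifs <;> simp

lemma seen_le_one (t : ℕ) (ω : Ω) (i : V) : run.seen t ω i ≤ 1 := by
  unfold seen; split_ifs <;> simp

lemma state_Lhat_succ (t : ℕ) (ω : Ω) (i : V) :
    (run.state (t + 1) ω).Lhat i = (run.state t ω).Lhat i + run.seen t ω i * ℓ (t + 1) ω i := by
  unfold seen
  simp only [state, stateAt, step]
  split_ifs <;> simp

lemma state_obs_succ (t : ℕ) (ω : Ω) (i : V) :
    ((run.state (t + 1) ω).obs i : ℝ) = (run.state t ω).obs i + run.seen t ω i := by
  unfold seen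
  simp only [state, stateAt, step]
  split_ifs <;> simp

lemma state_Ltilde_succ {t : ℕ} (ht : Fintype.card V ≤ t) (ω : Ω) (i : V) :
    (run.state (t + 1) ω).Ltilde i =
      (run.state t ω).Ltilde i + run.seen t ω i * ℓ (t + 1) ω i / run.obsP t ω i := by
  have : Fintype.card V < t + 1 := by omega
  unfold seen obsP prob
  simp only [state, stateAt, step, if_pos this]
  split_ifs <;> simp

lemma state_Theta_succ {t : ℕ} (ht : Fintype.card V ≤ t) (ω : Ω) :
    (run.state (t + 1) ω).Theta =
      (run.state t ω).Theta + ∑ i, run.prob t ω i / run.obsP t ω i := by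
  have : Fintype.card V < t + 1 := by omega
  unfold obsP prob
  simp only [state, stateAt, step, if_pos this]

lemma state_of_le {t : ℕ} (ht : t ≤ Fintype.card V) (ω : Ω) :
    (run.state t ω).Ltilde = 0 ∧ (run.state t ω).Theta = Fintype.card V := by
  induction t with
  | zero => simp [state, stateAt]
  | succ t ih =>
    have h := ih (by omega)
    have : ¬ Fintype.card V < t + 1 := by omega
    refine ⟨funext fun i => ?_, ?_⟩
    · rw [← h.1]
      simp only [state, stateAt, step, if_neg this]
    · rw [← h.2]
      simp only [state, stateAt, step, if_neg this]

lemma state_isValid (hℓ : ∀ t ω i, ℓ (t + 1) ω i ∈ Set.Icc (0 : ℝ) 1) (t : ℕ) (ω : Ω) :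
    (run.state t ω).IsValid := by
  induction t with
  | zero => intro i; simp [state, stateAt]
  | succ t ih =>
    intro i
    have h := ih i
    have h1 := hℓ t ω i
    have h2 := run.seen_nonneg t ω i
    rw [run.state_Lhat_succ, run.state_obs_succ]
    constructor
    · exact add_nonneg h.1 (mul_nonneg h2 h1.1)
    · exact add_le_add h.2 (mul_le_of_le_one_right h2 h1.2)

lemma state_obs_le (t : ℕ) (ω : Ω) (i : V) : (run.state t ω).obs i ≤ t := by
  induction t with
  | zero => simp [state, stateAt]
  | succ t ih =>
    have h1 := run.state_obs_succ t ω i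
    have h2 := run.seen_le_one t ω i
    have h3 : ((run.state t ω).obs i : ℝ) ≤ t := by exact_mod_cast ih
    have : ((run.state (t + 1) ω).obs i : ℝ) ≤ (t + 1 : ℕ) := by push_cast; linarith
    exact_mod_cast this

lemma state_obs_mono {s t : ℕ} (h : s ≤ t) (ω : Ω) (i : V) :
    (run.state s ω).obs i ≤ (run.state t ω).obs i := by
  induction t, h using Nat.le_induction with
  | base => exact le_rfl
  | succ t _ ih =>
    have h1 := run.state_obs_succ t ω i
    have h2 := run.seen_nonneg t ω i
    have : ((run.state t ω).obs i : ℝ) ≤ (run.state (t + 1) ω).obs i := by linarith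
    exact ih.trans (by exact_mod_cast this)

lemma one_le_state_obs (hG : ∀ t i, (G t).Adj i i) {t : ℕ} (ht : Fintype.card V ≤ t) (ω : Ω)
    (i : V) : 1 ≤ (run.state t ω).obs i := by
  obtain ⟨e, he, heI⟩ := run.init
  obtain ⟨s, hs, hsi⟩ := he.surjOn (Set.mem_univ i)
  obtain ⟨r, rfl⟩ : ∃ r, s = r + 1 := ⟨s - 1, by have := hs.1; omega⟩
  refine le_trans ?_ (run.state_obs_mono (hs.2.trans ht) ω i)
  have h1 := run.state_obs_succ r ω i
  have h2 : run.seen r ω i = 1 := by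
    unfold seen
    rw [heI _ hs ω, hsi, if_pos (hG _ _)]
  have : (1 : ℝ) ≤ (run.state (r + 1) ω).obs i := by
    rw [h1, h2]
    have : (0 : ℝ) ≤ (run.state r ω).obs i := Nat.cast_nonneg _
    linarith
  exact_mod_cast this

/-! ### Measurability -/

lemma measurableSet_adj (run : IsRun 1 4 β μ ℱ G ℓ S I) (t : ℕ) (i : V) :
    MeasurableSet[ℱ (t + 1)] {ω | (G (t + 1)).Adj (I (t + 1) ω) i} := by
  have : {ω | (G (t + 1)).Adj (I (t + 1) ω) i} =
      ⋃ a ∈ {a | (G (t + 1)).Adj a i}, {ω | I (t + 1) ω = a} := by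
    ext ω; simp
  rw [this]
  exact MeasurableSet.biUnion (Set.to_countable _) fun a _ => run.arms_adapted t a

lemma bddMeas_seen (t : ℕ) (i : V) : BddMeas (ℱ (t + 1)) (fun ω => run.seen t ω i) :=
  .of_mem_Icc (Measurable.ite (run.measurableSet_adj t i) measurable_const measurable_const)
    fun ω => ⟨run.seen_nonneg t ω i, run.seen_le_one t ω i⟩

lemma measurable_loss (run : IsRun 1 4 β μ ℱ G ℓ S I) (t : ℕ) (i : V) :
    Measurable[ℱ (t + 1)] (fun ω => ℓ (t + 1) ω i) :=
  (measurable_pi_apply i).comp (run.losses_adapted t)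

/-- Every component of the state at the end of round `t` is measurable with respect to `ℱ t`. -/
lemma measurable_state (t : ℕ) :
    (∀ i, Measurable[ℱ t] fun ω => (run.state t ω).Lhat i) ∧
    (∀ i, Measurable[ℱ t] fun ω => ((run.state t ω).obs i : ℝ)) ∧
    (∀ i, Measurable[ℱ t] fun ω => (run.state t ω).Ltilde i) ∧
    Measurable[ℱ t] fun ω => (run.state t ω).Theta := by
  induction t with
  | zero => simp [state, stateAt]
  | succ t ih =>
    obtain ⟨h1, h2, h3, h4⟩ := ih
    have hle : ℱ t ≤ ℱ (t + 1) := ℱ.mono (Nat.le_succ t)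
    have hp : Fintype.card V ≤ t → ∀ i, Measurable[ℱ t] fun ω => run.prob t ω i := fun ht i => by
      have he := measurable_explRate (m := ℱ t) β (t + 1) (measurable_gapEst 4 (t + 1) h1 h2)
        (run.explorationSet_predictable t ht)
      exact ((measurable_const.sub (Finset.measurable_sum _ fun j _ => he j)).mul
        (measurable_expWeight h3 h4 i)).add (he i)
    have hP : Fintype.card V ≤ t → ∀ i, Measurable[ℱ t] fun ω => run.obsP t ω i := fun ht i =>
      Finset.measurable_sum _ fun j _ => hp ht j
    have hs := fun i => (run.bddMeas_seen t i).1
    refine ⟨fun i => ?_, fun i => ?_, fun i => ?_, ?_⟩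
    · simp only [run.state_Lhat_succ]
      exact ((h1 i).mono hle le_rfl).add ((hs i).mul (run.measurable_loss t i))
    · simp only [run.state_obs_succ]
      exact ((h2 i).mono hle le_rfl).add (hs i)
    · by_cases ht : Fintype.card V ≤ t
      · simp only [run.state_Ltilde_succ ht]
        exact ((h3 i).mono hle le_rfl).add
          (((hs i).mul (run.measurable_loss t i)).div ((hP ht i).mono hle le_rfl))
      · simp only [(run.state_of_le (by omega : t + 1 ≤ Fintype.card V) _).1]
        exact measurable_const
    · by_cases ht : Fintype.card V ≤ t
      · simp only [run.state_Theta_succ ht]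
        exact (h4.mono hle le_rfl).add (Finset.measurable_sum _ fun j _ =>
          ((hp ht j).mono hle le_rfl).div ((hP ht j).mono hle le_rfl))
      · simp only [(run.state_of_le (by omega : t + 1 ≤ Fintype.card V) _).2]
        exact measurable_const

lemma measurable_expl {t : ℕ} (ht : Fintype.card V ≤ t) (i : V) :
    Measurable[ℱ t] fun ω => run.expl t ω i :=
  measurable_explRate (m := ℱ t) β (t + 1)
    (measurable_gapEst 4 (t + 1) (run.measurable_state t).1 (run.measurable_state t).2.1)
    (run.explorationSet_predictable t ht) i

lemma measurable_weight (t : ℕ) (i : V) : Measurable[ℱ t] fun ω => run.weight t ω i :=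
  measurable_expWeight (run.measurable_state t).2.2.1 (run.measurable_state t).2.2.2 i

lemma measurable_prob {t : ℕ} (ht : Fintype.card V ≤ t) (i : V) :
    Measurable[ℱ t] fun ω => run.prob t ω i :=
  ((measurable_const.sub (Finset.measurable_sum _ fun j _ => run.measurable_expl ht j)).mul
    (run.measurable_weight t i)).add (run.measurable_expl ht i)

lemma measurable_obsP {t : ℕ} (ht : Fintype.card V ≤ t) (i : V) :
    Measurable[ℱ t] fun ω => run.obsP t ω i :=
  Finset.measurable_sum _ fun j _ => run.measurable_prob ht j

end IsRun

end RunBasics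


section Sampling

variable {V Ω : Type*} [Fintype V] {mΩ : MeasurableSpace Ω} {μ : Measure Ω}
  {ℱ : Filtration ℕ mΩ} {G : ℕ → Digraph V} {ℓ : ℕ → Ω → V → ℝ} {S : ℕ → Ω → Finset V}
  {I : ℕ → Ω → V} {β : ℝ}

namespace IsRun

/-! ## Integrating out the arm of a round -/

/-- What is known when the arm of round `t + 1` is drawn, with the losses of that round. -/
abbrev preInfo (_ : IsRun 1 4 β μ ℱ G ℓ S I) (t : ℕ) : MeasurableSpace Ω :=
  ℱ t ⊔ MeasurableSpace.comap (ℓ (t + 1)) inferInstance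

lemma le_preInfo (run : IsRun 1 4 β μ ℱ G ℓ S I) (t : ℕ) : ℱ t ≤ run.preInfo t := le_sup_left

lemma preInfo_le (run : IsRun 1 4 β μ ℱ G ℓ S I) (t : ℕ) : run.preInfo t ≤ ℱ (t + 1) :=
  sup_le (ℱ.mono (Nat.le_succ t)) (run.losses_adapted t).comap_le

lemma bddMeas_loss (run : IsRun 1 4 β μ ℱ G ℓ S I)
    (hℓ : ∀ t ω i, ℓ (t + 1) ω i ∈ Set.Icc (0 : ℝ) 1) (t : ℕ) (i : V) :
    BddMeas (run.preInfo t) (fun ω => ℓ (t + 1) ω i) := by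
  refine .of_mem_Icc ?_ (fun ω => hℓ t ω i)
  have h : Measurable[MeasurableSpace.comap (ℓ (t + 1)) inferInstance] (ℓ (t + 1)) :=
    Measurable.of_comap_le le_rfl
  exact (measurable_pi_apply i).comp (h.mono le_sup_right le_rfl)

open scoped Classical in
-- The arm is drawn given the past and also the losses of the round, so `Y` may depend on both and
-- is pulled out of the conditional expectation. In the initialization rounds the two integrands
-- coincide by the definition of `law`.
lemma integral_mul_indicator [IsProbabilityMeasure μ] (run : IsRun 1 4 β μ ℱ G ℓ S I) (t : ℕ)
    (a : V) {Y : Ω → ℝ} (hY : BddMeas (run.preInfo t) Y) :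
    ∫ ω, Y ω * (if I (t + 1) ω = a then 1 else 0) ∂μ = ∫ ω, Y ω * run.law t ω a ∂μ := by
  by_cases ht : Fintype.card V ≤ t
  · have hle : run.preInfo t ≤ mΩ := (run.preInfo_le t).trans (ℱ.le _)
    have hind : (fun ω => if I (t + 1) ω = a then (1 : ℝ) else 0) =
        Set.indicator {ω | I (t + 1) ω = a} (fun _ => (1 : ℝ)) := by
      ext ω; simp [Set.indicator]
    have hint : Integrable (Set.indicator {ω | I (t + 1) ω = a} (fun _ => (1 : ℝ))) μ :=
      (integrable_const 1).indicator (ℱ.le _ _ (run.arms_adapted t a))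
    obtain ⟨C, hC⟩ := hY.2
    have h1 := condExp_stronglyMeasurable_mul_of_bound hle hY.1.stronglyMeasurable hint C
      (Filter.Eventually.of_forall hC)
    have h2 := run.sampling t ht a
    calc ∫ ω, Y ω * (if I (t + 1) ω = a then 1 else 0) ∂μ
        = ∫ ω, (Y * Set.indicator {ω | I (t + 1) ω = a} (fun _ => (1 : ℝ))) ω ∂μ := by
          rw [← hind]; rfl
      _ = ∫ ω, (μ[Y * Set.indicator {ω | I (t + 1) ω = a} (fun _ => (1 : ℝ)) |
            run.preInfo t]) ω ∂μ := (integral_condExp hle).symm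
      _ = ∫ ω, Y ω * run.law t ω a ∂μ := by
          refine integral_congr_ae ?_
          filter_upwards [h1, h2] with ω hω1 hω2
          rw [hω1, Pi.mul_apply]
          congr 1
          rw [law, if_pos ht]
          exact hω2
  · simp only [law, if_neg ht]

lemma obsProb_law (run : IsRun 1 4 β μ ℱ G ℓ S I) {t : ℕ} (ht : Fintype.card V ≤ t) (ω : Ω)
    (i : V) : obsProb (G (t + 1)) (run.law t ω) i = run.obsP t ω i := by
  have : run.law t ω = run.prob t ω := by
    ext a; rw [law, if_pos ht]
  rw [obsP, this]

section Law

variable [Nonempty V]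

lemma prob_pos (run : IsRun 1 4 β μ ℱ G ℓ S I) (hβ : 2 ≤ β) (t : ℕ) (ω : Ω) (i : V) :
    0 < run.prob t ω i := playProb_pos (by linarith) _ _ _ _ _

lemma sum_prob (run : IsRun 1 4 β μ ℱ G ℓ S I) (t : ℕ) (ω : Ω) : ∑ i, run.prob t ω i = 1 :=
  sum_playProb _ _ _ _ _

lemma law_nonneg (run : IsRun 1 4 β μ ℱ G ℓ S I) (hβ : 2 ≤ β) (t : ℕ) (ω : Ω) (i : V) :
    0 ≤ run.law t ω i := by
  have := run.prob_pos hβ t ω i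
  unfold law
  split_ifs <;> linarith

lemma sum_law (run : IsRun 1 4 β μ ℱ G ℓ S I) (t : ℕ) (ω : Ω) : ∑ i, run.law t ω i = 1 := by
  classical
  unfold law
  split_ifs
  · exact run.sum_prob t ω
  · rw [Finset.sum_ite_eq]
    simp

lemma law_le_one (run : IsRun 1 4 β μ ℱ G ℓ S I) (hβ : 2 ≤ β) (t : ℕ) (ω : Ω) (i : V) :
    run.law t ω i ≤ 1 :=
  (Finset.single_le_sum (fun j _ => run.law_nonneg hβ t ω j) (Finset.mem_univ i)).trans
    (run.sum_law t ω).le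

lemma bddMeas_law (run : IsRun 1 4 β μ ℱ G ℓ S I) (hβ : 2 ≤ β) (t : ℕ) (i : V) :
    BddMeas (ℱ t) (fun ω => run.law t ω i) := by
  refine .of_mem_Icc ?_ fun ω => ⟨run.law_nonneg hβ t ω i, run.law_le_one hβ t ω i⟩
  classical
  by_cases ht : Fintype.card V ≤ t
  · simp only [law, if_pos ht]
    exact run.measurable_prob ht i
  · obtain ⟨e, -, he⟩ := run.init
    have h : (fun ω => run.law t ω i) = fun _ => if e (t + 1) = i then 1 else 0 := by
      ext ω
      rw [law, if_neg ht, he (t + 1) ⟨by omega, by omega⟩ ω]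
    rw [h]
    exact measurable_const

/-- Every later average over a draw goes through this identity. -/
lemma integral_arm [IsProbabilityMeasure μ] (run : IsRun 1 4 β μ ℱ G ℓ S I) (hβ : 2 ≤ β) (t : ℕ)
    {F : V → Ω → ℝ} (hF : ∀ a, BddMeas (run.preInfo t) (F a)) :
    ∫ ω, F (I (t + 1) ω) ω ∂μ = ∫ ω, ∑ a, run.law t ω a * F a ω ∂μ := by
  classical
  have hle : run.preInfo t ≤ mΩ := (run.preInfo_le t).trans (ℱ.le _)
  have h1 : ∀ ω, F (I (t + 1) ω) ω = ∑ a, F a ω * (if I (t + 1) ω = a then 1 else 0) := by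
    intro ω; simp
  simp only [h1]
  have hind : ∀ a, BddMeas mΩ (fun ω => if I (t + 1) ω = a then (1 : ℝ) else 0) := fun a =>
    .ite (ℱ.le _ _ (run.arms_adapted t a)) (.const 1) (.const 0)
  rw [integral_finsetSum _ fun a _ => (((hF a).mono hle).mul (hind a)).integrable le_rfl,
    integral_finsetSum _ fun a _ => (((run.bddMeas_law hβ t a).mono (ℱ.le t)).mul
      ((hF a).mono hle)).integrable le_rfl]
  refine Finset.sum_congr rfl fun a _ => ?_
  rw [run.integral_mul_indicator t a (hF a)]
  simp only [mul_comm]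

lemma integral_mul_seen [IsProbabilityMeasure μ] (run : IsRun 1 4 β μ ℱ G ℓ S I) (hβ : 2 ≤ β)
    (t : ℕ) (i : V) {Z : Ω → ℝ} (hZ : BddMeas (run.preInfo t) Z) :
    ∫ ω, Z ω * run.seen t ω i ∂μ = ∫ ω, Z ω * obsProb (G (t + 1)) (run.law t ω) i ∂μ := by
  classical
  have h := run.integral_arm hβ t (F := fun a ω => Z ω * if (G (t + 1)).Adj a i then 1 else 0)
    fun a => hZ.mul (.const _)
  unfold seen obsProb
  rw [h]
  congr 1
  ext ω
  rw [Finset.mul_sum, Finset.sum_filter]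
  exact Finset.sum_congr rfl fun a _ => by split_ifs <;> ring

lemma inv_sq_le_obsP (run : IsRun 1 4 β μ ℱ G ℓ S I) (hβ : 2 ≤ β) (hK : 2 ≤ Fintype.card V)
    (hG : ∀ t i, (G t).Adj i i) (hℓ : ∀ t ω i, ℓ (t + 1) ω i ∈ Set.Icc (0 : ℝ) 1)
    {t : ℕ} (ht : Fintype.card V ≤ t) (ω : Ω) (i : V) :
    1 / ((Fintype.card V : ℝ) * (t + 1 : ℕ)) ^ 2 ≤ run.obsP t ω i :=
  inv_sq_le_obsProb hβ 4 hK (by omega) (hG (t + 1)) _ (run.state_isValid hℓ t ω) i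

lemma obsP_pos (run : IsRun 1 4 β μ ℱ G ℓ S I) (hβ : 2 ≤ β)
    (hG : ∀ t i, (G t).Adj i i) (t : ℕ) (ω : Ω) (i : V) : 0 < run.obsP t ω i :=
  obsProb_pos (by linarith) 4 _ (hG (t + 1)) _ _ i

lemma obsP_le_one (run : IsRun 1 4 β μ ℱ G ℓ S I) (hβ : 2 ≤ β) (t : ℕ) (ω : Ω) (i : V) :
    run.obsP t ω i ≤ 1 :=
  obsProb_le_one _ _ (fun j => (run.prob_pos hβ t ω j).le) (run.sum_prob t ω) i

lemma bddMeas_inv_obsP (run : IsRun 1 4 β μ ℱ G ℓ S I) (hβ : 2 ≤ β) (hK : 2 ≤ Fintype.card V)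
    (hG : ∀ t i, (G t).Adj i i) (hℓ : ∀ t ω i, ℓ (t + 1) ω i ∈ Set.Icc (0 : ℝ) 1)
    {t : ℕ} (ht : Fintype.card V ≤ t) (i : V) :
    BddMeas (ℱ t) (fun ω => (run.obsP t ω i)⁻¹) := by
  have : (0 : ℝ) < Fintype.card V := by exact_mod_cast Fintype.card_pos
  exact .inv_of_le (run.measurable_obsP ht i)
    (by positivity : 0 < 1 / ((Fintype.card V : ℝ) * (t + 1 : ℕ)) ^ 2)
    fun ω => run.inv_sq_le_obsP hβ hK hG hℓ ht ω i

lemma bddMeas_obsP (run : IsRun 1 4 β μ ℱ G ℓ S I) (hβ : 2 ≤ β)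
    (hG : ∀ t i, (G t).Adj i i) {t : ℕ} (ht : Fintype.card V ≤ t) (i : V) :
    BddMeas (ℱ t) (fun ω => run.obsP t ω i) :=
  .of_mem_Icc (run.measurable_obsP ht i)
    fun ω => ⟨(run.obsP_pos hβ hG t ω i).le, run.obsP_le_one hβ t ω i⟩

/-- The importance-weighted loss estimate of round `t + 1`. -/
noncomputable def est (run : IsRun 1 4 β μ ℱ G ℓ S I) (t : ℕ) (ω : Ω) (i : V) : ℝ :=
  run.seen t ω i * ℓ (t + 1) ω i / run.obsP t ω i

lemma bddMeas_est (run : IsRun 1 4 β μ ℱ G ℓ S I) (hβ : 2 ≤ β) (hK : 2 ≤ Fintype.card V)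
    (hG : ∀ t i, (G t).Adj i i) (hℓ : ∀ t ω i, ℓ (t + 1) ω i ∈ Set.Icc (0 : ℝ) 1)
    {t : ℕ} (ht : Fintype.card V ≤ t) (i : V) :
    BddMeas (ℱ (t + 1)) (fun ω => run.est t ω i) :=
  ((run.bddMeas_seen t i).mul ((run.bddMeas_loss hℓ t i).mono (run.preInfo_le t))).mul
    ((run.bddMeas_inv_obsP hβ hK hG hℓ ht i).mono (ℱ.mono (Nat.le_succ t)))

section Estimates

variable [IsProbabilityMeasure μ]

/-- The loss estimates are unbiased. -/
lemma integral_mul_est (run : IsRun 1 4 β μ ℱ G ℓ S I) (hβ : 2 ≤ β) (hK : 2 ≤ Fintype.card V)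
    (hG : ∀ t i, (G t).Adj i i) (hℓ : ∀ t ω i, ℓ (t + 1) ω i ∈ Set.Icc (0 : ℝ) 1)
    {t : ℕ} (ht : Fintype.card V ≤ t) (i : V) {Z : Ω → ℝ} (hZ : BddMeas (ℱ t) Z) :
    ∫ ω, Z ω * run.est t ω i ∂μ = ∫ ω, Z ω * ℓ (t + 1) ω i ∂μ := by
  have hP := (run.bddMeas_inv_obsP hβ hK hG hℓ ht i).mono (run.le_preInfo t)
  have h := run.integral_mul_seen hβ t i
    (((hZ.mono (run.le_preInfo t)).mul (run.bddMeas_loss hℓ t i)).mul hP)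
  simp only [run.obsProb_law ht] at h
  calc ∫ ω, Z ω * run.est t ω i ∂μ
      = ∫ ω, Z ω * ℓ (t + 1) ω i * (run.obsP t ω i)⁻¹ * run.seen t ω i ∂μ := by
        congr 1; ext ω; rw [est]; ring
    _ = _ := h
    _ = _ := by
        congr 1; ext ω
        have := (run.obsP_pos hβ hG t ω i).ne'
        field_simp

/-- The second moment of the loss estimates. -/
lemma integral_mul_est_sq_le (run : IsRun 1 4 β μ ℱ G ℓ S I) (hβ : 2 ≤ β)
    (hK : 2 ≤ Fintype.card V)
    (hG : ∀ t i, (G t).Adj i i) (hℓ : ∀ t ω i, ℓ (t + 1) ω i ∈ Set.Icc (0 : ℝ) 1)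
    {t : ℕ} (ht : Fintype.card V ≤ t) (i : V) {Z : Ω → ℝ} (hZ : BddMeas (ℱ t) Z)
    (hZ0 : ∀ ω, 0 ≤ Z ω) :
    ∫ ω, Z ω * run.est t ω i ^ 2 ∂μ ≤ ∫ ω, Z ω * (run.obsP t ω i)⁻¹ ∂μ := by
  have hP := (run.bddMeas_inv_obsP hβ hK hG hℓ ht i).mono (run.le_preInfo t)
  have hl := run.bddMeas_loss hℓ t i
  have hZ' := hZ.mono (run.le_preInfo t)
  have h := run.integral_mul_seen hβ t i ((hZ'.mul (hl.pow_two)).mul hP.pow_two)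
  simp only [run.obsProb_law ht] at h
  have hle : run.preInfo t ≤ mΩ := (run.preInfo_le t).trans (ℱ.le _)
  calc ∫ ω, Z ω * run.est t ω i ^ 2 ∂μ
      = ∫ ω, Z ω * ℓ (t + 1) ω i ^ 2 * (run.obsP t ω i)⁻¹ ^ 2 * run.seen t ω i ∂μ := by
        congr 1; ext ω
        have : run.seen t ω i ^ 2 = run.seen t ω i := by unfold seen; split_ifs <;> simp
        rw [est, div_pow, mul_pow, this]; ring
    _ = _ := h
    _ ≤ _ := by
        refine integral_mono (((((hZ'.mul hl.pow_two).mul hP.pow_two).mul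
          ((run.bddMeas_obsP hβ hG ht i).mono (run.le_preInfo t)))).integrable hle)
          ((hZ'.mul hP).integrable hle) fun ω => ?_
        have hpos := run.obsP_pos hβ hG t ω i
        have h1 : ℓ (t + 1) ω i ^ 2 ≤ 1 := pow_le_one₀ (hℓ t ω i).1 (hℓ t ω i).2
        have h2 : Z ω * ℓ (t + 1) ω i ^ 2 * (run.obsP t ω i)⁻¹ ^ 2 * run.obsP t ω i =
            Z ω * (run.obsP t ω i)⁻¹ * ℓ (t + 1) ω i ^ 2 := by field_simp
        dsimp only
        rw [h2]
        exact mul_le_of_le_one_right (mul_nonneg (hZ0 ω) (inv_pos.2 hpos).le) h1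

end Estimates

end Law

end IsRun

end Sampling


section AdversarialBound

variable {V Ω : Type*} [Fintype V] {mΩ : MeasurableSpace Ω} {μ : Measure Ω}
  {ℱ : Filtration ℕ mΩ} {G : ℕ → Digraph V} {ℓ : ℕ → Ω → V → ℝ} {S : ℕ → Ω → Finset V}
  {I : ℕ → Ω → V} {β : ℝ}

namespace IsRun

/-! ## The adversarial regret bound -/

/-- The quantity `θ` of round `t + 1`. -/
noncomputable def theta (run : IsRun 1 4 β μ ℱ G ℓ S I) (t : ℕ) (ω : Ω) : ℝ :=
  ∑ i, run.prob t ω i / run.obsP t ω i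

/-- The learning rate of round `t + 1`. -/
noncomputable def rate (run : IsRun 1 4 β μ ℱ G ℓ S I) (t : ℕ) (ω : Ω) : ℝ :=
  learningRate (run.state t ω)

lemma bddMeas_playedLoss (run : IsRun 1 4 β μ ℱ G ℓ S I)
    (hℓ : ∀ t ω i, ℓ (t + 1) ω i ∈ Set.Icc (0 : ℝ) 1) (t : ℕ) :
    BddMeas (ℱ (t + 1)) (fun ω => ℓ (t + 1) ω (I (t + 1) ω)) := by
  classical
  refine .of_mem_Icc ?_ fun ω => hℓ t ω _
  have h : (fun ω => ℓ (t + 1) ω (I (t + 1) ω)) =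
      fun ω => ∑ a, if I (t + 1) ω = a then ℓ (t + 1) ω a else 0 := by
    ext ω; simp
  rw [h]
  exact Finset.measurable_sum _ fun a _ =>
    Measurable.ite (run.arms_adapted t a) (run.measurable_loss t a) measurable_const

lemma Ltilde_add (run : IsRun 1 4 β μ ℱ G ℓ S I) (n : ℕ) (ω : Ω) (i : V) :
    (run.state (Fintype.card V + n) ω).Ltilde i =
      ∑ s ∈ Finset.range n, run.est (Fintype.card V + s) ω i := by
  induction n with
  | zero => simp [(run.state_of_le le_rfl ω).1]
  | succ n ih =>
    rw [← add_assoc, run.state_Ltilde_succ (by omega), Finset.sum_range_succ, ih]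
    rfl

variable [Nonempty V]

lemma theta_nonneg (run : IsRun 1 4 β μ ℱ G ℓ S I) (hβ : 2 ≤ β)
    (hG : ∀ t i, (G t).Adj i i) (t : ℕ) (ω : Ω) : 0 ≤ run.theta t ω :=
  Finset.sum_nonneg fun i _ => (div_pos (run.prob_pos hβ t ω i) (run.obsP_pos hβ hG t ω i)).le

lemma theta_le_card (run : IsRun 1 4 β μ ℱ G ℓ S I) (hβ : 2 ≤ β)
    (hG : ∀ t i, (G t).Adj i i) (t : ℕ) (ω : Ω) : run.theta t ω ≤ Fintype.card V :=
  sum_div_obsProb_le_card _ (hG (t + 1)) _ (run.prob_pos hβ t ω)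

lemma card_le_Theta (run : IsRun 1 4 β μ ℱ G ℓ S I) (hβ : 2 ≤ β)
    (hG : ∀ t i, (G t).Adj i i) (n : ℕ) (ω : Ω) :
    (Fintype.card V : ℝ) ≤ (run.state (Fintype.card V + n) ω).Theta := by
  induction n with
  | zero => exact (run.state_of_le le_rfl ω).2.ge
  | succ n ih =>
    rw [← add_assoc, run.state_Theta_succ (by omega)]
    have := run.theta_nonneg hβ hG (Fintype.card V + n) ω
    unfold theta at this
    linarith

lemma Theta_le_card_mul (run : IsRun 1 4 β μ ℱ G ℓ S I) (hβ : 2 ≤ β)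
    (hG : ∀ t i, (G t).Adj i i) {t : ℕ} (ht : Fintype.card V ≤ t) (ω : Ω) :
    (run.state t ω).Theta ≤ Fintype.card V * t := by
  have hK : (1 : ℝ) ≤ Fintype.card V := by exact_mod_cast Fintype.card_pos (α := V)
  induction t, ht using Nat.le_induction with
  | base => rw [(run.state_of_le le_rfl ω).2]; nlinarith
  | succ t ht ih =>
    rw [run.state_Theta_succ ht]
    have := run.theta_le_card hβ hG t ω
    unfold theta at this
    push_cast
    linarith

/-- The initial value $\theta_K=K$ is charged to the first $K$ rounds, in which the independence
numbers are at least 1. -/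
lemma Theta_le_sum_indepNumber (run : IsRun 1 4 β μ ℱ G ℓ S I) (hβ : 2 ≤ β)
    (hK : 2 ≤ Fintype.card V) (hG : ∀ t i, (G t).Adj i i)
    (hℓ : ∀ t ω i, ℓ (t + 1) ω i ∈ Set.Icc (0 : ℝ) 1) {t T : ℕ} (ht : Fintype.card V ≤ t)
    (htT : t ≤ T) (ω : Ω) :
    (run.state t ω).Theta ≤ (4 * Real.log (Fintype.card V * T) + 1) *
      ∑ s ∈ Finset.range t, (indepNumber (G (s + 1)) : ℝ) := by
  have hK' : (2 : ℝ) ≤ Fintype.card V := by exact_mod_cast hK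
  induction t, ht using Nat.le_induction with
  | base =>
    rw [(run.state_of_le le_rfl ω).2]
    have hT : (1 : ℝ) ≤ T := by exact_mod_cast (by omega : 1 ≤ T)
    have h1 : 0 ≤ Real.log (Fintype.card V * T) := Real.log_nonneg (by nlinarith)
    have h2 : (Fintype.card V : ℝ) ≤
        ∑ s ∈ Finset.range (Fintype.card V), (indepNumber (G (s + 1)) : ℝ) := by
      calc (Fintype.card V : ℝ) = ∑ _s ∈ Finset.range (Fintype.card V), (1 : ℝ) := by simp
        _ ≤ _ := Finset.sum_le_sum fun s _ => by exact_mod_cast one_le_indepNumber (G (s + 1))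
    exact h2.trans (le_mul_of_one_le_left ((Nat.cast_nonneg _).trans h2) (by linarith))
  | succ t ht ih =>
    rw [run.state_Theta_succ ht, Finset.sum_range_succ, mul_add]
    refine add_le_add (ih (by omega)) ?_
    have h := sum_playProb_div_obsProb_le hβ 4 hK (by omega : Fintype.card V < t + 1) (hG (t + 1))
      (S (t + 1) ω) (run.state_isValid hℓ t ω)
    refine h.trans ?_
    rw [mul_comm]
    have : (0 : ℝ) < (t + 1 : ℕ) := by positivity
    gcongr

lemma rate_pos (run : IsRun 1 4 β μ ℱ G ℓ S I) (hβ : 2 ≤ β) (hK : 2 ≤ Fintype.card V)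
    (hG : ∀ t i, (G t).Adj i i) (n : ℕ) (ω : Ω) : 0 < run.rate (Fintype.card V + n) ω := by
  have h1 := run.card_le_Theta hβ hG n ω
  have hK' : (1 : ℝ) < Fintype.card V := by exact_mod_cast hK
  have h2 := Real.log_pos hK'
  unfold rate learningRate
  have h3 : 0 < (run.state (Fintype.card V + n) ω).Theta := by linarith
  positivity

lemma rate_anti (run : IsRun 1 4 β μ ℱ G ℓ S I) (hβ : 2 ≤ β)
    (hG : ∀ t i, (G t).Adj i i) (n : ℕ) (ω : Ω) :
    run.rate (Fintype.card V + (n + 1)) ω ≤ run.rate (Fintype.card V + n) ω := by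
  have h1 := run.card_le_Theta hβ hG n ω
  have hK' : (1 : ℝ) ≤ Fintype.card V := by exact_mod_cast Fintype.card_pos (α := V)
  have h2 := Real.log_nonneg hK'
  have h3 := run.theta_nonneg hβ hG (Fintype.card V + n) ω
  have h4 := run.state_Theta_succ (by omega : Fintype.card V ≤ Fintype.card V + n) ω
  unfold rate learningRate
  rw [← add_assoc, h4]
  unfold theta at h3
  have h5 : 0 < (run.state (Fintype.card V + n) ω).Theta := by linarith
  gcongr
  linarith

lemma est_nonneg (run : IsRun 1 4 β μ ℱ G ℓ S I) (hβ : 2 ≤ β)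
    (hG : ∀ t i, (G t).Adj i i) (hℓ : ∀ t ω i, ℓ (t + 1) ω i ∈ Set.Icc (0 : ℝ) 1)
    (t : ℕ) (ω : Ω) (i : V) : 0 ≤ run.est t ω i :=
  div_nonneg (mul_nonneg (run.seen_nonneg t ω i) (hℓ t ω i).1) (run.obsP_pos hβ hG t ω i).le

lemma weight_pos (run : IsRun 1 4 β μ ℱ G ℓ S I) (t : ℕ) (ω : Ω) (i : V) :
    0 < run.weight t ω i := expWeight_pos _ _

lemma weight_le_one (run : IsRun 1 4 β μ ℱ G ℓ S I) (t : ℕ) (ω : Ω) (i : V) :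
    run.weight t ω i ≤ 1 := expWeight_le_one _ _

lemma bddMeas_weight (run : IsRun 1 4 β μ ℱ G ℓ S I) (t : ℕ) (i : V) :
    BddMeas (ℱ t) (fun ω => run.weight t ω i) :=
  .of_mem_Icc (run.measurable_weight t i)
    fun ω => ⟨(run.weight_pos t ω i).le, run.weight_le_one t ω i⟩

lemma bddMeas_rate (run : IsRun 1 4 β μ ℱ G ℓ S I) (hβ : 2 ≤ β)
    (hG : ∀ t i, (G t).Adj i i) (n : ℕ) :
    BddMeas (ℱ (Fintype.card V + n)) (fun ω => run.rate (Fintype.card V + n) ω) := by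
  have hK' : (1 : ℝ) ≤ Fintype.card V := by exact_mod_cast Fintype.card_pos (α := V)
  have h2 := Real.log_nonneg hK'
  refine .of_mem_Icc (a := 0) (b := √(Real.log (Fintype.card V) / (2 * Fintype.card V)))
    ((measurable_const.div ((run.measurable_state _).2.2.2.const_mul 2)).sqrt)
    fun ω => ⟨Real.sqrt_nonneg _, ?_⟩
  have h1 := run.card_le_Theta hβ hG n ω
  unfold rate learningRate
  gcongr

lemma bddMeas_prob (run : IsRun 1 4 β μ ℱ G ℓ S I) (hβ : 2 ≤ β) {t : ℕ}
    (ht : Fintype.card V ≤ t) (i : V) : BddMeas (ℱ t) (fun ω => run.prob t ω i) :=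
  .of_mem_Icc (run.measurable_prob ht i)
    fun ω => ⟨(run.prob_pos hβ t ω i).le, playProb_le_one (by linarith) _ _ _ _ i⟩

lemma bddMeas_theta (run : IsRun 1 4 β μ ℱ G ℓ S I) (hβ : 2 ≤ β)
    (hG : ∀ t i, (G t).Adj i i) {t : ℕ} (ht : Fintype.card V ≤ t) :
    BddMeas (ℱ t) (run.theta t) :=
  .of_mem_Icc (Finset.measurable_sum _ fun j _ =>
      (run.measurable_prob ht j).div (run.measurable_obsP ht j))
    fun ω => ⟨run.theta_nonneg hβ hG t ω, run.theta_le_card hβ hG t ω⟩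

lemma sum_rate_mul_theta_le (run : IsRun 1 4 β μ ℱ G ℓ S I) (hβ : 2 ≤ β)
    (hG : ∀ t i, (G t).Adj i i) (n : ℕ) (ω : Ω) :
    ∑ s ∈ Finset.range n, run.rate (Fintype.card V + s) ω * run.theta (Fintype.card V + s) ω ≤
      5 / 2 * (√(Real.log (Fintype.card V)) / √2 * √(run.state (Fintype.card V + n) ω).Theta) := by
  have hK' : (1 : ℝ) ≤ Fintype.card V := by exact_mod_cast Fintype.card_pos (α := V)
  have hlog := Real.log_nonneg hK'
  have h := sum_div_sqrt_le (fun n => (run.state (Fintype.card V + n) ω).Theta)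
    (fun n => run.theta (Fintype.card V + n) ω)
    (lt_of_lt_of_le (by linarith) (run.card_le_Theta hβ hG 0 ω))
    (fun n => run.state_Theta_succ (Nat.le_add_right _ _) ω)
    (fun n => run.theta_nonneg hβ hG _ ω)
    (fun n => (run.theta_le_card hβ hG _ ω).trans (run.card_le_Theta hβ hG 0 ω)) n
  have hc : (0 : ℝ) ≤ √(Real.log (Fintype.card V)) / √2 := by positivity
  calc ∑ s ∈ Finset.range n, run.rate (Fintype.card V + s) ω * run.theta (Fintype.card V + s) ω
      = √(Real.log (Fintype.card V)) / √2 * ∑ s ∈ Finset.range n,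
          run.theta (Fintype.card V + s) ω / √(run.state (Fintype.card V + s) ω).Theta := by
        rw [Finset.mul_sum]
        refine Finset.sum_congr rfl fun s _ => ?_
        unfold rate learningRate
        rw [Real.sqrt_div hlog, Real.sqrt_mul (by norm_num)]
        ring
    _ ≤ _ := mul_le_mul_of_nonneg_left h hc
    _ = _ := by ring

lemma log_div_rate (run : IsRun 1 4 β μ ℱ G ℓ S I) (hβ : 2 ≤ β) (hK : 2 ≤ Fintype.card V)
    (hG : ∀ t i, (G t).Adj i i) (n : ℕ) (ω : Ω) :
    Real.log (Fintype.card V) / run.rate (Fintype.card V + n) ω =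
      √2 * (√(Real.log (Fintype.card V)) * √(run.state (Fintype.card V + n) ω).Theta) := by
  have hK' : (1 : ℝ) < Fintype.card V := by exact_mod_cast hK
  have hlog := Real.log_pos hK'
  have h1 := run.card_le_Theta hβ hG n ω
  have h2 : 0 < (run.state (Fintype.card V + n) ω).Theta := by linarith
  rw [div_eq_iff (run.rate_pos hβ hK hG n ω).ne']
  unfold rate learningRate
  rw [Real.sqrt_div hlog.le, Real.sqrt_mul (by norm_num)]
  have h3 : 0 < √(run.state (Fintype.card V + n) ω).Theta := Real.sqrt_pos.2 h2
  field_simp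
  exact (Real.sq_sqrt hlog.le).symm

variable [IsProbabilityMeasure μ]

/-- The regret of the exponential weights, in expectation. -/
lemma sum_integral_weight_sub_le (run : IsRun 1 4 β μ ℱ G ℓ S I) (hβ : 2 ≤ β)
    (hK : 2 ≤ Fintype.card V) (hG : ∀ t i, (G t).Adj i i)
    (hℓ : ∀ t ω i, ℓ (t + 1) ω i ∈ Set.Icc (0 : ℝ) 1) (n : ℕ) {B : ℝ}
    (hB : ∀ ω, (run.state (Fintype.card V + n) ω).Theta ≤ B) (i : V) :
    ∑ s ∈ Finset.range n, (∫ ω, ∑ j, run.weight (Fintype.card V + s) ω j *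
        ℓ (Fintype.card V + s + 1) ω j ∂μ - ∫ ω, ℓ (Fintype.card V + s + 1) ω i ∂μ) ≤
      16 / 5 * (√(Real.log (Fintype.card V)) * √B) := by
  set k := Fintype.card V with hk
  have hle : ∀ t, ℱ t ≤ mΩ := ℱ.le
  have hest : ∀ s j, BddMeas mΩ (fun ω => run.est (k + s) ω j) := fun s j =>
    (run.bddMeas_est hβ hK hG hℓ (by omega) j).mono (hle _)
  have hw : ∀ s j, BddMeas mΩ (fun ω => run.weight (k + s) ω j) := fun s j =>
    (run.bddMeas_weight _ j).mono (hle _)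
  have hr : ∀ s, BddMeas mΩ (fun ω => run.rate (k + s) ω) := fun s =>
    (run.bddMeas_rate hβ hG s).mono (hle _)
  have hth : ∀ s, BddMeas mΩ (run.theta (k + s)) := fun s =>
    (run.bddMeas_theta hβ hG (by omega)).mono (hle _)
  have hl : ∀ s j, BddMeas mΩ (fun ω => ℓ (k + s + 1) ω j) := fun s j =>
    (run.bddMeas_loss hℓ _ j).mono ((run.preInfo_le _).trans (hle _))
  -- The learning rates are random, so the exponential weights inequality is used on each path and
  -- integrated afterwards.
  have hpath : ∀ ω, ∑ s ∈ Finset.range n,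
      (∑ j, run.weight (k + s) ω j * run.est (k + s) ω j - run.rate (k + s) ω / 2 *
        ∑ j, run.weight (k + s) ω j * run.est (k + s) ω j ^ 2) ≤
      ∑ s ∈ Finset.range n, run.est (k + s) ω i +
        √2 * (√(Real.log k) * √B) := by
    intro ω
    have h := sum_expWeights_le (fun n => run.rate (k + n) ω) (fun n => run.rate_pos hβ hK hG n ω)
      (fun n => run.rate_anti hβ hG n ω) (fun n => (run.state (k + n) ω).Ltilde)
      (fun n => run.est (k + n) ω) (fun n => run.weight (k + n) ω)
      (run.state_of_le le_rfl ω).1 (fun n i => run.state_Ltilde_succ (Nat.le_add_right _ _) ω i)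
      (fun n i => run.est_nonneg hβ hG hℓ _ ω i) (fun n i => rfl) n i
    refine h.trans ?_
    rw [run.Ltilde_add, run.log_div_rate hβ hK hG]
    have := Real.sqrt_le_sqrt (hB ω)
    gcongr
  have hJ : ∀ s, ∫ ω, ∑ j, run.weight (k + s) ω j * run.est (k + s) ω j ∂μ =
      ∫ ω, ∑ j, run.weight (k + s) ω j * ℓ (k + s + 1) ω j ∂μ := by
    intro s
    rw [integral_finsetSum _ fun j _ => ((hw s j).mul (hest s j)).integrable le_rfl,
      integral_finsetSum _ fun j _ => ((hw s j).mul (hl s j)).integrable le_rfl]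
    exact Finset.sum_congr rfl fun j _ =>
      run.integral_mul_est hβ hK hG hℓ (by omega) j (run.bddMeas_weight _ j)
  -- Rate and weights are known before the draw, so the second moment bound applies with them as
  -- factors; then $q\le2p$ turns $\frac\eta2\sum q/P$ into at most $\eta\theta$.
  have hQ : ∀ s, ∫ ω, run.rate (k + s) ω / 2 *
        ∑ j, run.weight (k + s) ω j * run.est (k + s) ω j ^ 2 ∂μ ≤
      ∫ ω, run.rate (k + s) ω * run.theta (k + s) ω ∂μ := by
    intro s
    have hz : ∀ j, BddMeas (ℱ (k + s))
        (fun ω => run.rate (k + s) ω / 2 * run.weight (k + s) ω j) := fun j =>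
      ((run.bddMeas_rate hβ hG s).mul (.const _)).mul (run.bddMeas_weight _ j)
    have hinv : ∀ j, BddMeas (ℱ (k + s)) (fun ω => (run.obsP (k + s) ω j)⁻¹) := fun j =>
      run.bddMeas_inv_obsP hβ hK hG hℓ (by omega) j
    calc ∫ ω, run.rate (k + s) ω / 2 *
          ∑ j, run.weight (k + s) ω j * run.est (k + s) ω j ^ 2 ∂μ
        = ∑ j, ∫ ω, run.rate (k + s) ω / 2 * run.weight (k + s) ω j *
            run.est (k + s) ω j ^ 2 ∂μ := by
          rw [← integral_finsetSum _ fun j _ =>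
            (((hz j).mono (hle _)).mul (hest s j).pow_two).integrable le_rfl]
          simp only [Finset.mul_sum, mul_assoc]
      _ ≤ ∑ j, ∫ ω, run.rate (k + s) ω / 2 * run.weight (k + s) ω j *
            (run.obsP (k + s) ω j)⁻¹ ∂μ := Finset.sum_le_sum fun j _ =>
          run.integral_mul_est_sq_le hβ hK hG hℓ (by omega) j (hz j) fun ω =>
            mul_nonneg (half_pos (run.rate_pos hβ hK hG s ω)).le (run.weight_pos _ ω j).le
      _ = ∫ ω, ∑ j, run.rate (k + s) ω / 2 * run.weight (k + s) ω j *
            (run.obsP (k + s) ω j)⁻¹ ∂μ := (integral_finsetSum _ fun j _ =>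
          ((hz j).mul (hinv j)).integrable (hle _)).symm
      _ ≤ _ := by
          refine integral_mono ((BddMeas.sum _ fun j _ => (hz j).mul (hinv j)).integrable (hle _))
            (((hr s).mul (hth s)).integrable le_rfl) fun ω => ?_
          dsimp only
          rw [theta, Finset.mul_sum]
          refine Finset.sum_le_sum fun j _ => ?_
          have h1 : run.weight (k + s) ω j ≤ 2 * run.prob (k + s) ω j :=
            expWeight_le_two_mul_playProb (by linarith) _ _ _ _ _
          have h2 := run.rate_pos hβ hK hG s ω
          have h3 := inv_pos.2 (run.obsP_pos hβ hG (k + s) ω j)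
          rw [div_eq_mul_inv (run.prob _ _ _), ← mul_assoc]
          refine mul_le_mul_of_nonneg_right ?_ h3.le
          nlinarith
  have hLint : ∀ s, ∫ ω, run.est (k + s) ω i ∂μ = ∫ ω, ℓ (k + s + 1) ω i ∂μ := by
    intro s
    simpa using run.integral_mul_est hβ hK hG hℓ (by omega : Fintype.card V ≤ k + s) i (.const 1)
  have hJb : ∀ s, BddMeas mΩ (fun ω => ∑ j, run.weight (k + s) ω j * run.est (k + s) ω j) :=
    fun s => .sum _ fun j _ => (hw s j).mul (hest s j)
  have hQb : ∀ s, BddMeas mΩ (fun ω => run.rate (k + s) ω / 2 *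
      ∑ j, run.weight (k + s) ω j * run.est (k + s) ω j ^ 2) :=
    fun s => ((hr s).mul (.const _)).mul (.sum _ fun j _ => (hw s j).mul (hest s j).pow_two)
  have hint := integral_mono (μ := μ)
    ((BddMeas.sum (Finset.range n) fun s _ => (hJb s).sub (hQb s)).integrable le_rfl)
    (((BddMeas.sum (Finset.range n) fun s _ => hest s i).add (.const _)).integrable le_rfl) hpath
  rw [integral_add ((BddMeas.sum _ fun s _ => hest s i).integrable le_rfl) (integrable_const _),
    integral_finsetSum _ fun s _ => ((hJb s).sub (hQb s)).integrable le_rfl,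
    integral_finsetSum _ fun s _ => (hest s i).integrable le_rfl] at hint
  have hsplit : ∀ s, ∫ ω, (∑ j, run.weight (k + s) ω j * run.est (k + s) ω j -
      run.rate (k + s) ω / 2 * ∑ j, run.weight (k + s) ω j * run.est (k + s) ω j ^ 2) ∂μ =
      ∫ ω, ∑ j, run.weight (k + s) ω j * ℓ (k + s + 1) ω j ∂μ -
      ∫ ω, run.rate (k + s) ω / 2 *
        ∑ j, run.weight (k + s) ω j * run.est (k + s) ω j ^ 2 ∂μ := fun s => by
    rw [integral_sub ((hJb s).integrable le_rfl) ((hQb s).integrable le_rfl), hJ]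
  simp only [hsplit, hLint, Finset.sum_sub_distrib] at hint
  have hQsum : ∑ s ∈ Finset.range n, ∫ ω, run.rate (k + s) ω / 2 *
      ∑ j, run.weight (k + s) ω j * run.est (k + s) ω j ^ 2 ∂μ ≤
      5 / 2 * (√(Real.log k) / √2 * √B) := by
    refine (Finset.sum_le_sum fun s _ => hQ s).trans ?_
    rw [← integral_finsetSum _ fun s _ => ((hr s).mul (hth s)).integrable le_rfl]
    calc ∫ ω, ∑ s ∈ Finset.range n, run.rate (k + s) ω * run.theta (k + s) ω ∂μ
        ≤ ∫ _ω, 5 / 2 * (√(Real.log k) / √2 * √B) ∂μ := by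
          refine integral_mono ((BddMeas.sum _ fun s _ => (hr s).mul (hth s)).integrable le_rfl)
            (integrable_const _) fun ω => ?_
          refine (run.sum_rate_mul_theta_le hβ hG n ω).trans ?_
          have := Real.sqrt_le_sqrt (hB ω)
          gcongr
      _ = _ := by simp
  simp only [integral_const, probReal_univ, one_smul] at hint
  rw [Finset.sum_sub_distrib]
  set c := √(Real.log k) * √B with hc
  have hc0 : 0 ≤ c := by positivity
  have h2 : √2 * √2 = 2 := Real.mul_self_sqrt (by norm_num)
  have h2' : √2 ≤ 1.415 := by
    rw [Real.sqrt_le_left (by norm_num)]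
    norm_num
  -- The two contributions are $\frac54\sqrt2$ and $\sqrt2$ times `c`, and
  -- $\frac94\sqrt2\le\frac{16}5$.
  have h3 : 5 / 2 * (√(Real.log k) / √2 * √B) = 5 / 4 * √2 * c := by
    have : (√2 : ℝ)⁻¹ = √2 / 2 := by
      rw [inv_eq_iff_eq_inv, inv_div, eq_div_iff (by positivity)]
      exact h2
    rw [hc, div_eq_mul_inv (√(Real.log k)), this]
    ring
  rw [h3] at hQsum
  nlinarith

/-- The adversarial regret bound, against losses that may be random. -/
theorem sum_regret_le (run : IsRun 1 4 β μ ℱ G ℓ S I) (hβ : 2 ≤ β)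
    (hK : 2 ≤ Fintype.card V) (hG : ∀ t i, (G t).Adj i i)
    (hℓ : ∀ t ω i, ℓ (t + 1) ω i ∈ Set.Icc (0 : ℝ) 1) {T : ℕ} (hT : Fintype.card V ≤ T) {B : ℝ}
    (hB : ∀ ω, (run.state T ω).Theta ≤ B) (i : V) :
    ∑ t ∈ Finset.range T, (∫ ω, ℓ (t + 1) ω (I (t + 1) ω) ∂μ - ∫ ω, ℓ (t + 1) ω i ∂μ) ≤
      Fintype.card V + 16 / 5 * (√(Real.log (Fintype.card V)) * √B) +
        √(Real.log (Fintype.card V)) * √T := by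
  obtain ⟨n, rfl⟩ := Nat.exists_eq_add_of_le hT
  have hK' : (1 : ℝ) ≤ Fintype.card V := by exact_mod_cast Fintype.card_pos (α := V)
  have hl : ∀ s j, BddMeas mΩ (fun ω => ℓ (s + 1) ω j) := fun s j =>
    (run.bddMeas_loss hℓ _ j).mono ((run.preInfo_le _).trans (ℱ.le _))
  have hw : ∀ s j, BddMeas mΩ (fun ω => run.weight s ω j) := fun s j =>
    (run.bddMeas_weight _ j).mono (ℱ.le _)
  rw [Finset.sum_range_add]
  have hinit : ∑ t ∈ Finset.range (Fintype.card V),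
      (∫ ω, ℓ (t + 1) ω (I (t + 1) ω) ∂μ - ∫ ω, ℓ (t + 1) ω i ∂μ) ≤ Fintype.card V := by
    calc _ ≤ ∑ _t ∈ Finset.range (Fintype.card V), (1 : ℝ) := Finset.sum_le_sum fun t _ => by
          have h1 : ∫ ω, ℓ (t + 1) ω (I (t + 1) ω) ∂μ ≤ ∫ _ω, (1 : ℝ) ∂μ :=
            integral_mono ((run.bddMeas_playedLoss hℓ t).integrable (ℱ.le _))
              (integrable_const _) fun ω => (hℓ t ω _).2
          have h2 : 0 ≤ ∫ ω, ℓ (t + 1) ω i ∂μ := integral_nonneg fun ω => (hℓ t ω i).1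
          simp only [integral_const, probReal_univ, one_smul] at h1
          linarith
      _ = _ := by simp
  have hmain := run.sum_integral_weight_sub_le hβ hK hG hℓ n hB i
  -- Passing from $p$ to $q$ costs at most $K$ times the rate cap. The round number is at least `s +
  -- 1`, which yields a bound that sums to $\sqrt{\ln K}\sqrt n$.
  have hround : ∀ s, ∫ ω, ℓ (Fintype.card V + s + 1) ω (I (Fintype.card V + s + 1) ω) ∂μ ≤
      ∫ ω, ∑ j, run.weight (Fintype.card V + s) ω j * ℓ (Fintype.card V + s + 1) ω j ∂μ +
        √(Real.log (Fintype.card V)) / 2 * (1 / √((s : ℝ) + 1)) := by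
    intro s
    set t := Fintype.card V + s with ht
    rw [run.integral_arm hβ t (F := fun a ω => ℓ (t + 1) ω a) fun a => run.bddMeas_loss hℓ t a]
    have hc : ∀ c : ℝ, c = ∫ _ω, c ∂μ := fun c => by simp
    rw [hc (_ * _), ← integral_add
      ((BddMeas.sum _ fun j _ => (hw t j).mul (hl t j)).integrable le_rfl) (integrable_const _)]
    refine integral_mono ((BddMeas.sum _ fun j _ =>
      ((run.bddMeas_law hβ t j).mono (ℱ.le _)).mul (hl t j)).integrable le_rfl)
      (((BddMeas.sum _ fun j _ => (hw t j).mul (hl t j)).add (.const _)).integrable le_rfl)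
      fun ω => ?_
    dsimp only
    have hcap : rateCap V (t + 1) ≤
        √(Real.log (Fintype.card V)) / (2 * Fintype.card V * √((s : ℝ) + 1)) := by
      rw [rateCap_eq Fintype.card_pos]
      have : (s : ℝ) + 1 ≤ (t + 1 : ℕ) := by
        rw [ht]; push_cast; linarith
      have h3 : 0 < √((s : ℝ) + 1) := Real.sqrt_pos.2 (by positivity)
      gcongr
    calc ∑ j, run.law t ω j * ℓ (t + 1) ω j
        ≤ ∑ j, (run.weight t ω j * ℓ (t + 1) ω j +
            √(Real.log (Fintype.card V)) / (2 * Fintype.card V * √((s : ℝ) + 1))) := by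
          refine Finset.sum_le_sum fun j _ => ?_
          rw [law, if_pos (by omega)]
          have h1 : run.prob t ω j ≤ run.weight t ω j + run.expl t ω j :=
            playProb_le_add (by linarith) _ _ _ _ _
          have h2 : run.expl t ω j ≤ rateCap V (t + 1) := explRate_le_rateCap _ _ _ _ _
          have h0 : 0 ≤ run.expl t ω j := explRate_nonneg (by linarith) _ _ _ _
          have h3 := hℓ t ω j
          calc run.prob t ω j * ℓ (t + 1) ω j
              ≤ (run.weight t ω j + run.expl t ω j) * ℓ (t + 1) ω j :=
                mul_le_mul_of_nonneg_right h1 h3.1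
            _ = run.weight t ω j * ℓ (t + 1) ω j + run.expl t ω j * ℓ (t + 1) ω j := by ring
            _ ≤ _ := add_le_add le_rfl
                ((mul_le_of_le_one_right h0 h3.2).trans (h2.trans hcap))
      _ = _ := by
          rw [Finset.sum_add_distrib]
          congr 1
          have h3 : 0 < √((s : ℝ) + 1) := Real.sqrt_pos.2 (by positivity)
          simp only [Finset.sum_const, Finset.card_univ, nsmul_eq_mul]
          field_simp
  have hsum : ∑ s ∈ Finset.range n,
      (∫ ω, ℓ (Fintype.card V + s + 1) ω (I (Fintype.card V + s + 1) ω) ∂μ -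
        ∫ ω, ℓ (Fintype.card V + s + 1) ω i ∂μ) ≤
      16 / 5 * (√(Real.log (Fintype.card V)) * √B) +
        √(Real.log (Fintype.card V)) * √((Fintype.card V + n : ℕ) : ℝ) := by
    calc _ ≤ ∑ s ∈ Finset.range n, ((∫ ω, ∑ j, run.weight (Fintype.card V + s) ω j *
            ℓ (Fintype.card V + s + 1) ω j ∂μ - ∫ ω, ℓ (Fintype.card V + s + 1) ω i ∂μ) +
            √(Real.log (Fintype.card V)) / 2 * (1 / √((s : ℝ) + 1))) :=
          Finset.sum_le_sum fun s _ => by linarith [hround s]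
      _ = _ := Finset.sum_add_distrib
      _ ≤ _ := by
          refine add_le_add hmain ?_
          rw [← Finset.mul_sum]
          have h1 := sum_inv_sqrt_le n
          have h2 : √(n : ℝ) ≤ √((Fintype.card V + n : ℕ) : ℝ) :=
            Real.sqrt_le_sqrt (by push_cast; linarith)
          have h3 := Real.sqrt_nonneg (Real.log (Fintype.card V))
          calc √(Real.log (Fintype.card V)) / 2 * ∑ s ∈ Finset.range n, 1 / √((s : ℝ) + 1)
              ≤ √(Real.log (Fintype.card V)) / 2 * (2 * √n) := by gcongr
            _ = √(Real.log (Fintype.card V)) * √n := by ring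
            _ ≤ _ := by gcongr
  linarith

end IsRun

end AdversarialBound


section Preliminaries

variable {V Ω : Type*} {mΩ : MeasurableSpace Ω} {μ : Measure Ω}
  {ℱ : Filtration ℕ mΩ} {G : ℕ → Digraph V} {ℓ : ℕ → Ω → V → ℝ} {S : ℕ → Ω → Finset V}
  {I : ℕ → Ω → V} {β : ℝ}

lemma measurableSet_const_le {m : MeasurableSpace Ω} {f : Ω → ℝ} (hf : Measurable[m] f) (c : ℝ) :
    MeasurableSet[m] {ω | c ≤ f ω} := measurableSet_le measurable_const hf

/-! ## Independence of the losses from the past -/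

lemma IsStochastic.integral_mul_comp (hs : IsStochastic μ ℱ ℓ)
    (hm : ∀ t, Measurable[ℱ (t + 1)] (ℓ (t + 1))) (t : ℕ) {X : Ω → ℝ} (hX : BddMeas (ℱ t) X)
    {g : (V → ℝ) → ℝ} (hg : Measurable g) :
    ∫ ω, X ω * g (ℓ (t + 1) ω) ∂μ = (∫ ω, X ω ∂μ) * ∫ ω, g (ℓ 1 ω) ∂μ := by
  have hℓ : Measurable (ℓ (t + 1)) := (hm t).mono (ℱ.le _) le_rfl
  have hXm : Measurable X := hX.1.mono (ℱ.le _) le_rfl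
  have hind : IndepFun X (ℓ (t + 1)) μ :=
    (indep_of_indep_of_le_right (hs.indep t) hX.1.comap_le).symm
  have h1 : IndepFun X (fun ω => g (ℓ (t + 1) ω)) μ := hind.comp measurable_id hg
  rw [h1.integral_fun_mul_eq_mul_integral hXm.aestronglyMeasurable
    (hg.comp hℓ).aestronglyMeasurable]
  congr 1
  exact ((hs.identDistrib t).comp hg).integral_eq

/-- Unobserved rounds contribute nothing, so the random number of observations plays the part of the
sample size. -/
lemma IsRun.sum_observed_eq [Fintype V] (run : IsRun 1 4 β μ ℱ G ℓ S I) (lam m : ℝ) (i : V)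
    (t : ℕ) (ω : Ω) :
    ∑ s ∈ Finset.range t, run.seen s ω i * (lam * (ℓ (s + 1) ω i - m) - lam ^ 2 / 8) =
      lam * ((run.state t ω).Lhat i - m * (run.state t ω).obs i) -
        lam ^ 2 / 8 * (run.state t ω).obs i := by
  induction t with
  | zero => simp [state, stateAt]
  | succ t ih =>
    rw [Finset.sum_range_succ, ih, run.state_Lhat_succ, run.state_obs_succ]
    ring

end Preliminaries

section Concentration

variable {V Ω : Type*} [Fintype V] {mΩ : MeasurableSpace Ω} {μ : Measure Ω}
  [IsProbabilityMeasure μ]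
  {ℱ : Filtration ℕ mΩ} {G : ℕ → Digraph V} {ℓ : ℕ → Ω → V → ℝ} {S : ℕ → Ω → Finset V}
  {I : ℕ → Ω → V} {β : ℝ}

/-! ## Exponential supermartingales -/

/-- The hypothesis on `D` is the supermartingale property of the exponentiated partial sums, tested
against bounded nonnegative variables of the past instead of being stated with conditional
expectations. -/
lemma integral_exp_sum_le_one {D : ℕ → Ω → ℝ} (hD : ∀ s, BddMeas (ℱ (s + 1)) (D s))
    (h : ∀ s (X : Ω → ℝ), BddMeas (ℱ s) X → (∀ ω, 0 ≤ X ω) →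
      ∫ ω, X ω * Real.exp (D s ω) ∂μ ≤ ∫ ω, X ω ∂μ) (t : ℕ) :
    ∫ ω, Real.exp (∑ s ∈ Finset.range t, D s ω) ∂μ ≤ 1 := by
  induction t with
  | zero => simp
  | succ t ih =>
    refine le_trans ?_ ih
    have hX : BddMeas (ℱ t) (fun ω => Real.exp (∑ s ∈ Finset.range t, D s ω)) :=
      (BddMeas.sum _ fun s hs => (hD s).mono (ℱ.mono (Finset.mem_range.1 hs))).exp
    have := h t _ hX fun ω => (Real.exp_pos _).le
    simpa only [Finset.sum_range_succ, Real.exp_add] using this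

lemma measureReal_sum_ge_le_exp_neg {D : ℕ → Ω → ℝ} (hD : ∀ s, BddMeas (ℱ (s + 1)) (D s))
    (h : ∀ s (X : Ω → ℝ), BddMeas (ℱ s) X → (∀ ω, 0 ≤ X ω) →
      ∫ ω, X ω * Real.exp (D s ω) ∂μ ≤ ∫ ω, X ω ∂μ) (t : ℕ) (c : ℝ) :
    μ.real {ω | c ≤ ∑ s ∈ Finset.range t, D s ω} ≤ Real.exp (-c) := by
  have hb : BddMeas mΩ (fun ω => ∑ s ∈ Finset.range t, D s ω) :=
    .sum _ fun s _ => (hD s).mono (ℱ.le _)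
  have hint : Integrable (fun ω => Real.exp (∑ s ∈ Finset.range t, D s ω)) μ :=
    hb.exp.integrable le_rfl
  have h1 := mul_meas_ge_le_integral_of_nonneg
    (Filter.Eventually.of_forall fun ω => (Real.exp_pos _).le) hint (Real.exp c)
  have h2 := h1.trans (integral_exp_sum_le_one hD h t)
  simp only [Real.exp_le_exp] at h2
  rw [Real.exp_neg, ← one_div, le_div_iff₀ (Real.exp_pos c), mul_comm]
  exact h2

namespace IsRun

variable [Nonempty V]

/-- Hoeffding's lemma, with $\lambda^2/8$ for losses in an interval of length 1. Whether the arm is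
observed depends on the draw, so the draw is integrated out first; its law is known from the past,
of which the losses of the round are independent. -/
lemma integral_mul_exp_observed_le (run : IsRun 1 4 β μ ℱ G ℓ S I) (hβ : 2 ≤ β)
    (hs : IsStochastic μ ℱ ℓ) (lam : ℝ) (i : V) (t : ℕ) {X : Ω → ℝ} (hX : BddMeas (ℱ t) X)
    (hX0 : ∀ ω, 0 ≤ X ω) :
    ∫ ω, X ω * Real.exp (run.seen t ω i *
      (lam * (ℓ (t + 1) ω i - ∫ ω, ℓ 1 ω i ∂μ) - lam ^ 2 / 8)) ∂μ ≤ ∫ ω, X ω ∂μ := by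
  classical
  set m := ∫ ω, ℓ 1 ω i ∂μ with hm
  set g : V → (V → ℝ) → ℝ := fun a l =>
    if (G (t + 1)).Adj a i then Real.exp (lam * (l i - m) - lam ^ 2 / 8) else 1 with hgdef
  have hg : ∀ a, Measurable (g a) := by
    intro a
    simp only [hgdef]
    split_ifs
    · fun_prop
    · exact measurable_const
  have hl := run.bddMeas_loss hs.mem_Icc t i
  have hgb : ∀ a, BddMeas (run.preInfo t) (fun ω => g a (ℓ (t + 1) ω)) := by
    intro a
    simp only [hgdef]
    split_ifs
    · exact (((hl.sub (.const m)).const_mul lam).sub (.const _)).exp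
    · exact .const 1
  have hle : run.preInfo t ≤ mΩ := (run.preInfo_le t).trans (ℱ.le _)
  have hlaw := run.bddMeas_law hβ t
  have hXl : ∀ a, BddMeas (ℱ t) (fun ω => X ω * run.law t ω a) := fun a => hX.mul (hlaw a)
  have hg1 : ∀ a, ∫ ω, g a (ℓ 1 ω) ∂μ ≤ 1 := by
    intro a
    simp only [hgdef]
    split_ifs
    · have hsub := hasSubgaussianMGF_of_mem_Icc (μ := μ) (X := fun ω => ℓ 1 ω i) (a := 0) (b := 1)
        ((run.measurable_loss 0 i).mono (ℱ.le _) le_rfl).aemeasurable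
        (Filter.Eventually.of_forall fun ω => hs.mem_Icc 0 ω i)
      have h1 := hsub.mgf_le lam
      rw [mgf] at h1
      have h2 : ((((‖(1 : ℝ) - 0‖₊ / 2) ^ 2 : NNReal)) : ℝ) * lam ^ 2 / 2 = lam ^ 2 / 8 := by
        simp; ring
      rw [h2] at h1
      simp only [Real.exp_sub, integral_div]
      rw [div_le_one (Real.exp_pos _)]
      exact h1
    · simp
  calc _ = ∫ ω, X ω * g (I (t + 1) ω) (ℓ (t + 1) ω) ∂μ := by
        congr 1; ext ω
        simp only [hgdef, seen]
        split_ifs <;> simp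
    _ = ∫ ω, ∑ a, run.law t ω a * (X ω * g a (ℓ (t + 1) ω)) ∂μ :=
        run.integral_arm hβ t (F := fun a ω => X ω * g a (ℓ (t + 1) ω))
          fun a => (hX.mono (run.le_preInfo t)).mul (hgb a)
    _ = ∑ a, ∫ ω, X ω * run.law t ω a * g a (ℓ (t + 1) ω) ∂μ := by
        rw [← integral_finsetSum _ fun a _ =>
          (((hXl a).mono (run.le_preInfo t)).mul (hgb a)).integrable hle]
        congr 1; ext ω
        exact Finset.sum_congr rfl fun a _ => by ring
    _ = ∑ a, (∫ ω, X ω * run.law t ω a ∂μ) * ∫ ω, g a (ℓ 1 ω) ∂μ :=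
        Finset.sum_congr rfl fun a _ =>
          hs.integral_mul_comp run.losses_adapted t (hXl a) (hg a)
    _ ≤ ∑ a, ∫ ω, X ω * run.law t ω a ∂μ := Finset.sum_le_sum fun a _ =>
        mul_le_of_le_one_right
          (integral_nonneg fun ω => mul_nonneg (hX0 ω) (run.law_nonneg hβ t ω a)) (hg1 a)
    _ = ∫ ω, X ω ∂μ := by
        rw [← integral_finsetSum _ fun a _ => (hXl a).integrable (ℱ.le _)]
        congr 1; ext ω
        rw [← Finset.mul_sum, run.sum_law, mul_one]

/-- For an indicator $B$ of conditional mean $P$ and $c=\theta-\theta^2/2$ one has $e^{-\theta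
B}\le1-cB$, which averages to $1-cP\le e^{-cP}$. -/
lemma integral_mul_exp_seen_le (run : IsRun 1 4 β μ ℱ G ℓ S I) (hβ : 2 ≤ β)
    (hG : ∀ t i, (G t).Adj i i) {θ : ℝ} (hθ : 0 ≤ θ) (i : V) {t : ℕ} (ht : Fintype.card V ≤ t)
    {X : Ω → ℝ} (hX : BddMeas (ℱ t) X) (hX0 : ∀ ω, 0 ≤ X ω) :
    ∫ ω, X ω * Real.exp (-θ * run.seen t ω i + (θ - θ ^ 2 / 2) * run.obsP t ω i) ∂μ ≤
      ∫ ω, X ω ∂μ := by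
  set c := θ - θ ^ 2 / 2 with hc
  have hP := run.bddMeas_obsP hβ hG ht i
  have hs := (run.bddMeas_seen t i).mono (ℱ.le _)
  have hZ : BddMeas (ℱ t) (fun ω => X ω * Real.exp (c * run.obsP t ω i)) :=
    hX.mul (hP.const_mul c).exp
  have hZ' := hZ.mono (ℱ.le t)
  have hP' := hP.mono (ℱ.le t)
  calc _ ≤ ∫ ω, X ω * Real.exp (c * run.obsP t ω i) - c * (X ω * Real.exp (c * run.obsP t ω i) *
          run.seen t ω i) ∂μ := by
        refine integral_mono (((hX.mono (ℱ.le t)).mul ((hs.const_mul (-θ)).add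
          (hP'.const_mul c)).exp).integrable le_rfl)
          ((hZ'.sub ((hZ'.mul hs).const_mul c)).integrable le_rfl) fun ω => ?_
        dsimp only
        rw [Real.exp_add]
        have h1 : Real.exp (-θ * run.seen t ω i) ≤ 1 - c * run.seen t ω i := by
          unfold seen
          split_ifs
          · have := exp_neg_le_quadratic hθ
            simp only [mul_one]
            linarith
          · simp
        have h2 : 0 ≤ X ω * Real.exp (c * run.obsP t ω i) :=
          mul_nonneg (hX0 ω) (Real.exp_pos _).le
        nlinarith
    _ = ∫ ω, X ω * Real.exp (c * run.obsP t ω i) ∂μ - c * ∫ ω, X ω *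
          Real.exp (c * run.obsP t ω i) * run.obsP t ω i ∂μ := by
        rw [integral_sub (hZ'.integrable le_rfl) (((hZ'.mul hs).const_mul c).integrable le_rfl),
          integral_const_mul, run.integral_mul_seen hβ t i (hZ.mono (run.le_preInfo t))]
        simp only [run.obsProb_law ht]
    _ = ∫ ω, X ω * (Real.exp (c * run.obsP t ω i) * (1 - c * run.obsP t ω i)) ∂μ := by
        rw [← integral_const_mul, ← integral_sub (hZ'.integrable le_rfl)
          (((hZ'.mul hP').const_mul c).integrable le_rfl)]
        congr 1; ext ω; ring
    _ ≤ ∫ ω, X ω ∂μ := by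
        refine integral_mono (((hX.mul ((hP.const_mul c).exp.mul
          ((BddMeas.const 1).sub (hP.const_mul c))))).integrable (ℱ.le t))
          (hX.integrable (ℱ.le t)) fun ω => ?_
        refine mul_le_of_le_one_right (hX0 ω) ?_
        have h1 := Real.add_one_le_exp (-(c * run.obsP t ω i))
        have h2 : Real.exp (c * run.obsP t ω i) * Real.exp (-(c * run.obsP t ω i)) = 1 := by
          rw [← Real.exp_add]; simp
        rw [← h2]
        exact mul_le_mul_of_nonneg_left (by linarith) (Real.exp_pos _).le

open scoped Classical in
-- A Freedman-type bound: $e^y\le1+y+y^2$ for $|y|\le1$, where the deviation of the estimate is at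
-- most $1/P$ and its second moment too. The range condition needs $|\lambda|\le P$, which may fail
-- on some paths; there the increment is set to 0. The condition is known before the draw, so the
-- supermartingale property is kept.
lemma integral_mul_exp_est_le (run : IsRun 1 4 β μ ℱ G ℓ S I) (hβ : 2 ≤ β)
    (hK : 2 ≤ Fintype.card V) (hG : ∀ t i, (G t).Adj i i) (hs : IsStochastic μ ℱ ℓ) (lam : ℝ)
    (i : V) {t : ℕ} (ht : Fintype.card V ≤ t) {X : Ω → ℝ} (hX : BddMeas (ℱ t) X)
    (hX0 : ∀ ω, 0 ≤ X ω) :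
    ∫ ω, X ω * Real.exp (if |lam| ≤ run.obsP t ω i then
      lam * (run.est t ω i - ∫ ω, ℓ 1 ω i ∂μ) - lam ^ 2 * (run.obsP t ω i)⁻¹ else 0) ∂μ ≤
      ∫ ω, X ω ∂μ := by
  set m := ∫ ω, ℓ 1 ω i ∂μ with hm
  have hm0 : 0 ≤ m := integral_nonneg fun ω => (hs.mem_Icc 0 ω i).1
  have hm1 : m ≤ 1 := by
    have h := integral_mono (μ := μ) (((run.bddMeas_loss hs.mem_Icc 0 i).mono
      (run.preInfo_le 0)).integrable (ℱ.le _)) (integrable_const 1)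
      fun ω => (hs.mem_Icc 0 ω i).2
    simpa using h
  have hP := run.bddMeas_obsP hβ hG ht i
  have hPi := run.bddMeas_inv_obsP hβ hK hG hs.mem_Icc ht i
  have he := (run.bddMeas_est hβ hK hG hs.mem_Icc ht i).mono (ℱ.le _)
  have hset : MeasurableSet[ℱ t] {ω | |lam| ≤ run.obsP t ω i} :=
    measurableSet_const_le hP.1 _
  -- `Z` carries the compensated weight where the increment is active; `R` below is `X` where it is
  -- switched off.
  set Z : Ω → ℝ := fun ω => if |lam| ≤ run.obsP t ω i then
    X ω * Real.exp (-(lam ^ 2 * (run.obsP t ω i)⁻¹)) else 0 with hZdef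
  have hZ : BddMeas (ℱ t) Z := .ite hset (hX.mul ((hPi.const_mul _).neg.exp)) (.const 0)
  have hZ0 : ∀ ω, 0 ≤ Z ω := fun ω => by
    simp only [hZdef]
    split_ifs
    · exact mul_nonneg (hX0 ω) (Real.exp_pos _).le
    · exact le_rfl
  set R : Ω → ℝ := fun ω => if |lam| ≤ run.obsP t ω i then 0 else X ω with hRdef
  have hR : BddMeas (ℱ t) R := .ite hset (.const 0) hX
  have hZ' := hZ.mono (ℱ.le t)
  have hR' := hR.mono (ℱ.le t)
  have hPi' := hPi.mono (ℱ.le t)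
  have hmean : ∫ ω, Z ω * run.est t ω i ∂μ = (∫ ω, Z ω ∂μ) * m := by
    rw [run.integral_mul_est hβ hK hG hs.mem_Icc ht i hZ]
    exact hs.integral_mul_comp run.losses_adapted t hZ (g := fun l => l i) (measurable_pi_apply i)
  have hsq := run.integral_mul_est_sq_le hβ hK hG hs.mem_Icc ht i hZ hZ0
  have hdev := he.sub (.const m)
  -- The integrand is `R` plus `Z` times $1+y+y^2$ for $y=\lambda(\mathrm{est}-m)$, expanded in
  -- powers of the estimate.
  calc _ ≤ ∫ ω, R ω + (Z ω + (lam - 2 * lam ^ 2 * m) * (Z ω * run.est t ω i) +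
          lam ^ 2 * (Z ω * run.est t ω i ^ 2) + (lam ^ 2 * m ^ 2 - lam * m) * Z ω) ∂μ := by
        refine integral_mono (((hX.mono (ℱ.le t)).mul (BddMeas.ite (ℱ.le _ _ hset)
          ((hdev.const_mul lam).sub (hPi'.const_mul _)) (.const 0)).exp).integrable le_rfl)
          ((hR'.add (((hZ'.add ((hZ'.mul he).const_mul _)).add
            ((hZ'.mul he.pow_two).const_mul _)).add (hZ'.const_mul _))).integrable le_rfl)
          fun ω => ?_
        simp only [hRdef, hZdef]
        split_ifs with hc
        · have hpos := run.obsP_pos hβ hG t ω i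
          have hPle := run.obsP_le_one hβ t ω i
          have hest : |run.est t ω i - m| ≤ (run.obsP t ω i)⁻¹ := by
            have h1 := run.est_nonneg hβ hG hs.mem_Icc t ω i
            have h2 : run.est t ω i ≤ (run.obsP t ω i)⁻¹ := by
              rw [est, div_eq_mul_inv]
              refine mul_le_of_le_one_left (inv_pos.2 hpos).le ?_
              exact mul_le_one₀ (run.seen_le_one t ω i) (hs.mem_Icc t ω i).1 (hs.mem_Icc t ω i).2
            have h3 := (one_le_inv₀ hpos).2 hPle
            rw [abs_le]
            constructor <;> linarith
          have hy : |lam * (run.est t ω i - m)| ≤ 1 := by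
            rw [abs_mul]
            calc |lam| * |run.est t ω i - m| ≤ run.obsP t ω i * (run.obsP t ω i)⁻¹ :=
                  mul_le_mul hc hest (abs_nonneg _) hpos.le
              _ = 1 := mul_inv_cancel₀ hpos.ne'
          have h1 := Real.abs_exp_sub_one_sub_id_le hy
          have h2 := (abs_le.1 h1).2
          rw [sub_eq_add_neg, Real.exp_add]
          have h3 : 0 ≤ X ω * Real.exp (-(lam ^ 2 * (run.obsP t ω i)⁻¹)) :=
            mul_nonneg (hX0 ω) (Real.exp_pos _).le
          have h4 : Real.exp (lam * (run.est t ω i - m)) ≤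
              1 + lam * (run.est t ω i - m) + (lam * (run.est t ω i - m)) ^ 2 := by linarith
          have h5 := mul_le_mul_of_nonneg_left h4 h3
          linarith
        · simp
    _ = ∫ ω, R ω ∂μ + ((1 - lam ^ 2 * m ^ 2) * ∫ ω, Z ω ∂μ +
          lam ^ 2 * ∫ ω, Z ω * run.est t ω i ^ 2 ∂μ) := by
        rw [integral_add (hR'.integrable le_rfl) (((((hZ'.add ((hZ'.mul he).const_mul _)).add
            ((hZ'.mul he.pow_two).const_mul _)).add (hZ'.const_mul _))).integrable le_rfl),
          integral_add (((hZ'.add ((hZ'.mul he).const_mul _)).add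
            ((hZ'.mul he.pow_two).const_mul _)).integrable le_rfl)
            ((hZ'.const_mul _).integrable le_rfl),
          integral_add ((hZ'.add ((hZ'.mul he).const_mul _)).integrable le_rfl)
            (((hZ'.mul he.pow_two).const_mul _).integrable le_rfl),
          integral_add (hZ'.integrable le_rfl) (((hZ'.mul he).const_mul _).integrable le_rfl),
          integral_const_mul, integral_const_mul, integral_const_mul, hmean]
        ring
    _ ≤ ∫ ω, R ω ∂μ + (∫ ω, Z ω ∂μ + lam ^ 2 * ∫ ω, Z ω * (run.obsP t ω i)⁻¹ ∂μ) := by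
        have h1 : 0 ≤ ∫ ω, Z ω ∂μ := integral_nonneg hZ0
        have h2 := mul_le_mul_of_nonneg_left hsq (sq_nonneg lam)
        have h3 : 0 ≤ lam ^ 2 * m ^ 2 * ∫ ω, Z ω ∂μ := by positivity
        linarith
    _ = ∫ ω, R ω + Z ω * (1 + lam ^ 2 * (run.obsP t ω i)⁻¹) ∂μ := by
        rw [← integral_const_mul, ← integral_add (hZ'.integrable le_rfl)
          (((hZ'.mul hPi').const_mul _).integrable le_rfl), ← integral_add (hR'.integrable le_rfl)
          ((hZ'.add ((hZ'.mul hPi').const_mul _)).integrable le_rfl)]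
        congr 1; ext ω; ring
    _ ≤ ∫ ω, X ω ∂μ := by
        refine integral_mono ((hR'.add (hZ'.mul ((BddMeas.const 1).add
          (hPi'.const_mul _)))).integrable le_rfl) (hX.integrable (ℱ.le t)) fun ω => ?_
        simp only [hRdef, hZdef]
        split_ifs
        · have h1 := Real.add_one_le_exp (lam ^ 2 * (run.obsP t ω i)⁻¹)
          rw [zero_add, mul_assoc]
          refine mul_le_of_le_one_right (hX0 ω) ?_
          rw [Real.exp_neg, inv_mul_le_iff₀ (Real.exp_pos _)]
          linarith
        · simp

/-! ## Deviation probabilities -/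

lemma measureReal_observed_ge_le (run : IsRun 1 4 β μ ℱ G ℓ S I) (hβ : 2 ≤ β)
    (hs : IsStochastic μ ℱ ℓ) (lam : ℝ) (i : V) (t : ℕ) (c : ℝ) :
    μ.real {ω | c ≤ lam * ((run.state t ω).Lhat i - (∫ ω, ℓ 1 ω i ∂μ) * (run.state t ω).obs i) -
        lam ^ 2 / 8 * (run.state t ω).obs i} ≤ Real.exp (-c) := by
  simp only [← run.sum_observed_eq]
  refine measureReal_sum_ge_le_exp_neg (ℱ := ℱ) (fun s => ?_) (fun s X hX hX0 =>
    run.integral_mul_exp_observed_le hβ hs lam i s hX hX0) t c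
  exact (run.bddMeas_seen s i).mul ((((run.bddMeas_loss hs.mem_Icc s i).mono
    (run.preInfo_le s)).sub (.const _) |>.const_mul lam).sub (.const _))

lemma measureReal_seen_ge_le (run : IsRun 1 4 β μ ℱ G ℓ S I) (hβ : 2 ≤ β)
    (hG : ∀ t i, (G t).Adj i i) {θ : ℝ} (hθ : 0 ≤ θ) (i : V) (t : ℕ) (W : Finset ℕ)
    (hW : ∀ s ∈ W, Fintype.card V ≤ s ∧ s < t) (c : ℝ) :
    μ.real {ω | c ≤ ∑ s ∈ W, (-θ * run.seen s ω i + (θ - θ ^ 2 / 2) * run.obsP s ω i)} ≤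
      Real.exp (-c) := by
  have h : ∀ ω, ∑ s ∈ W, (-θ * run.seen s ω i + (θ - θ ^ 2 / 2) * run.obsP s ω i) =
      ∑ s ∈ Finset.range t, if s ∈ W then
        (-θ * run.seen s ω i + (θ - θ ^ 2 / 2) * run.obsP s ω i) else 0 := fun ω => by
    rw [← Finset.sum_filter]
    congr 1
    ext s
    simp only [Finset.mem_filter, Finset.mem_range]
    exact ⟨fun hs => ⟨(hW s hs).2, hs⟩, fun hs => hs.2⟩
  simp only [h]
  refine measureReal_sum_ge_le_exp_neg (ℱ := ℱ) (fun s => ?_) (fun s X hX hX0 => ?_) t c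
  · by_cases hs : s ∈ W
    · simp only [if_pos hs]
      exact ((run.bddMeas_seen s i).const_mul _).add (((run.bddMeas_obsP hβ hG (hW s hs).1 i).mono
        (ℱ.mono (Nat.le_succ s))).const_mul _)
    · simp only [if_neg hs]
      exact .const 0
  · by_cases hs : s ∈ W
    · simp only [if_pos hs]
      exact run.integral_mul_exp_seen_le hβ hG hθ i (hW s hs).1 hX hX0
    · simp [if_neg hs]

open scoped Classical in
lemma measureReal_est_ge_le (run : IsRun 1 4 β μ ℱ G ℓ S I) (hβ : 2 ≤ β)
    (hK : 2 ≤ Fintype.card V) (hG : ∀ t i, (G t).Adj i i) (hs : IsStochastic μ ℱ ℓ) (lam : ℝ)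
    (i : V) (n : ℕ) (c : ℝ) :
    μ.real {ω | c ≤ ∑ s ∈ Finset.range n, if |lam| ≤ run.obsP (Fintype.card V + s) ω i then
      lam * (run.est (Fintype.card V + s) ω i - ∫ ω, ℓ 1 ω i ∂μ) -
        lam ^ 2 * (run.obsP (Fintype.card V + s) ω i)⁻¹ else 0} ≤ Real.exp (-c) := by
  set D : ℕ → Ω → ℝ := fun t ω => if Fintype.card V ≤ t then
    (if |lam| ≤ run.obsP t ω i then lam * (run.est t ω i - ∫ ω, ℓ 1 ω i ∂μ) -
        lam ^ 2 * (run.obsP t ω i)⁻¹ else 0) else 0 with hD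
  have h : ∀ ω, ∑ s ∈ Finset.range n, (if |lam| ≤ run.obsP (Fintype.card V + s) ω i then
      lam * (run.est (Fintype.card V + s) ω i - ∫ ω, ℓ 1 ω i ∂μ) -
        lam ^ 2 * (run.obsP (Fintype.card V + s) ω i)⁻¹ else 0) =
      ∑ t ∈ Finset.range (Fintype.card V + n), D t ω := fun ω => by
    rw [Finset.sum_range_add, Finset.sum_eq_zero (s := Finset.range (Fintype.card V)), zero_add]
    · exact Finset.sum_congr rfl fun s _ => by simp [hD]
    · intro s hs
      simp only [hD]
      rw [if_neg (by simpa using hs)]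
  simp only [h]
  refine measureReal_sum_ge_le_exp_neg (ℱ := ℱ) (fun s => ?_) (fun s X hX hX0 => ?_) _ c
  · by_cases ht : Fintype.card V ≤ s
    · simp only [hD, if_pos ht]
      have hP := run.bddMeas_obsP hβ hG ht i
      have hPi := run.bddMeas_inv_obsP hβ hK hG hs.mem_Icc ht i
      have hset : MeasurableSet[ℱ s] {ω | |lam| ≤ run.obsP s ω i} :=
        measurableSet_const_le hP.1 _
      have hle : ℱ s ≤ ℱ (s + 1) := ℱ.mono (Nat.le_succ s)
      exact .ite (hle _ hset) ((((run.bddMeas_est hβ hK hG hs.mem_Icc ht i).sub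
        (.const _)).const_mul lam).sub ((hPi.mono hle).const_mul _)) (.const 0)
    · simp only [hD, if_neg ht]
      exact .const 0
  · by_cases ht : Fintype.card V ≤ s
    · simp only [hD, if_pos ht]
      exact run.integral_mul_exp_est_le hβ hK hG hs lam i ht hX hX0
    · simp [hD, if_neg ht]

end IsRun

end Concentration


section Confidence

/-! ## Confidence intervals -/

variable {V Ω : Type*} [Fintype V] {mΩ : MeasurableSpace Ω} {μ : Measure Ω}
  {ℱ : Filtration ℕ mΩ} {G : ℕ → Digraph V} {ℓ : ℕ → Ω → V → ℝ} {S : ℕ → Ω → Finset V}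
  {I : ℕ → Ω → V} {β : ℝ}

/-- The mean loss of an arm. -/
noncomputable def armMean (μ : Measure Ω) (ℓ : ℕ → Ω → V → ℝ) (i : V) : ℝ := ∫ ω, ℓ 1 ω i ∂μ

variable (V) in
/-- The exponent of the deviation probabilities at round `t`. -/
noncomputable def confLevel (t : ℕ) : ℝ := 4 * Real.log t + Real.log (Fintype.card V)

/-- The half width of the confidence interval of an arm at round `t`. -/
noncomputable def confWidth (t : ℕ) (st : State V) (i : V) : ℝ :=
  √(confLevel V t / (2 * st.obs i))

/-- All empirical means are within the confidence width of the means `m`. -/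
def State.IsConfident (st : State V) (t : ℕ) (m : V → ℝ) : Prop :=
  ∀ i, |st.Lhat i / st.obs i - m i| ≤ confWidth t st i

lemma confLevel_nonneg (t : ℕ) : 0 ≤ confLevel V t := by
  have := Real.log_natCast_nonneg t
  have := Real.log_natCast_nonneg (Fintype.card V)
  unfold confLevel
  positivity

section Deterministic

variable [Nonempty V]

lemma confLevel_eq {t : ℕ} (ht : 0 < t) :
    4 * Real.log (t * (Fintype.card V : ℝ) ^ (1 / 4 : ℝ)) = confLevel V t := by
  have hK : (0 : ℝ) < Fintype.card V := by exact_mod_cast Fintype.card_pos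
  have ht' : (0 : ℝ) < t := by exact_mod_cast ht
  rw [Real.log_mul ht'.ne' (Real.rpow_pos_of_pos hK _).ne', Real.log_rpow hK, confLevel]
  ring

variable {st : State V} {t : ℕ} {m : V → ℝ}

lemma ucb_eq (ht : 0 < t) (i : V) :
    ucb 4 t st i = min 1 (st.Lhat i / st.obs i + confWidth t st i) := by
  rw [ucb, confLevel_eq ht, confWidth]

lemma lcb_eq (ht : 0 < t) (i : V) :
    lcb 4 t st i = max 0 (st.Lhat i / st.obs i - confWidth t st i) := by
  rw [lcb, confLevel_eq ht, confWidth]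

/-- Lower confidence bounds lie below the means and upper ones above them; means in $[0,1]$ are
needed because of the truncations. Gaps are thus not overestimated, so exploration is never too
scarce. -/
lemma State.IsConfident.gapEst_le (h : st.IsConfident t m) (ht : 0 < t)
    (hm : ∀ i, m i ∈ Set.Icc (0 : ℝ) 1) (i : V) : gapEst 4 t st i ≤ m i - ⨅ j, m j := by
  have hinf : (⨅ j, m j) ≤ ⨅ j, ucb 4 t st j := by
    refine le_ciInf fun j => (ciInf_le (Set.finite_range m).bddBelow j).trans ?_
    rw [ucb_eq ht]
    exact le_min (hm j).2 (by linarith [(abs_le.1 (h j)).1])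
  have hl : lcb 4 t st i ≤ m i := by
    rw [lcb_eq ht]
    exact max_le (hm i).1 (by linarith [(abs_le.1 (h i)).2])
  have hi : (⨅ j, m j) ≤ m i := ciInf_le (Set.finite_range m).bddBelow i
  exact max_le (by linarith) (by linarith)

/-- Used with `j` an optimal arm and both widths at most an eighth of the gap. -/
lemma State.IsConfident.le_gapEst (h : st.IsConfident t m) (ht : 0 < t)
    (i j : V) : m i - m j - 2 * confWidth t st i - 2 * confWidth t st j ≤ gapEst 4 t st i := by
  have hinf : (⨅ k, ucb 4 t st k) ≤ m j + 2 * confWidth t st j := by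
    refine (ciInf_le (Set.finite_range _).bddBelow j).trans ?_
    rw [ucb_eq ht]
    exact (min_le_right _ _).trans (by linarith [(abs_le.1 (h j)).2])
  have hl : m i - 2 * confWidth t st i ≤ lcb 4 t st i := by
    rw [lcb_eq ht]
    exact le_trans (by linarith [(abs_le.1 (h i)).1]) (le_max_right _ _)
  exact le_trans (by linarith) (le_max_right _ _)

end Deterministic

lemma armMean_mem_Icc [IsProbabilityMeasure μ] (run : IsRun 1 4 β μ ℱ G ℓ S I)
    (hs : IsStochastic μ ℱ ℓ) (i : V) :
    armMean μ ℓ i ∈ Set.Icc (0 : ℝ) 1 := by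
  refine ⟨integral_nonneg fun ω => (hs.mem_Icc 0 ω i).1, ?_⟩
  have h := integral_mono (μ := μ) (((run.bddMeas_loss hs.mem_Icc 0 i).mono
    (run.preInfo_le 0)).integrable (ℱ.le _)) (integrable_const 1) fun ω => (hs.mem_Icc 0 ω i).2
  simpa [armMean] using h

variable [Nonempty V] [IsProbabilityMeasure μ]

namespace IsRun

/-- The number of observations is random while the parameter of the exponential bound must be fixed.
Hence a union over the $t$ possible counts, the $K$ arms and both signs: $2Kt$ events of probability
at most $1/((t+1)^4K)$. -/
lemma measureReal_not_isConfident_le (run : IsRun 1 4 β μ ℱ G ℓ S I) (hβ : 2 ≤ β)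
    (hG : ∀ t i, (G t).Adj i i) (hs : IsStochastic μ ℱ ℓ) {t : ℕ} (ht : Fintype.card V ≤ t) :
    μ.real {ω | ¬ (run.state t ω).IsConfident (t + 1) (armMean μ ℓ)} ≤ 2 / ((t : ℝ) + 1) ^ 3 := by
  set Λ := confLevel V (t + 1) with hΛ
  have hΛ0 : 0 ≤ Λ := confLevel_nonneg _
  have hK : (0 : ℝ) < Fintype.card V := by exact_mod_cast Fintype.card_pos
  set E : ℝ → V → Set Ω := fun lam i => {ω | Λ ≤ lam * ((run.state t ω).Lhat i -
    (∫ ω, ℓ 1 ω i ∂μ) * (run.state t ω).obs i) - lam ^ 2 / 8 * (run.state t ω).obs i} with hE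
  set w : ℕ → ℝ := fun o => √(Λ / (2 * o)) with hw
  -- For a count $o$, $\lambda=4w$ maximises $\lambda wo-\lambda^2o/8$, and the maximum $2w^2o$
  -- equals `Λ`.
  have hsub : {ω | ¬ (run.state t ω).IsConfident (t + 1) (armMean μ ℓ)} ⊆
      ⋃ i ∈ (Finset.univ : Finset V), ⋃ o ∈ Finset.Icc 1 t,
        (E (4 * w o) i ∪ E (-(4 * w o)) i) := by
    intro ω hω
    simp only [Set.mem_ofPred_eq, State.IsConfident, not_forall, not_le] at hω
    obtain ⟨i, hi⟩ := hω
    have ho1 := run.one_le_state_obs hG ht ω i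
    have ho2 := run.state_obs_le t ω i
    simp only [Set.mem_iUnion]
    refine ⟨i, Finset.mem_univ i, (run.state t ω).obs i, Finset.mem_Icc.2 ⟨ho1, ho2⟩, ?_⟩
    have hopos : (0 : ℝ) < (run.state t ω).obs i := by exact_mod_cast ho1
    have hw0 : 0 ≤ w ((run.state t ω).obs i) := Real.sqrt_nonneg _
    have hwsq : w ((run.state t ω).obs i) ^ 2 * (2 * (run.state t ω).obs i) = Λ := by
      rw [hw, Real.sq_sqrt (by positivity)]
      field_simp
    change w ((run.state t ω).obs i) < _ at hi
    set o : ℝ := ((run.state t ω).obs i : ℝ) with ho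
    set v := w ((run.state t ω).obs i) with hv
    have hdiv : (run.state t ω).Lhat i = (run.state t ω).Lhat i / o * o := by field_simp
    set x := (run.state t ω).Lhat i / o with hx
    simp only [hE, Set.mem_union, Set.mem_ofPred_eq]
    rw [hdiv]
    change v < |x - ∫ ω, ℓ 1 ω i ∂μ| at hi
    set c := ∫ ω, ℓ 1 ω i ∂μ with hc
    have hvo : 0 ≤ v * o := mul_nonneg hw0 hopos.le
    rcases lt_abs.1 hi with h | h
    · left
      nlinarith [mul_nonneg hvo (sub_nonneg.2 h.le)]
    · right
      nlinarith [mul_nonneg hvo (sub_nonneg.2 h.le)]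
  have hexp : Real.exp (-Λ) = 1 / (((t : ℝ) + 1) ^ 4 * Fintype.card V) := by
    have ht' : (0 : ℝ) < (t : ℝ) + 1 := by positivity
    rw [Real.exp_neg, hΛ, confLevel, Real.exp_add, Real.exp_log hK]
    push_cast
    rw [show 4 * Real.log ((t : ℝ) + 1) = ((4 : ℕ) : ℝ) * Real.log ((t : ℝ) + 1) by norm_num,
      Real.exp_nat_mul, Real.exp_log ht', one_div]
  calc _ ≤ μ.real (⋃ i ∈ (Finset.univ : Finset V), ⋃ o ∈ Finset.Icc 1 t,
        (E (4 * w o) i ∪ E (-(4 * w o)) i)) := measureReal_mono hsub (measure_ne_top _ _)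
    _ ≤ ∑ i : V, ∑ o ∈ Finset.Icc 1 t, (Real.exp (-Λ) + Real.exp (-Λ)) := by
        refine (measureReal_biUnion_finset_le _ _).trans (Finset.sum_le_sum fun i _ => ?_)
        refine (measureReal_biUnion_finset_le _ _).trans (Finset.sum_le_sum fun o _ => ?_)
        exact (measureReal_union_le _ _).trans (add_le_add
          (run.measureReal_observed_ge_le hβ hs _ i t Λ)
          (run.measureReal_observed_ge_le hβ hs _ i t Λ))
    _ = 2 * (t / ((t : ℝ) + 1) ^ 4) := by
        rw [hexp]
        simp only [Finset.sum_const, Nat.card_Icc, Finset.card_univ, nsmul_eq_mul,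
          add_tsub_cancel_right]
        field_simp
        ring
    _ ≤ 2 * (((t : ℝ) + 1) / ((t : ℝ) + 1) ^ 4) := by gcongr; linarith
    _ = _ := by field_simp

end IsRun

end Confidence

section Numerics

/-! ## Consequences of the burn-in condition -/

variable {K N d : ℝ}

lemma one_le_log_of_three_le (hN : 3 ≤ N) : 1 ≤ Real.log N := by
  rw [Real.le_log_iff_exp_le (by linarith)]
  linarith [Real.exp_one_lt_d9]

/-- Cancels the logarithm on the left against $\sqrt{\ln K}\le\ln N$. -/
lemma burnIn_sqrt_ge (hK : 2 ≤ K) (hN : 3 ≤ N) (hKN : K ≤ N)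
    (hR : 640 * K * Real.log N ≤ √N * √(Real.log K) * d ^ 2) : 640 * K ≤ √N * d ^ 2 := by
  have hL := one_le_log_of_three_le hN
  have h1 : √(Real.log K) ≤ Real.log N := by
    have h2 : Real.log K ≤ Real.log N := Real.log_le_log (by linarith) hKN
    rw [Real.sqrt_le_left (by linarith)]
    nlinarith
  have h3 : √N * √(Real.log K) * d ^ 2 ≤ √N * d ^ 2 * Real.log N := by
    rw [mul_right_comm]
    exact mul_le_mul_of_nonneg_left h1 (by positivity)
  exact le_of_mul_le_mul_right (hR.trans h3) (by linarith)

lemma burnIn_ge (hK : 2 ≤ K) (h : 640 * K ≤ √N * d ^ 2) (hN : 0 ≤ N) :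
    (640 * K) ^ 2 ≤ N * d ^ 4 := by
  have h1 : (640 * K) ^ 2 ≤ (√N * d ^ 2) ^ 2 := by
    have : 0 ≤ 640 * K := by linarith
    gcongr
  rw [mul_pow (√N), Real.sq_sqrt hN] at h1
  exact h1.trans_eq (by ring)

end Numerics


section LateRounds

/-! ## Rounds after the burn-in phase -/

variable {V Ω : Type*} [Fintype V] {mΩ : MeasurableSpace Ω} {μ : Measure Ω}
  {ℱ : Filtration ℕ mΩ} {G : ℕ → Digraph V} {ℓ : ℕ → Ω → V → ℝ} {S : ℕ → Ω → Finset V}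
  {I : ℕ → Ω → V}

lemma log_div_le_log_div {x y : ℝ} (hx : 3 ≤ x) (hxy : x ≤ y) :
    Real.log y / y ≤ Real.log x / x := by
  have := Real.exp_one_lt_d9
  exact Real.log_div_self_antitoneOn (by simp only [Set.mem_Ici]; linarith)
    (by simp only [Set.mem_Ici]; linarith) hxy

/-- Round `N` is beyond the burn-in phase of an arm with gap `d`. -/
structure IsPastBurnIn (V : Type*) [Fintype V] (N : ℕ) (d : ℝ) : Prop where
  two_le_card : 2 ≤ Fintype.card V
  card_lt : Fintype.card V < N
  pos : 0 < d
  le_one : d ≤ 1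
  le_sqrt : 640 * Fintype.card V * Real.log N ≤ √N * √(Real.log (Fintype.card V)) * d ^ 2

namespace IsPastBurnIn

variable {N : ℕ} {d : ℝ}

lemma three_le (h : IsPastBurnIn V N d) : (3 : ℝ) ≤ N := by
  have h1 := h.two_le_card
  have h2 := h.card_lt
  exact_mod_cast (by omega : 3 ≤ N)

lemma one_le_log (h : IsPastBurnIn V N d) : 1 ≤ Real.log N := one_le_log_of_three_le h.three_le

lemma sq_le (h : IsPastBurnIn V N d) : (640 * (Fintype.card V : ℝ)) ^ 2 ≤ N * d ^ 4 := by
  have hK : (2 : ℝ) ≤ Fintype.card V := by exact_mod_cast h.two_le_card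
  have hKN : (Fintype.card V : ℝ) ≤ N := by exact_mod_cast h.card_lt.le
  exact burnIn_ge hK (burnIn_sqrt_ge hK h.three_le hKN h.le_sqrt) (Nat.cast_nonneg _)

lemma sq_le_mul (h : IsPastBurnIn V N d) : (640 * (Fintype.card V : ℝ)) ^ 2 ≤ N * d ^ 2 := by
  have h1 : d ^ 4 ≤ d ^ 2 := pow_le_pow_of_le_one h.pos.le h.le_one (by norm_num)
  exact h.sq_le.trans (mul_le_mul_of_nonneg_left h1 (Nat.cast_nonneg _))

lemma mul_card_le (h : IsPastBurnIn V N d) : 1000 * (Fintype.card V : ℝ) ≤ d * N := by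
  have hK : (2 : ℝ) ≤ Fintype.card V := by exact_mod_cast h.two_le_card
  have h1 : (N : ℝ) * d ^ 2 ≤ N * d :=
    mul_le_mul_of_nonneg_left (by nlinarith [h.pos, h.le_one]) (Nat.cast_nonneg _)
  nlinarith [h.sq_le_mul]

lemma log_card_le (h : IsPastBurnIn V N d) :
    Real.log (Fintype.card V) ≤ Real.log N / 2 := by
  have hK : (2 : ℝ) ≤ Fintype.card V := by exact_mod_cast h.two_le_card
  have h1 : (Fintype.card V : ℝ) ^ 2 ≤ N := by
    have h2 : (N : ℝ) * d ^ 2 ≤ N :=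
      mul_le_of_le_one_right (Nat.cast_nonneg _) (pow_le_one₀ h.pos.le h.le_one)
    nlinarith [h.sq_le_mul]
  have h2 := Real.log_le_log (by positivity) h1
  rw [Real.log_pow] at h2
  push_cast at h2
  linarith

end IsPastBurnIn

namespace IsRun

variable {N : ℕ} {d : ℝ}

lemma sum_seen_eq (run : IsRun 1 4 320 μ ℱ G ℓ S I) (t : ℕ) (ω : Ω) (i : V) :
    ((run.state t ω).obs i : ℝ) = ∑ s ∈ Finset.range t, run.seen s ω i := by
  induction t with
  | zero => simp [state, stateAt]
  | succ t ih => rw [run.state_obs_succ, ih, Finset.sum_range_succ]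

/-- Arms are observed often, unless the observations deviate from their probabilities. -/
lemma le_obs_of_lt (run : IsRun 1 4 320 μ ℱ G ℓ S I) {t : ℕ} (h : IsPastBurnIn V (t + 1) d)
    {a : ℕ} (ha : (a : ℝ) ≤ (t + 1 : ℕ) / 4) (hat : a ≤ t) {ω : Ω} {i : V}
    (hP : ∀ s ∈ Finset.Ico a t, 320 * Real.log (t + 1 : ℕ) / ((t + 1 : ℕ) * d ^ 2) ≤
      run.obsP s ω i)
    (hdev : ∑ s ∈ Finset.Ico a t, (-(1 / 4 : ℝ) * run.seen s ω i +
      (1 / 4 - (1 / 4 : ℝ) ^ 2 / 2) * run.obsP s ω i) < 3 * Real.log (t + 1 : ℕ)) :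
    144 * Real.log (t + 1 : ℕ) / d ^ 2 ≤ (run.state t ω).obs i := by
  have hd := h.pos
  have hL := h.one_le_log
  have hbig := h.mul_card_le
  have hK : (2 : ℝ) ≤ Fintype.card V := by exact_mod_cast h.two_le_card
  set L := Real.log (t + 1 : ℕ) with hLdef
  have hNpos : (0 : ℝ) < (t + 1 : ℕ) := by positivity
  have hN : (2000 : ℝ) ≤ (t + 1 : ℕ) := by
    have := mul_le_of_le_one_left hNpos.le h.le_one
    linarith
  -- The window has $t-a\ge N-1-N/4$ rounds with $N=t+1\ge2000$; then $\frac58\cdot320=200$.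
  have hcount : 5 / 8 * ((t + 1 : ℕ) : ℝ) ≤ (Finset.Ico a t).card := by
    rw [Nat.card_Ico, Nat.cast_sub hat]
    push_cast at *
    linarith
  have hsumP : 200 * (L / d ^ 2) ≤ ∑ s ∈ Finset.Ico a t, run.obsP s ω i := by
    calc 200 * (L / d ^ 2) = 5 / 8 * ((t + 1 : ℕ) : ℝ) * (320 * L / ((t + 1 : ℕ) * d ^ 2)) := by
          field_simp
          norm_num
      _ ≤ (Finset.Ico a t).card * (320 * L / ((t + 1 : ℕ) * d ^ 2)) := by gcongr
      _ = ∑ s ∈ Finset.Ico a t, (320 * L / ((t + 1 : ℕ) * d ^ 2)) := by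
          rw [Finset.sum_const, nsmul_eq_mul]
      _ ≤ _ := Finset.sum_le_sum hP
  have hseen : ∑ s ∈ Finset.Ico a t, run.seen s ω i ≤ (run.state t ω).obs i := by
    rw [run.sum_seen_eq]
    refine Finset.sum_le_sum_of_subset_of_nonneg (fun s hs => ?_)
      fun s _ _ => run.seen_nonneg s ω i
    exact Finset.mem_range.2 (Finset.mem_Ico.1 hs).2
  -- Multiplied by 4, the deviation bound says that the number of observations exceeds $\frac78\sum
  -- P-12L$, hence $(175-12)L/d^2$.
  rw [Finset.sum_add_distrib, ← Finset.mul_sum, ← Finset.mul_sum] at hdev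
  have hLd : L ≤ L / d ^ 2 := by
    rw [le_div_iff₀ (by positivity)]
    exact mul_le_of_le_one_right (by linarith) (pow_le_one₀ hd.le h.le_one)
  rw [mul_div_assoc]
  linarith

/-- Past the burn-in $\ln K\le L/2$ with $L$ the logarithm of the round, so the level is at most
$\frac92L$, and $\frac92/(2\cdot144)=\frac1{64}$. -/
lemma confWidth_le (run : IsRun 1 4 320 μ ℱ G ℓ S I) {t : ℕ} (h : IsPastBurnIn V (t + 1) d)
    {ω : Ω} {i : V} (hO : 144 * Real.log (t + 1 : ℕ) / d ^ 2 ≤ (run.state t ω).obs i) :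
    confWidth (t + 1) (run.state t ω) i ≤ d / 8 := by
  have hd := h.pos
  have hL := h.one_le_log
  have h1 := h.log_card_le
  have hpos : 0 < 144 * Real.log (t + 1 : ℕ) / d ^ 2 := by positivity
  rw [confWidth, Real.sqrt_le_left (by positivity), div_le_iff₀ (by linarith)]
  rw [div_le_iff₀ (by positivity)] at hO
  unfold confLevel
  nlinarith

variable [Nonempty V]

/-- This is the burn-in inequality divided by $2KNd^2$, whence its constant $640=2\beta$: for a gap
`d` the cap no longer binds. -/
lemma _root_.FeedbackGraph.IsPastBurnIn.le_rateCap (h : IsPastBurnIn V N d) :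
    320 * Real.log N / (N * d ^ 2) ≤ rateCap V N := by
  have hK : (2 : ℝ) ≤ Fintype.card V := by exact_mod_cast h.two_le_card
  have hN := h.three_le
  have hd := h.pos
  have hs : 0 < √(N : ℝ) := Real.sqrt_pos.2 (by linarith)
  rw [rateCap_eq Fintype.card_pos, div_le_div_iff₀ (by positivity) (by positivity)]
  have h1 := mul_le_mul_of_nonneg_right h.le_sqrt hs.le
  have h2 : √(N : ℝ) * √N = N := Real.mul_self_sqrt (by linarith)
  calc _ = 640 * Fintype.card V * Real.log N * √N := by ring
    _ ≤ _ := h1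
    _ = √(Real.log (Fintype.card V)) * ((√(N : ℝ) * √N) * d ^ 2) := by ring
    _ = _ := by rw [h2]

/-- Both the cap and $\ln x/x$, for $x\ge3$, decrease, so the value at round `N` bounds the rates of
all earlier rounds from below. -/
lemma le_obsP_of_gapEst_le (run : IsRun 1 4 320 μ ℱ G ℓ S I) (hG : ∀ t i, (G t).Adj i i)
    (h : IsPastBurnIn V N d) {s : ℕ} (hs : Fintype.card V ≤ s) (hsN : s + 1 ≤ N) {ω : Ω} {i : V}
    (hg : gapEst 4 (s + 1) (run.state s ω) i ≤ d) :
    320 * Real.log N / (N * d ^ 2) ≤ run.obsP s ω i := by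
  have hd := h.pos
  have h2 := h.two_le_card
  refine le_trans (le_min ?_ ?_) (min_le_obsProb (by norm_num) (by omega) (hG (s + 1))
    (run.isExplorationSet s hs ω) hg)
  · exact h.le_rateCap.trans (rateCap_antitone (by omega) hsN h2)
  · have h3 : (3 : ℝ) ≤ (s + 1 : ℕ) := by exact_mod_cast (by omega : 3 ≤ s + 1)
    have h4 := log_div_le_log_div h3 (by exact_mod_cast hsN : ((s + 1 : ℕ) : ℝ) ≤ N)
    have e : ∀ x y : ℝ, 320 * x / (y * d ^ 2) = 320 * (x / y) / d ^ 2 := fun x y => by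
      rw [mul_div_assoc', div_div]
    rw [e, e]
    gcongr

/-- Early rounds offer only the trivial estimate that gaps are at most 1. Since $s+1\le dN/4$ and
$\ln(dN/4)\ge\frac12\ln N$, the factor $\ln(s+1)/(s+1)$ is large enough to gain $1/d$ all the same.
-/
lemma le_obsP_of_le (run : IsRun 1 4 320 μ ℱ G ℓ S I) (hG : ∀ t i, (G t).Adj i i)
    (hℓ : ∀ t ω i, ℓ (t + 1) ω i ∈ Set.Icc (0 : ℝ) 1)
    (h : IsPastBurnIn V N d) {s : ℕ} (hs : Fintype.card V ≤ s) (hsN : ((s + 1 : ℕ) : ℝ) ≤ d * N / 4)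
    (ω : Ω) (i : V) :
    320 * Real.log N / (N * d) ≤ run.obsP s ω i := by
  have hd := h.pos
  have hN := h.three_le
  have hL := h.one_le_log
  have h2 := h.two_le_card
  have hK : (2 : ℝ) ≤ Fintype.card V := by exact_mod_cast h.two_le_card
  have hdN : d * N ≤ N := mul_le_of_le_one_left (by linarith) h.le_one
  have hsN' : s + 1 ≤ N := by
    have : ((s + 1 : ℕ) : ℝ) ≤ N := by linarith
    exact_mod_cast this
  refine le_trans (le_min ?_ ?_) (min_le_obsProb (by norm_num) (by omega) (hG (s + 1))
    (run.isExplorationSet s hs ω) (gapEst_le_one 4 (s + 1) (run.state_isValid hℓ s ω) i))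
  · refine le_trans ?_ (h.le_rateCap.trans (rateCap_antitone (by omega) hsN' h2))
    have : d ^ 2 ≤ d := by nlinarith [h.le_one]
    gcongr
  · have h3 : (3 : ℝ) ≤ (s + 1 : ℕ) := by exact_mod_cast (by omega : 3 ≤ s + 1)
    have h4 := log_div_le_log_div h3 hsN
    have h5 : Real.log N / 2 ≤ Real.log (d * N / 4) := by
      rw [div_le_iff₀ (by norm_num), mul_comm, show (2 : ℝ) = ((2 : ℕ) : ℝ) by norm_num,
        ← Real.log_pow]
      refine Real.log_le_log (by linarith) ?_
      have h6 := h.sq_le_mul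
      have h7 : (16 : ℝ) ≤ N * d ^ 2 := by nlinarith
      nlinarith
    have h8 : Real.log N / 2 / (d * N / 4) ≤ Real.log (d * N / 4) / (d * N / 4) := by gcongr
    have h9 : Real.log N / (N * d) ≤ Real.log N / 2 / (d * N / 4) := by
      rw [div_div, div_le_div_iff₀ (by positivity) (by positivity)]
      nlinarith [mul_pos (by linarith : 0 < Real.log N) (mul_pos hd (by linarith : (0 : ℝ) < N))]
    rw [one_pow, mul_one, mul_div_assoc, mul_div_assoc]
    exact mul_le_mul_of_nonneg_left (h9.trans (h8.trans h4)) (by norm_num)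

open scoped Classical in
/-- The cumulative loss estimates do not deviate by more than a quarter of the gap. -/
lemma mul_Ltilde_sub_lt (run : IsRun 1 4 320 μ ℱ G ℓ S I)
    {n : ℕ} (h : IsPastBurnIn V (Fintype.card V + n + 1) d) {a : ℕ}
    (hKa : Fintype.card V ≤ a) (ha : (a : ℝ) ≤ d * (Fintype.card V + n + 1 : ℕ) / 4)
    {ω : Ω} {i : V} {m lam : ℝ}
    (hlam : |lam| = 16 * Real.log (Fintype.card V + n + 1 : ℕ) /
      ((Fintype.card V + n + 1 : ℕ) * d))
    (hearly : ∀ s, Fintype.card V ≤ s → s < a → 320 * Real.log (Fintype.card V + n + 1 : ℕ) /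
      ((Fintype.card V + n + 1 : ℕ) * d) ≤ run.obsP s ω i)
    (hlate : ∀ s, a ≤ s → s < Fintype.card V + n →
      320 * Real.log (Fintype.card V + n + 1 : ℕ) /
      ((Fintype.card V + n + 1 : ℕ) * d ^ 2) ≤ run.obsP s ω i)
    (hdev : ∑ s ∈ Finset.range n, (if |lam| ≤ run.obsP (Fintype.card V + s) ω i then
      lam * (run.est (Fintype.card V + s) ω i - m) -
        lam ^ 2 * (run.obsP (Fintype.card V + s) ω i)⁻¹ else 0) <
        3 * Real.log (Fintype.card V + n + 1 : ℕ)) :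
    lam * ((run.state (Fintype.card V + n) ω).Ltilde i - n * m) <
      4 * Real.log (Fintype.card V + n + 1 : ℕ) := by
  have hd := h.pos
  have hL := h.one_le_log
  have hNpos : (0 : ℝ) < (Fintype.card V + n + 1 : ℕ) := by positivity
  have hnN : (n : ℝ) ≤ (Fintype.card V + n + 1 : ℕ) := by exact_mod_cast (by omega)
  have haN : (a : ℝ) - Fintype.card V ≤ d * (Fintype.card V + n + 1 : ℕ) / 4 := by
    have : (0 : ℝ) ≤ Fintype.card V := Nat.cast_nonneg _
    linarith
  set N : ℝ := ((Fintype.card V + n + 1 : ℕ) : ℝ) with hN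
  set L := Real.log N with hLdef
  have hd2 : d ^ 2 ≤ d := by nlinarith [h.le_one]
  -- `u` and `v` bound $1/P$ before and after round `a`. There are at most $dN/4$ early rounds, so
  -- the two shares of the variance are $N^2d^2/(1280L)$ and $N^2d^2/(320L)$, in total
  -- $N^2d^2/(256L)$.
  set u : ℝ := N * d / (320 * L) with hu
  set v : ℝ := N * d ^ 2 / (320 * L) with hv
  have hu0 : 0 < u := by positivity
  have hv0 : 0 < v := by positivity
  have hueq : 320 * L / (N * d) = u⁻¹ := by rw [hu, inv_div]
  have hveq : 320 * L / (N * d ^ 2) = v⁻¹ := by rw [hv, inv_div]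
  have hvu : u⁻¹ ≤ v⁻¹ := by
    refine inv_anti₀ hv0 ?_
    rw [hu, hv]
    gcongr
  have hlamle : |lam| ≤ u⁻¹ := by
    rw [hlam, ← hueq]
    gcongr
    norm_num
  have hPu : ∀ s, s < n → u⁻¹ ≤ run.obsP (Fintype.card V + s) ω i := fun s hs => by
    by_cases hsa : Fintype.card V + s < a
    · exact hueq ▸ hearly _ (by omega) hsa
    · exact hvu.trans (hveq ▸ hlate _ (by omega) (by omega))
  have hinv : ∀ s ∈ Finset.range n, (run.obsP (Fintype.card V + s) ω i)⁻¹ ≤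
      (if s < a - Fintype.card V then u else 0) + v := fun s hs => by
    have hs' := Finset.mem_range.1 hs
    split_ifs with hsa
    · have := inv_anti₀ (inv_pos.2 hu0) (hPu s hs')
      rw [inv_inv] at this
      linarith
    · have := inv_anti₀ (inv_pos.2 hv0) (hveq ▸ hlate (Fintype.card V + s) (by omega) (by omega))
      rw [inv_inv] at this
      linarith
  have hV : ∑ s ∈ Finset.range n, (run.obsP (Fintype.card V + s) ω i)⁻¹ ≤
      N ^ 2 * d ^ 2 / (256 * L) := by
    calc _ ≤ ∑ s ∈ Finset.range n, ((if s < a - Fintype.card V then u else 0) + v) :=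
          Finset.sum_le_sum hinv
      _ = ((Finset.range n).filter (· < a - Fintype.card V)).card * u + n * v := by
          rw [Finset.sum_add_distrib, ← Finset.sum_filter, Finset.sum_const, Finset.sum_const,
            nsmul_eq_mul, nsmul_eq_mul, Finset.card_range]
      _ ≤ d * N / 4 * u + N * v := by
          gcongr
          refine le_trans ?_ haN
          rw [← Nat.cast_sub hKa]
          norm_cast
          calc _ ≤ (Finset.range (a - Fintype.card V)).card :=
                Finset.card_le_card fun s hs => Finset.mem_range.2 (Finset.mem_filter.1 hs).2
            _ = _ := Finset.card_range _
      _ = _ := by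
          rw [hu, hv]
          field_simp
          norm_num
  -- All observation probabilities are at least $u^{-1}\ge|\lambda|$ here, so the truncation is
  -- inactive.
  have heq : ∑ s ∈ Finset.range n, (if |lam| ≤ run.obsP (Fintype.card V + s) ω i then
      lam * (run.est (Fintype.card V + s) ω i - m) -
        lam ^ 2 * (run.obsP (Fintype.card V + s) ω i)⁻¹ else 0) =
      lam * ((run.state (Fintype.card V + n) ω).Ltilde i - n * m) -
        lam ^ 2 * ∑ s ∈ Finset.range n, (run.obsP (Fintype.card V + s) ω i)⁻¹ := by
    rw [run.Ltilde_add, Finset.mul_sum]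
    have : (n : ℝ) * m = ∑ _s ∈ Finset.range n, m := by simp
    rw [this, ← Finset.sum_sub_distrib, Finset.mul_sum, ← Finset.sum_sub_distrib]
    exact Finset.sum_congr rfl fun s hs =>
      if_pos (hlamle.trans (hPu s (Finset.mem_range.1 hs)))
  rw [heq] at hdev
  have hlamsq : lam ^ 2 = (16 * L / (N * d)) ^ 2 := by rw [← sq_abs, hlam]
  have hfin : lam ^ 2 * ∑ s ∈ Finset.range n, (run.obsP (Fintype.card V + s) ω i)⁻¹ ≤ L := by
    calc _ ≤ lam ^ 2 * (N ^ 2 * d ^ 2 / (256 * L)) := by gcongr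
      _ = L := by
          rw [hlamsq]
          field_simp
          norm_num
  linarith

/-- The weight of an arm whose cumulative loss estimate exceeds another one by its gap is small. -/
lemma weight_le_of_le (run : IsRun 1 4 320 μ ℱ G ℓ S I) (hG : ∀ t i, (G t).Adj i i)
    {t : ℕ} (ht : Fintype.card V ≤ t) (h : IsPastBurnIn V (t + 1) d)
    {ω : Ω} {i j : V} (hL : ((t + 1 : ℕ) : ℝ) * d / 4 ≤
      (run.state t ω).Ltilde i - (run.state t ω).Ltilde j) :
    run.weight t ω i ≤ 1 / ((t + 1 : ℕ) : ℝ) ^ 2 := by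
  have hd := h.pos
  have hlog := h.one_le_log
  have hK : (2 : ℝ) ≤ Fintype.card V := by exact_mod_cast h.two_le_card
  have hTheta := run.Theta_le_card_mul (by norm_num) hG ht ω
  have hge : (Fintype.card V : ℝ) ≤ (run.state t ω).Theta := by
    obtain ⟨n, rfl⟩ := Nat.exists_eq_add_of_le ht
    exact run.card_le_Theta (by norm_num) hG n ω
  have hNt : (t : ℝ) ≤ (t + 1 : ℕ) := by push_cast; linarith
  have hsq := h.le_sqrt
  set N : ℝ := ((t + 1 : ℕ) : ℝ) with hN
  have hNpos : 0 < N := by positivity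
  set L := Real.log N with hLdef
  have hs : 0 < √N := Real.sqrt_pos.2 hNpos
  have hss : √N * √N = N := Real.mul_self_sqrt hNpos.le
  set η := learningRate (run.state t ω) with hη
  have hηge : √(Real.log (Fintype.card V)) / (Fintype.card V * √N) ≤ η := by
    have h0 : 0 ≤ Real.log (Fintype.card V) := Real.log_nonneg (by linarith)
    have h1 : √(Real.log (Fintype.card V)) / (Fintype.card V * √N) =
        √(Real.log (Fintype.card V) / (Fintype.card V ^ 2 * N)) := by
      rw [Real.sqrt_div h0, Real.sqrt_mul (by positivity), Real.sqrt_sq (by linarith)]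
    rw [h1, hη, learningRate]
    have h2 : 2 * (run.state t ω).Theta ≤ (Fintype.card V : ℝ) ^ 2 * N := by
      have : (Fintype.card V : ℝ) * t ≤ Fintype.card V * N := by gcongr
      nlinarith [mul_pos (by linarith : (0 : ℝ) < Fintype.card V) hNpos]
    have h3 : 0 < 2 * (run.state t ω).Theta := by linarith
    gcongr
  -- The burn-in inequality even yields $160L/d$.
  have hmain : 2 * L ≤ η * (N * d / 4) := by
    have h1 : √(Real.log (Fintype.card V)) / (Fintype.card V * √N) * (N * d / 4) =
        √N * √(Real.log (Fintype.card V)) * d ^ 2 / (4 * Fintype.card V * d) := by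
      field_simp
      rw [Real.sq_sqrt hNpos.le]
    calc 2 * L ≤ 160 * L / d := by
          rw [le_div_iff₀ hd]
          nlinarith [h.le_one]
      _ = 640 * Fintype.card V * L / (4 * Fintype.card V * d) := by
          field_simp
          norm_num
      _ ≤ √N * √(Real.log (Fintype.card V)) * d ^ 2 / (4 * Fintype.card V * d) := by gcongr
      _ = _ := h1.symm
      _ ≤ _ := by gcongr
  calc run.weight t ω i ≤ Real.exp (-η * ((run.state t ω).Ltilde i - (run.state t ω).Ltilde j)) :=
        expWeight_le_exp _ i j
    _ ≤ Real.exp (-(2 * L)) := by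
        rw [Real.exp_le_exp]
        have hη0 : 0 ≤ η := Real.sqrt_nonneg _
        have := mul_le_mul_of_nonneg_left hL hη0
        linarith
    _ = 1 / N ^ 2 := by
        rw [show -(2 * L) = -(((2 : ℕ) : ℝ) * L) by norm_num, Real.exp_neg, Real.exp_nat_mul,
          Real.exp_log hNpos, one_div]

end IsRun

end LateRounds


section RoundRegret

/-! ## The regret of a round after the burn-in phase -/

variable {V Ω : Type*} [Fintype V] {mΩ : MeasurableSpace Ω} {μ : Measure Ω}
  {ℱ : Filtration ℕ mΩ} {G : ℕ → Digraph V} {ℓ : ℕ → Ω → V → ℝ} {S : ℕ → Ω → Finset V}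
  {I : ℕ → Ω → V}

lemma IsPastBurnIn.mono_gap {N : ℕ} {δ d : ℝ} (h : IsPastBurnIn V N δ)
    (hδ : δ ≤ d) (hd : d ≤ 1) : IsPastBurnIn V N d where
  two_le_card := h.two_le_card
  card_lt := h.card_lt
  pos := h.pos.trans_le hδ
  le_one := hd
  le_sqrt := h.le_sqrt.trans (by have := h.pos; gcongr)

lemma gap_nonneg (ℓ : ℕ → Ω → V → ℝ) (i : V) : 0 ≤ gap μ ℓ i :=
  sub_nonneg.2 (ciInf_le (Set.finite_range _).bddBelow i)

variable [IsProbabilityMeasure μ]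

namespace IsRun

lemma gap_le_one (run : IsRun 1 4 320 μ ℱ G ℓ S I) (hs : IsStochastic μ ℱ ℓ) (i : V) :
    gap μ ℓ i ≤ 1 := by
  have h1 : 0 ≤ ⨅ k, armMean μ ℓ k := Real.iInf_nonneg fun k => (armMean_mem_Icc run hs k).1
  have h2 := (armMean_mem_Icc run hs i).2
  change armMean μ ℓ i - ⨅ k, armMean μ ℓ k ≤ 1
  linarith

variable [Nonempty V]

open scoped Classical in
/-- Outside of a rare event, the gap of a suboptimal arm is well estimated and its weight is
small. -/
lemma exists_rare_event (run : IsRun 1 4 320 μ ℱ G ℓ S I) (hG : ∀ t i, (G t).Adj i i)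
    (hs : IsStochastic μ ℱ ℓ) {t : ℕ} (ht : Fintype.card V ≤ t) {i j : V} {d : ℝ}
    (hi : gap μ ℓ i = d) (hj : gap μ ℓ j = 0) (h : IsPastBurnIn V (t + 1) d) :
    ∃ E : Set Ω, MeasurableSet E ∧ μ.real E ≤ 132 / (d ^ 3 * ((t + 1 : ℕ) : ℝ) ^ 2) ∧
      ∀ ω ∉ E, d / 2 ≤ gapEst 4 (t + 1) (run.state t ω) i ∧
        run.weight t ω i ≤ 1 / ((t + 1 : ℕ) : ℝ) ^ 2 := by
  obtain ⟨n, rfl⟩ := Nat.exists_eq_add_of_le ht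
  have hβ : (2 : ℝ) ≤ 320 := by norm_num
  have hd := h.pos
  have hd1 := h.le_one
  have hL := h.one_le_log
  have hK2 := h.two_le_card
  have hbig := h.mul_card_le
  have hm := armMean_mem_Icc run hs
  have hK : (2 : ℝ) ≤ Fintype.card V := by exact_mod_cast hK2
  have hNpos : (0 : ℝ) < (Fintype.card V + n + 1 : ℕ) := by positivity
  have hdN : d * (Fintype.card V + n + 1 : ℕ) ≤ (Fintype.card V + n + 1 : ℕ) :=
    mul_le_of_le_one_left hNpos.le hd1
  have hgi : armMean μ ℓ i - ⨅ k, armMean μ ℓ k = d := hi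
  have hgj : armMean μ ℓ j - ⨅ k, armMean μ ℓ k = 0 := hj
  obtain ⟨N, hN⟩ : ∃ N : ℝ, N = ((Fintype.card V + n + 1 : ℕ) : ℝ) := ⟨_, rfl⟩
  set L := Real.log ((Fintype.card V + n + 1 : ℕ) : ℝ) with hLdef
  -- The cut balances two needs: late enough that failures of the confidence intervals after it are
  -- summable, early enough that the larger variance before it, over at most $dN/4$ rounds, does no
  -- harm.
  set a := ⌊d * (Fintype.card V + n + 1 : ℕ) / 4⌋₊ with ha
  have ha1 : (a : ℝ) ≤ d * (Fintype.card V + n + 1 : ℕ) / 4 := Nat.floor_le (by positivity)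
  have ha2 : d * (Fintype.card V + n + 1 : ℕ) / 4 < a + 1 := Nat.lt_floor_add_one _
  have hKa : Fintype.card V ≤ a := Nat.le_floor (by linarith)
  have hat : a ≤ Fintype.card V + n := by
    have h1 : (a : ℝ) < (Fintype.card V + n + 1 : ℕ) := by linarith
    have : a < Fintype.card V + n + 1 := by exact_mod_cast h1
    omega
  set lam0 := 16 * L / ((Fintype.card V + n + 1 : ℕ) * d) with hlam0
  have hlampos : 0 < lam0 := by positivity
  set B : ℕ → Set Ω := fun s =>
    {ω | ¬ (run.state s ω).IsConfident (s + 1) (armMean μ ℓ)} with hB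
  set O : V → Set Ω := fun k => {ω | 3 * L ≤ ∑ s ∈ Finset.Ico a (Fintype.card V + n),
    (-(1 / 4 : ℝ) * run.seen s ω k + (1 / 4 - (1 / 4 : ℝ) ^ 2 / 2) * run.obsP s ω k)} with hO
  set D : ℝ → V → Set Ω := fun lam k => {ω | 3 * L ≤ ∑ s ∈ Finset.range n,
    if |lam| ≤ run.obsP (Fintype.card V + s) ω k then
      lam * (run.est (Fintype.card V + s) ω k - ∫ ω, ℓ 1 ω k ∂μ) -
        lam ^ 2 * (run.obsP (Fintype.card V + s) ω k)⁻¹ else 0} with hD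
  set E := (⋃ s ∈ Finset.Ico a (Fintype.card V + n + 1), B s) ∪
    ((O i ∪ O j) ∪ (D (-lam0) i ∪ D lam0 j)) with hE
  have hexp : Real.exp (-(3 * L)) = 1 / ((Fintype.card V + n + 1 : ℕ) : ℝ) ^ 3 := by
    rw [show -(3 * L) = -(((3 : ℕ) : ℝ) * L) by norm_num, Real.exp_neg, Real.exp_nat_mul,
      Real.exp_log hNpos, one_div]
  have hOle : ∀ k, μ.real (O k) ≤ 1 / ((Fintype.card V + n + 1 : ℕ) : ℝ) ^ 3 := fun k => by
    rw [← hexp]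
    exact run.measureReal_seen_ge_le hβ hG (by norm_num) k (Fintype.card V + n) _
      (fun s hs' => ⟨hKa.trans (Finset.mem_Ico.1 hs').1, (Finset.mem_Ico.1 hs').2⟩) _
  have hDle : ∀ lam k, μ.real (D lam k) ≤ 1 / ((Fintype.card V + n + 1 : ℕ) : ℝ) ^ 3 :=
    fun lam k => by
    rw [← hexp]
    exact run.measureReal_est_ge_le hβ hK2 hG hs lam k n _
  -- At most $N$ rounds, each failing with probability at most $2/(dN/4)^3=128/(dN)^3$.
  have hBle : μ.real (⋃ s ∈ Finset.Ico a (Fintype.card V + n + 1), B s) ≤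
      128 / (d ^ 3 * ((Fintype.card V + n + 1 : ℕ) : ℝ) ^ 2) := by
    calc _ ≤ ∑ s ∈ Finset.Ico a (Fintype.card V + n + 1), μ.real (B s) :=
          measureReal_biUnion_finset_le _ _
      _ ≤ ∑ s ∈ Finset.Ico a (Fintype.card V + n + 1),
            2 / (d * (Fintype.card V + n + 1 : ℕ) / 4) ^ 3 := by
          refine Finset.sum_le_sum fun s hs' => ?_
          have has := (Finset.mem_Ico.1 hs').1
          refine (run.measureReal_not_isConfident_le hβ hG hs (hKa.trans has)).trans ?_
          have : (a : ℝ) ≤ s := by exact_mod_cast has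
          have h5 : d * (Fintype.card V + n + 1 : ℕ) / 4 ≤ (s : ℝ) + 1 := by linarith
          gcongr
      _ ≤ ((Fintype.card V + n + 1 : ℕ) : ℝ) *
            (2 / (d * (Fintype.card V + n + 1 : ℕ) / 4) ^ 3) := by
          rw [Finset.sum_const, nsmul_eq_mul, Nat.card_Ico]
          gcongr
          exact Nat.sub_le _ _
      _ = _ := by
          field_simp
          norm_num
  -- The measurable hull has the same probability, so `E` itself need not be shown measurable.
  refine ⟨toMeasurable μ E, measurableSet_toMeasurable _ _, ?_, fun ω hω => ?_⟩
  · have h1 : μ.real (toMeasurable μ E) = μ.real E := by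
      simp only [Measure.real, measure_toMeasurable]
    rw [h1]
    have h2 : 1 / ((Fintype.card V + n + 1 : ℕ) : ℝ) ^ 3 ≤
        1 / (d ^ 3 * ((Fintype.card V + n + 1 : ℕ) : ℝ) ^ 2) := by
      have h3 : d ^ 3 ≤ 1 := pow_le_one₀ hd.le hd1
      have h4 : (1 : ℝ) ≤ (Fintype.card V + n + 1 : ℕ) := by
        exact_mod_cast Nat.succ_le_succ (Nat.zero_le _)
      refine one_div_le_one_div_of_le (by positivity) ?_
      calc d ^ 3 * ((Fintype.card V + n + 1 : ℕ) : ℝ) ^ 2 ≤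
            ((Fintype.card V + n + 1 : ℕ) : ℝ) * ((Fintype.card V + n + 1 : ℕ) : ℝ) ^ 2 := by
            gcongr
            exact h3.trans h4
        _ = _ := by ring
    calc μ.real E ≤ 128 / (d ^ 3 * ((Fintype.card V + n + 1 : ℕ) : ℝ) ^ 2) +
          ((1 / ((Fintype.card V + n + 1 : ℕ) : ℝ) ^ 3 +
            1 / ((Fintype.card V + n + 1 : ℕ) : ℝ) ^ 3) +
          (1 / ((Fintype.card V + n + 1 : ℕ) : ℝ) ^ 3 +
            1 / ((Fintype.card V + n + 1 : ℕ) : ℝ) ^ 3)) := by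
          refine (measureReal_union_le _ _).trans (add_le_add hBle ?_)
          refine (measureReal_union_le _ _).trans (add_le_add ?_ ?_)
          · exact (measureReal_union_le _ _).trans (add_le_add (hOle i) (hOle j))
          · exact (measureReal_union_le _ _).trans (add_le_add (hDle _ i) (hDle _ j))
      _ ≤ 128 / (d ^ 3 * ((Fintype.card V + n + 1 : ℕ) : ℝ) ^ 2) +
          4 * (1 / (d ^ 3 * ((Fintype.card V + n + 1 : ℕ) : ℝ) ^ 2)) := by linarith
      _ = _ := by ring
  · have hωE : ω ∉ E := fun hh => hω (subset_toMeasurable μ E hh)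
    simp only [hE, Set.mem_union, Set.mem_iUnion, not_or, not_exists] at hωE
    obtain ⟨hc, ⟨hOi, hOj⟩, hDi, hDj⟩ := hωE
    have hconf : ∀ s, a ≤ s → s ≤ Fintype.card V + n →
        (run.state s ω).IsConfident (s + 1) (armMean μ ℓ) := fun s h1 h2 => by
      by_contra hcon
      exact hc s (Finset.mem_Ico.2 ⟨h1, by omega⟩) hcon
    have hlate : ∀ k, gap μ ℓ k ≤ d → ∀ s, a ≤ s → s < Fintype.card V + n →
        320 * L / ((Fintype.card V + n + 1 : ℕ) * d ^ 2) ≤ run.obsP s ω k :=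
      fun k hk s h1 h2 => run.le_obsP_of_gapEst_le hG h (hKa.trans h1) (by omega)
        (((hconf s h1 h2.le).gapEst_le (Nat.succ_pos s) hm k).trans hk)
    have hearly : ∀ k, ∀ s, Fintype.card V ≤ s → s < a →
        320 * L / ((Fintype.card V + n + 1 : ℕ) * d) ≤ run.obsP s ω k := fun k s h1 h2 => by
      refine run.le_obsP_of_le hG hs.mem_Icc h h1 (le_trans ?_ ha1) ω k
      exact_mod_cast h2
    have ha4 : (a : ℝ) ≤ (Fintype.card V + n + 1 : ℕ) / 4 := by linarith
    have hwidth : ∀ k, gap μ ℓ k ≤ d → ω ∉ O k →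
        confWidth (Fintype.card V + n + 1) (run.state (Fintype.card V + n) ω) k ≤ d / 8 :=
      fun k hk hOk => by
      refine run.confWidth_le h (run.le_obs_of_lt h ha4 hat (fun s hs' => ?_) (not_le.1 hOk))
      exact hlate k hk s (Finset.mem_Ico.1 hs').1 (Finset.mem_Ico.1 hs').2
    have hwi := hwidth i hi.le hOi
    have hwj := hwidth j (by rw [hj]; exact hd.le) hOj
    have hgap := (hconf _ hat le_rfl).le_gapEst (Nat.succ_pos _) i j
    -- Two widths for each of the two arms: $d-4\cdot\frac d8=\frac d2$.
    refine ⟨by linarith, ?_⟩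
    refine run.weight_le_of_le hG ht h (i := i) (j := j) ?_
    have hLi := run.mul_Ltilde_sub_lt h hKa ha1 (i := i) (m := ∫ ω, ℓ 1 ω i ∂μ) (lam := -lam0)
      (by rw [abs_neg, abs_of_pos hlampos]) (hearly i) (hlate i hi.le) (not_le.1 hDi)
    have hLj := run.mul_Ltilde_sub_lt h hKa ha1 (i := j) (m := ∫ ω, ℓ 1 ω j ∂μ) (lam := lam0)
      (abs_of_pos hlampos) (hearly j) (hlate j (by rw [hj]; exact hd.le)) (not_le.1 hDj)
    -- Dividing by `lam0`, either cumulative estimate is off by less than $Nd/4$ in the harmful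
    -- direction.
    have h4L : 4 * L = lam0 * ((Fintype.card V + n + 1 : ℕ) * d / 4) := by
      rw [hlam0]
      field_simp
      norm_num
    change _ < 4 * L at hLi hLj
    rw [h4L] at hLi hLj
    rw [neg_mul, ← mul_neg] at hLi
    have h1 := lt_of_mul_lt_mul_left hLi hlampos.le
    have h2 := lt_of_mul_lt_mul_left hLj hlampos.le
    change -(_ - n * armMean μ ℓ i) < _ at h1
    change _ - n * armMean μ ℓ j < _ at h2
    have hdiff : armMean μ ℓ i = armMean μ ℓ j + d := by linarith
    rw [hdiff] at h1
    -- The initialization rounds carry no estimates, but $n\ge\frac34N$, so the separation is at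
    -- least $\frac34Nd-2\cdot\frac14Nd$.
    have hn : 3 / 4 * ((Fintype.card V + n + 1 : ℕ) : ℝ) ≤ n := by
      have : (Fintype.card V + n + 1 : ℕ) = (Fintype.card V : ℝ) + n + 1 := by push_cast; ring
      rw [this] at hbig hdN ⊢
      linarith
    have hn' := mul_le_mul_of_nonneg_right hn hd.le
    linarith

/-- The regret of a round in terms of the gaps. -/
lemma integral_playedLoss_sub_eq (run : IsRun 1 4 320 μ ℱ G ℓ S I)
    (hs : IsStochastic μ ℱ ℓ) (t : ℕ) {j : V} (hj : gap μ ℓ j = 0) :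
    ∫ ω, ℓ (t + 1) ω (I (t + 1) ω) ∂μ - ∫ ω, ℓ (t + 1) ω j ∂μ =
      ∫ ω, ∑ i, gap μ ℓ i * run.law t ω i ∂μ := by
  have hβ : (2 : ℝ) ≤ 320 := by norm_num
  have hl := run.bddMeas_loss hs.mem_Icc t
  have hle : run.preInfo t ≤ mΩ := (run.preInfo_le t).trans (ℱ.le _)
  have hprob : ∀ i, BddMeas (ℱ t) (fun ω => run.law t ω i) := run.bddMeas_law hβ t
  have hmean : ∀ i, ∫ ω, ℓ (t + 1) ω i ∂μ = armMean μ ℓ i := fun i =>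
    ((hs.identDistrib t).comp (measurable_pi_apply i)).integral_eq
  have hgap : ∀ i, gap μ ℓ i = armMean μ ℓ i - armMean μ ℓ j := fun i => by
    have h1 : armMean μ ℓ j - ⨅ k, armMean μ ℓ k = 0 := hj
    change armMean μ ℓ i - ⨅ k, armMean μ ℓ k = _
    linarith
  have hone : ∑ i, ∫ ω, run.law t ω i ∂μ = 1 := by
    rw [← integral_finsetSum _ fun i _ => (hprob i).integrable (ℱ.le _)]
    simp [run.sum_law]
  rw [run.integral_arm hβ t (F := fun a ω => ℓ (t + 1) ω a) hl, hmean]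
  rw [integral_finsetSum _ fun i _ =>
      (((hprob i).mono (run.le_preInfo t)).mul (hl i)).integrable hle,
    integral_finsetSum _ fun i _ => ((hprob i).const_mul _).integrable (ℱ.le _)]
  have h1 : ∀ i, ∫ ω, run.law t ω i * ℓ (t + 1) ω i ∂μ =
      (∫ ω, run.law t ω i ∂μ) * armMean μ ℓ i := fun i =>
    hs.integral_mul_comp run.losses_adapted t (hprob i) (g := fun l => l i)
      (measurable_pi_apply i)
  simp only [h1, hgap, integral_const_mul]
  simp only [sub_mul, Finset.sum_sub_distrib]
  rw [← Finset.mul_sum, hone, mul_one]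
  simp only [mul_comm]

open scoped Classical in
/-- The regret of a round after the burn-in phase. -/
lemma integral_playedLoss_sub_le (run : IsRun 1 4 320 μ ℱ G ℓ S I) (hG : ∀ t i, (G t).Adj i i)
    (hs : IsStochastic μ ℱ ℓ) {t : ℕ} (ht : Fintype.card V ≤ t) {j : V} (hj : gap μ ℓ j = 0)
    {δ : ℝ} (hδ : ∀ i, 0 < gap μ ℓ i → δ ≤ gap μ ℓ i) (h : IsPastBurnIn V (t + 1) δ) {b : ℝ}
    (hb : ∀ ω, ∑ i ∈ S (t + 1) ω with 0 < gap μ ℓ i,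
      1280 * Real.log (t + 1 : ℕ) / ((t + 1 : ℕ) * gap μ ℓ i) ≤ b) :
    ∫ ω, ℓ (t + 1) ω (I (t + 1) ω) ∂μ - ∫ ω, ℓ (t + 1) ω j ∂μ ≤
      b + 137 * Fintype.card V / δ ^ 3 * (1 / ((t + 1 : ℕ) : ℝ) ^ 2) := by
  have hβ : (2 : ℝ) ≤ 320 := by norm_num
  rw [run.integral_playedLoss_sub_eq hs t hj]
  simp only [law, if_pos ht]
  have hδ0 := h.pos
  have hprob : ∀ i, BddMeas mΩ (fun ω => run.prob t ω i) := fun i =>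
    (run.bddMeas_prob hβ ht i).mono (ℱ.le _)
  set N : ℝ := ((t + 1 : ℕ) : ℝ) with hN
  have hNpos : 0 < N := by positivity
  have hL : 0 ≤ Real.log N := Real.log_natCast_nonneg _
  -- Here 5 is 1 for the exponential weight plus 4 for exploration outside `S`; 1280 is $4\beta$, as
  -- the estimated gap may be half the true one. Arms of gap 0 need no rare event.
  have hex : ∀ i, ∃ E : Set Ω, MeasurableSet E ∧ μ.real E ≤ 132 / (δ ^ 3 * N ^ 2) ∧
      ∀ ω, gap μ ℓ i * run.prob t ω i ≤ (if ω ∈ E then 1 else 0) + (5 / N ^ 2 +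
        if i ∈ S (t + 1) ω ∧ 0 < gap μ ℓ i then
          1280 * Real.log N / (N * gap μ ℓ i) else 0) := by
    intro i
    rcases (gap_nonneg (μ := μ) ℓ i).eq_or_lt with h0 | hpos
    · refine ⟨∅, MeasurableSet.empty, ?_, fun ω => ?_⟩
      · simp only [measureReal_empty]
        positivity
      · rw [← h0]
        simp only [zero_mul, Set.mem_empty_iff_false, if_false, lt_irrefl, and_false]
        positivity
    have hd1 := run.gap_le_one hs i
    have h' := h.mono_gap (hδ i hpos) hd1
    obtain ⟨E, hEm, hEle, hE⟩ := run.exists_rare_event hG hs ht rfl hj h'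
    refine ⟨E, hEm, hEle.trans ?_, fun ω => ?_⟩
    · have := hδ i hpos
      gcongr
    · set d := gap μ ℓ i with hd
      have hp0 := run.prob_pos hβ t ω i
      have hp1 : run.prob t ω i ≤ 1 := playProb_le_one (by norm_num) _ _ _ _ _
      have hterm : (0 : ℝ) ≤ if i ∈ S (t + 1) ω ∧ 0 < d then
          1280 * Real.log N / (N * d) else 0 := by
        split_ifs <;> positivity
      have h5 : 0 ≤ 5 / N ^ 2 := by positivity
      by_cases hω : ω ∈ E
      · rw [if_pos hω]
        have := mul_le_one₀ hd1 hp0.le hp1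
        linarith
      · rw [if_neg hω, zero_add]
        obtain ⟨hg, hw⟩ := hE ω hω
        have hle : run.prob t ω i ≤ run.weight t ω i + run.expl t ω i :=
          playProb_le_add (by norm_num) _ _ _ _ _
        by_cases hiS : i ∈ S (t + 1) ω
        · rw [if_pos ⟨hiS, hpos⟩]
          have he : run.expl t ω i ≤ 320 * Real.log N / (N * (d / 2) ^ 2) :=
            explRate_le_of_mem (by norm_num) _ _ _ hiS (half_pos hpos) hg
          have h6 : d * (320 * Real.log N / (N * (d / 2) ^ 2)) =
              1280 * Real.log N / (N * d) := by
            field_simp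
            ring
          have h7 : d * run.weight t ω i ≤ 5 / N ^ 2 :=
            (mul_le_of_le_one_left (run.weight_pos t ω i).le hd1).trans
              (hw.trans (by gcongr; norm_num))
          have h8 := mul_le_mul_of_nonneg_left hle hpos.le
          have h9 := mul_le_mul_of_nonneg_left he hpos.le
          rw [h6] at h9
          rw [mul_add] at h8
          linarith
        · rw [if_neg (fun hh => hiS hh.1), add_zero]
          have he : run.expl t ω i ≤ 4 / N ^ 2 := explRate_le_of_notMem _ _ _ _ hiS
          have h7 : d * run.prob t ω i ≤ run.prob t ω i := mul_le_of_le_one_left hp0.le hd1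
          have h8 : 5 / N ^ 2 = 1 / N ^ 2 + 4 / N ^ 2 := by ring
          change run.weight t ω i ≤ 1 / N ^ 2 at hw
          linarith
  choose E hEm hEle hE using hex
  have hind : ∀ i, BddMeas mΩ (fun ω => if ω ∈ E i then (1 : ℝ) else 0) := fun i =>
    .ite (hEm i) (.const 1) (.const 0)
  have hindint : ∀ i, ∫ ω, (if ω ∈ E i then (1 : ℝ) else 0) ∂μ = μ.real (E i) := fun i => by
    have : (fun ω => if ω ∈ E i then (1 : ℝ) else 0) = (E i).indicator 1 := by
      ext ω; simp [Set.indicator]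
    rw [this, integral_indicator_one (hEm i)]
  calc ∫ ω, ∑ i, gap μ ℓ i * run.prob t ω i ∂μ
      ≤ ∫ ω, ∑ i, (if ω ∈ E i then (1 : ℝ) else 0) + (Fintype.card V * (5 / N ^ 2) + b) ∂μ := by
        refine integral_mono ((BddMeas.sum _ fun i _ => (hprob i).const_mul _).integrable le_rfl)
          (((BddMeas.sum _ fun i _ => hind i).add (.const _)).integrable le_rfl) fun ω => ?_
        calc ∑ i, gap μ ℓ i * run.prob t ω i ≤ ∑ i, ((if ω ∈ E i then 1 else 0) + (5 / N ^ 2 +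
              if i ∈ S (t + 1) ω ∧ 0 < gap μ ℓ i then
                1280 * Real.log N / (N * gap μ ℓ i) else 0)) :=
              Finset.sum_le_sum fun i _ => hE i ω
          _ = ∑ i, (if ω ∈ E i then (1 : ℝ) else 0) + (Fintype.card V * (5 / N ^ 2) +
                ∑ i ∈ S (t + 1) ω with 0 < gap μ ℓ i,
                  1280 * Real.log N / (N * gap μ ℓ i)) := by
              rw [Finset.sum_add_distrib, Finset.sum_add_distrib, Finset.sum_const,
                Finset.card_univ, nsmul_eq_mul]
              congr 2
              rw [← Finset.sum_filter]
              exact Finset.sum_congr (by ext i; simp) fun _ _ => rfl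
          _ ≤ _ := by
              have := hb ω
              gcongr
    _ = ∑ i, μ.real (E i) + (Fintype.card V * (5 / N ^ 2) + b) := by
        rw [integral_add ((BddMeas.sum _ fun i _ => hind i).integrable le_rfl)
          (integrable_const _), integral_finsetSum _ fun i _ => (hind i).integrable le_rfl]
        simp only [hindint, integral_const, probReal_univ, one_smul]
    _ ≤ ∑ _i : V, 132 / (δ ^ 3 * N ^ 2) + (Fintype.card V * (5 / N ^ 2) + b) := by
        gcongr with i
        exact hEle i
    _ ≤ _ := by
        rw [Finset.sum_const, Finset.card_univ, nsmul_eq_mul]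
        have h1 : 5 / N ^ 2 ≤ 5 / (δ ^ 3 * N ^ 2) := by
          have h3 : δ ^ 3 ≤ 1 := pow_le_one₀ hδ0.le h.le_one
          have h4 : δ ^ 3 * N ^ 2 ≤ N ^ 2 := mul_le_of_le_one_left (by positivity) h3
          gcongr
        have h2 : (Fintype.card V : ℝ) * (5 / N ^ 2) ≤
            Fintype.card V * (5 / (δ ^ 3 * N ^ 2)) := by gcongr
        have h3 : 137 * (Fintype.card V : ℝ) / δ ^ 3 * (1 / N ^ 2) =
            Fintype.card V * (132 / (δ ^ 3 * N ^ 2)) + Fintype.card V * (5 / (δ ^ 3 * N ^ 2)) := by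
          field_simp
          norm_num
        linarith

end IsRun

end RoundRegret


/-! ### Harmonic sums and descending order statistics -/

section Sums

lemma sum_Icc_one_eq {M : Type*} [AddCommMonoid M] (f : ℕ → M) (T : ℕ) :
    ∑ t ∈ Finset.Icc 1 T, f t = ∑ t ∈ Finset.range T, f (t + 1) := by
  induction T with
  | zero => simp
  | succ T ih => rw [Finset.sum_Icc_succ_top (by omega), Finset.sum_range_succ, ih]

lemma sum_Ico_one_div_le_log {a : ℕ} (ha : 1 ≤ a) (T : ℕ) :
    ∑ t ∈ Finset.Ico a T, 1 / ((t + 1 : ℕ) : ℝ) ≤ Real.log T := by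
  induction T with
  | zero => simp
  | succ T ih =>
    rcases lt_or_ge T a with h | h
    · rw [Finset.Ico_eq_empty (by omega), Finset.sum_empty]
      exact Real.log_natCast_nonneg _
    · rw [Finset.sum_Ico_succ_top h]
      have hT : (0 : ℝ) < T := by exact_mod_cast (by omega : 0 < T)
      have h1 := Real.one_sub_inv_le_log_of_pos
        (show (0 : ℝ) < ((T + 1 : ℕ) : ℝ) / T by positivity)
      rw [Real.log_div (by positivity) hT.ne', inv_div] at h1
      have h2 : 1 - (T : ℝ) / (T + 1 : ℕ) = 1 / ((T + 1 : ℕ) : ℝ) := by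
        push_cast
        field_simp
        ring
      linarith

lemma sum_Ico_one_div_sq_le {a : ℕ} (ha : 1 ≤ a) (T : ℕ) :
    ∑ t ∈ Finset.Ico a T, 1 / ((t + 1 : ℕ) : ℝ) ^ 2 ≤ 1 / (a : ℝ) := by
  have ha' : (0 : ℝ) < a := by exact_mod_cast ha
  rcases lt_or_ge T a with h | h
  · rw [Finset.Ico_eq_empty (by omega), Finset.sum_empty]
    positivity
  suffices ∑ t ∈ Finset.Ico a T, 1 / ((t + 1 : ℕ) : ℝ) ^ 2 ≤ 1 / (a : ℝ) - 1 / T from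
    this.trans (sub_le_self _ (by positivity))
  induction T, h using Nat.le_induction with
  | base => simp
  | succ T hT ih =>
    rw [Finset.sum_Ico_succ_top hT]
    have hT' : (0 : ℝ) < T := by exact_mod_cast (by omega : 0 < T)
    have h2 : 1 / ((T + 1 : ℕ) : ℝ) ^ 2 ≤ 1 / (T : ℝ) - 1 / ((T + 1 : ℕ) : ℝ) := by
      have : 1 / (T : ℝ) - 1 / ((T + 1 : ℕ) : ℝ) = 1 / (T * ((T + 1 : ℕ) : ℝ)) := by
        push_cast
        field_simp
        ring
      rw [this]
      refine one_div_le_one_div_of_le (by positivity) ?_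
      rw [sq]
      gcongr
      exact Nat.le_succ T
    linarith

/-- At most `n` entries exceed the entry number `n` in descending order. -/
lemma card_nthLargest_lt_le (a : ℕ → ℕ) (T n : ℕ) :
    (Finset.range T).sum (fun t => if nthLargest a T n < a (t + 1) then 1 else 0) ≤ n := by
  rw [← sum_Icc_one_eq (fun t => if nthLargest a T n < a t then 1 else 0)]
  set l := ((Finset.Icc 1 T).val.map a).sort (fun x y => y ≤ x) with hl
  have hv : nthLargest a T n = l.getD n 0 := rfl
  have hsum : ∑ t ∈ Finset.Icc 1 T, (if nthLargest a T n < a t then 1 else 0) =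
      l.countP (fun x => decide (nthLargest a T n < x)) := by
    have h1 : (l : Multiset ℕ) = (Finset.Icc 1 T).val.map a := Multiset.sort_eq _ _
    rw [← Multiset.coe_countP, h1, Multiset.countP_map, Finset.sum_boole]
    rfl
  have hsorted : l.Pairwise (fun x y => y ≤ x) := Multiset.pairwise_sort _ _
  rw [hsum, ← List.take_append_drop n l, List.countP_append]
  -- In a descending list nothing from position `n` on exceeds entry `n`; if the list is shorter,
  -- nothing is left after the drop.
  have h2 : (l.drop n).countP (fun x => decide (nthLargest a T n < x)) = 0 := by
    rw [List.countP_eq_zero]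
    intro x hx
    rw [List.mem_drop_iff_getElem] at hx
    obtain ⟨k, hk, rfl⟩ := hx
    have hn : n < l.length := by omega
    rw [hv, List.getD_eq_getElem _ _ hn]
    simp only [decide_eq_true_eq, not_lt]
    rcases Nat.eq_zero_or_pos k with rfl | hk0
    · simp
    · exact List.pairwise_iff_getElem.1 hsorted n (n + k) hn (by omega) (by omega)
  have h3 := List.countP_le_length (p := fun x => decide (nthLargest a T n < x)) (l := l.take n)
  have h4 := List.length_take_le n l
  rw [h2]
  omega

lemma nthLargest_le {a : ℕ → ℕ} {c : ℕ} (h : ∀ t, a t ≤ c) (T n : ℕ) :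
    nthLargest a T n ≤ c := by
  rw [nthLargest]
  rcases Nat.lt_or_ge n (((Finset.Icc 1 T).val.map a).sort (fun x y => y ≤ x)).length with hn | hn
  · rw [List.getD_eq_getElem _ _ hn]
    have h1 := List.getElem_mem hn
    rw [Multiset.mem_sort, Multiset.mem_map] at h1
    obtain ⟨t, -, ht⟩ := h1
    exact ht ▸ h t
  · rw [List.getD_eq_default _ _ hn]
    exact Nat.zero_le _

end Sums

/-! ### The length of the burn-in phase -/

section Numerics

/-- Bounds on the square root `R` of the length of the burn-in phase. -/
lemma burnIn_bounds {K δ X R : ℝ} (hK : 2 ≤ K) (hδ : 0 < δ) (hδ1 : δ ≤ 1)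
    (hX : X = Real.log (20 * 320 ^ 2 * K ^ (5 / 2 : ℝ) / δ ^ 4))
    (hR : R = 3840 * K * X / (δ ^ 2 * √(Real.log K))) :
    1 ≤ X ∧ Real.log R ≤ 3 * X ∧ 3840 * (K / δ ^ 2) ≤ R := by
  set Y := 20 * 320 ^ 2 * K ^ (5 / 2 : ℝ) / δ ^ 4 with hY
  have hu : 2 ≤ K / δ ^ 2 := hK.trans
    (le_div_self (by linarith) (by positivity) (pow_le_one₀ hδ.le hδ1))
  have hYu : 2048000 * (K / δ ^ 2) ≤ Y := by
    have h1 : K ≤ K ^ (5 / 2 : ℝ) := by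
      nth_rewrite 1 [← Real.rpow_one K]
      exact Real.rpow_le_rpow_of_exponent_le (by linarith) (by norm_num)
    have h2 : δ ^ 4 ≤ δ ^ 2 := pow_le_pow_of_le_one hδ.le hδ1 (by norm_num)
    calc 2048000 * (K / δ ^ 2) = 20 * 320 ^ 2 * K / δ ^ 2 := by ring
      _ ≤ Y := by rw [hY]; gcongr
  have hY1 : 4096000 ≤ Y := by linarith
  have hKY : K ≤ Y := by
    have := le_div_self (by linarith) (by positivity) (pow_le_one₀ hδ.le hδ1 (n := 2)) (a := K)
    linarith
  have hX1 : 1 ≤ X := by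
    rw [hX, Real.le_log_iff_exp_le (by linarith)]
    have := Real.exp_one_lt_d9
    linarith
  have hXY : X ≤ Y := hX ▸ Real.log_le_self (by linarith)
  have hKX : Real.log K ≤ X := hX ▸ Real.log_le_log (by linarith) hKY
  have hK2 : (4 / 5) ^ 2 ≤ Real.log K := by
    have := Real.log_two_gt_d9
    have := Real.log_le_log (by norm_num) hK
    norm_num
    linarith
  have hs1 : 4 / 5 ≤ √(Real.log K) := Real.le_sqrt_of_sq_le hK2
  have hs2 : √(Real.log K) ≤ X := by
    rw [Real.sqrt_le_left (by linarith)]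
    nlinarith
  have hR' : R = 3840 * (K / δ ^ 2) * (X / √(Real.log K)) := by
    rw [hR]
    field_simp
  have hs0 : 0 < √(Real.log K) := by linarith
  have hlow : 3840 * (K / δ ^ 2) ≤ R := by
    rw [hR']
    exact le_mul_of_one_le_right (by positivity) ((one_le_div hs0).2 hs2)
  refine ⟨hX1, ?_, hlow⟩
  have hup : R ≤ Y ^ 2 := by
    have h1 : X / √(Real.log K) ≤ 5 / 4 * Y := by
      rw [div_le_iff₀ hs0]
      nlinarith
    rw [hR']
    calc 3840 * (K / δ ^ 2) * (X / √(Real.log K)) ≤ 3840 * (K / δ ^ 2) * (5 / 4 * Y) := by gcongr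
      _ = 4800 * (K / δ ^ 2) * Y := by ring
      _ ≤ Y * Y := by
        gcongr
        linarith
      _ = Y ^ 2 := by ring
  have h2 := Real.log_le_log (by linarith) hup
  rw [Real.log_pow, ← hX] at h2
  push_cast at h2
  linarith

/-- $\ln x/x$ decreases from $R$ to $\sqrt N$, and `R` is chosen so that $3X/R=\delta^2\sqrt{\ln
K}/(1280K)$. As $\ln\sqrt N=\frac12\ln N$, this is the burn-in inequality. -/
lemma isPastBurnIn_of_le {V : Type*} [Fintype V] (hK : 2 ≤ Fintype.card V) {δ X R : ℝ}
    (hδ : 0 < δ) (hδ1 : δ ≤ 1)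
    (hX : X = Real.log (20 * 320 ^ 2 * (Fintype.card V : ℝ) ^ (5 / 2 : ℝ) / δ ^ 4))
    (hR : R = 3840 * Fintype.card V * X / (δ ^ 2 * √(Real.log (Fintype.card V)))) {N : ℕ}
    (hN : R ^ 2 ≤ N) :
    IsPastBurnIn V N δ := by
  have hK' : (2 : ℝ) ≤ Fintype.card V := by exact_mod_cast hK
  obtain ⟨hX1, hlog, hlow⟩ := burnIn_bounds hK' hδ hδ1 hX hR
  have hu : (Fintype.card V : ℝ) ≤ Fintype.card V / δ ^ 2 :=
    le_div_self (by linarith) (by positivity) (pow_le_one₀ hδ.le hδ1)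
  have hR3 : 3 ≤ R := by linarith
  have hRN : R ≤ √(N : ℝ) := Real.le_sqrt_of_sq_le hN
  have hN0 : 0 < √(N : ℝ) := by linarith
  have hs : 0 < √(Real.log (Fintype.card V)) := Real.sqrt_pos.2 (Real.log_pos (by linarith))
  refine ⟨hK, ?_, hδ, hδ1, ?_⟩
  · have h1 : (Fintype.card V : ℝ) < N := by nlinarith
    exact_mod_cast h1
  · have h1 := log_div_le_log_div hR3 hRN
    rw [Real.log_sqrt (Nat.cast_nonneg _)] at h1
    have h2 : Real.log R / R ≤
        δ ^ 2 * √(Real.log (Fintype.card V)) / (1280 * Fintype.card V) := by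
      calc Real.log R / R ≤ 3 * X / R := by gcongr
        _ = _ := by
          rw [hR]
          field_simp
          norm_num
    have h3 := h1.trans h2
    rw [div_le_div_iff₀ hN0 (by positivity)] at h3
    linarith

end Numerics

/-! ### Regret over all rounds -/

section Regret

lemma sum_regret_of_subsingleton {V Ω : Type*} {mΩ : MeasurableSpace Ω} [Subsingleton V]
    (μ : Measure Ω) (ℓ : ℕ → Ω → V → ℝ) (I : ℕ → Ω → V) (i : V) (T : ℕ) :
    ∑ t ∈ Finset.range T, (∫ ω, ℓ (t + 1) ω (I (t + 1) ω) ∂μ - ∫ ω, ℓ (t + 1) ω i ∂μ) = 0 :=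
  Finset.sum_eq_zero fun t _ => by
    rw [sub_eq_zero]
    congr 1
    ext ω
    rw [Subsingleton.elim (I (t + 1) ω) i]

variable {V Ω : Type*} [Fintype V] {mΩ : MeasurableSpace Ω} {μ : Measure Ω}
  [IsProbabilityMeasure μ]
  {ℱ : Filtration ℕ mΩ} {G : ℕ → Digraph V} {ℓ : ℕ → Ω → V → ℝ} {S : ℕ → Ω → Finset V}
  {I : ℕ → Ω → V} {β : ℝ}

namespace IsRun

lemma integral_playedLoss_sub_le_one (run : IsRun 1 4 β μ ℱ G ℓ S I)
    (hℓ : ∀ t ω i, ℓ (t + 1) ω i ∈ Set.Icc (0 : ℝ) 1) (t : ℕ) (i : V) :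
    ∫ ω, ℓ (t + 1) ω (I (t + 1) ω) ∂μ - ∫ ω, ℓ (t + 1) ω i ∂μ ≤ 1 := by
  have h1 : ∫ ω, ℓ (t + 1) ω (I (t + 1) ω) ∂μ ≤ ∫ _ω, (1 : ℝ) ∂μ :=
    integral_mono ((run.bddMeas_playedLoss hℓ t).integrable (ℱ.le _))
      (integrable_const _) fun ω => (hℓ t ω _).2
  have h2 : 0 ≤ ∫ ω, ℓ (t + 1) ω i ∂μ := integral_nonneg fun ω => (hℓ t ω i).1
  simp only [integral_const, probReal_univ, one_smul] at h1
  linarith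

lemma sum_regret_le_of_le (run : IsRun 1 4 β μ ℱ G ℓ S I)
    (hℓ : ∀ t ω i, ℓ (t + 1) ω i ∈ Set.Icc (0 : ℝ) 1) {T : ℕ} (hT : T ≤ Fintype.card V) (i : V) :
    ∑ t ∈ Finset.range T, (∫ ω, ℓ (t + 1) ω (I (t + 1) ω) ∂μ - ∫ ω, ℓ (t + 1) ω i ∂μ) ≤
      Fintype.card V := by
  refine (Finset.sum_le_sum fun t _ => run.integral_playedLoss_sub_le_one hℓ t i).trans ?_
  simpa using hT

variable [Nonempty V]

lemma pseudoRegret_le (run : IsRun 1 4 β μ ℱ G ℓ S I)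
    (hℓ : ∀ t ω i, ℓ (t + 1) ω i ∈ Set.Icc (0 : ℝ) 1) {T : ℕ} {B : ℝ}
    (h : ∀ i, ∑ t ∈ Finset.range T,
      (∫ ω, ℓ (t + 1) ω (I (t + 1) ω) ∂μ - ∫ ω, ℓ (t + 1) ω i ∂μ) ≤ B) :
    pseudoRegret μ ℓ I T ≤ B := by
  obtain ⟨i, hi⟩ := exists_eq_ciInf_of_finite
    (f := fun i => ∫ ω, ∑ t ∈ Finset.Icc 1 T, ℓ t ω i ∂μ)
  rw [pseudoRegret, ← hi]
  simp only [sum_Icc_one_eq]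
  rw [integral_finsetSum _ fun t _ => (run.bddMeas_playedLoss hℓ t).integrable (ℱ.le _),
    integral_finsetSum _ fun t _ => (run.bddMeas_loss hℓ t i).integrable
      ((run.preInfo_le t).trans (ℱ.le _)), ← Finset.sum_sub_distrib]
  exact h i

/-- The regret bound for arbitrary losses. -/
theorem pseudoRegret_le_sum_indepNumber (run : IsRun 1 4 β μ ℱ G ℓ S I) (hβ : 2 ≤ β)
    (hG : ∀ t i, (G t).Adj i i) (hℓ : ∀ t ω i, ℓ (t + 1) ω i ∈ Set.Icc (0 : ℝ) 1) (T : ℕ) :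
    pseudoRegret μ ℓ I T ≤ 9 * √(Real.log (Fintype.card V)) *
      √(Real.log (Fintype.card V * T)) *
        √(∑ t ∈ Finset.Icc 1 T, (indepNumber (G t) : ℝ)) + 2 * Fintype.card V := by
  refine run.pseudoRegret_le hℓ fun i => ?_
  rw [sum_Icc_one_eq]
  rcases Nat.lt_or_ge (Fintype.card V) 2 with h1 | hK
  · have : Subsingleton V := Fintype.card_le_one_iff_subsingleton.1 (by omega)
    rw [sum_regret_of_subsingleton]
    positivity
  rcases Nat.lt_or_ge T (Fintype.card V) with hT | hT
  · refine (run.sum_regret_le_of_le hℓ hT.le i).trans ?_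
    have : 0 ≤ 9 * √(Real.log (Fintype.card V)) * √(Real.log (Fintype.card V * T)) *
      √(∑ t ∈ Finset.range T, (indepNumber (G (t + 1)) : ℝ)) := by positivity
    have h2 : (0 : ℝ) ≤ Fintype.card V := by positivity
    linarith
  have hK' : (2 : ℝ) ≤ Fintype.card V := by exact_mod_cast hK
  have hT' : (2 : ℝ) ≤ T := by exact_mod_cast hK.trans hT
  set A := ∑ t ∈ Finset.range T, (indepNumber (G (t + 1)) : ℝ) with hA
  set L := Real.log (Fintype.card V * T) with hL
  have hTA : (T : ℝ) ≤ A := by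
    calc (T : ℝ) = ∑ t ∈ Finset.range T, (1 : ℝ) := by simp
      _ ≤ A := Finset.sum_le_sum fun t _ => by exact_mod_cast one_le_indepNumber (G (t + 1))
  have hL1 : 1 ≤ L := by
    rw [hL, Real.le_log_iff_exp_le (by positivity)]
    have := Real.exp_one_lt_d9
    nlinarith
  have hB : ∀ ω, (run.state T ω).Theta ≤ 5 * L * A := fun ω => by
    refine (run.Theta_le_sum_indepNumber hβ hK hG hℓ hT le_rfl ω).trans ?_
    gcongr
    linarith
  refine (run.sum_regret_le hβ hK hG hℓ hT hB i).trans ?_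
  -- $\sqrt5\le\frac94$; together with the exploration term this gives
  -- $\frac{16}5\cdot\frac94+1\le9$.
  have h5 : √(5 * L * A) ≤ 9 / 4 * (√L * √A) := by
    rw [mul_assoc, Real.sqrt_mul (by norm_num), Real.sqrt_mul (by linarith)]
    gcongr
    rw [Real.sqrt_le_left (by norm_num)]
    norm_num
  have h6 : √(T : ℝ) ≤ √L * √A := by
    rw [← Real.sqrt_mul (by linarith)]
    refine Real.sqrt_le_sqrt ?_
    nlinarith
  have h7 : 0 ≤ √L * √A := by positivity
  calc _ ≤ Fintype.card V + 16 / 5 * (√(Real.log (Fintype.card V)) * (9 / 4 * (√L * √A))) +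
        √(Real.log (Fintype.card V)) * (√L * √A) := by gcongr
    _ ≤ Fintype.card V + 9 * √(Real.log (Fintype.card V)) * (√L * √A) := by
      have : 0 ≤ √(Real.log (Fintype.card V)) * (√L * √A) := by positivity
      nlinarith
    _ ≤ _ := by linarith

/-- A regret bound that ignores the graphs. -/
lemma sum_regret_le_sqrt (run : IsRun 1 4 β μ ℱ G ℓ S I) (hβ : 2 ≤ β)
    (hK : 2 ≤ Fintype.card V) (hG : ∀ t i, (G t).Adj i i)
    (hℓ : ∀ t ω i, ℓ (t + 1) ω i ∈ Set.Icc (0 : ℝ) 1) (T : ℕ) (i : V) :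
    ∑ t ∈ Finset.range T, (∫ ω, ℓ (t + 1) ω (I (t + 1) ω) ∂μ - ∫ ω, ℓ (t + 1) ω i ∂μ) ≤
      Fintype.card V + 21 / 5 * (√(Real.log (Fintype.card V)) * √(Fintype.card V) * √T) := by
  rcases Nat.lt_or_ge T (Fintype.card V) with hT | hT
  · refine (run.sum_regret_le_of_le hℓ hT.le i).trans ?_
    have : 0 ≤ 21 / 5 * (√(Real.log (Fintype.card V)) * √(Fintype.card V : ℝ) * √(T : ℝ)) := by
      positivity
    linarith
  refine (run.sum_regret_le hβ hK hG hℓ hT (run.Theta_le_card_mul hβ hG hT) i).trans ?_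
  have hK' : (1 : ℝ) ≤ √(Fintype.card V : ℝ) := by
    rw [Real.one_le_sqrt]
    exact_mod_cast (by omega : 1 ≤ Fintype.card V)
  rw [Real.sqrt_mul (by positivity)]
  have h1 : √(Real.log (Fintype.card V)) * √(T : ℝ) ≤
      √(Real.log (Fintype.card V)) * √(Fintype.card V : ℝ) * √T := by
    gcongr
    exact le_mul_of_one_le_right (by positivity) hK'
  nlinarith

open scoped Classical in
-- Apart from a summable remainder, a round whose strong independence number exceeds entry `n` costs
-- 1, and there are at most `n` of them. In any other round the exploration set fits into a
-- competitor of the supremum, at cost $M/(N\ln T)$ in round $N$, and $\sum1/N\le\ln T$.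
lemma sum_regret_late_le (run : IsRun 1 4 320 μ ℱ G ℓ S I) (hG : ∀ t i, (G t).Adj i i)
    (hs : IsStochastic μ ℱ ℓ) {j : V} (hj : gap μ ℓ j = 0) {δ : ℝ}
    (hδ : ∀ i, 0 < gap μ ℓ i → δ ≤ gap μ ℓ i) {a : ℕ} (ha : Fintype.card V ≤ a)
    (hburn : ∀ N, a < N → IsPastBurnIn V N δ) (T n : ℕ) :
    ∑ t ∈ Finset.Ico a T, (∫ ω, ℓ (t + 1) ω (I (t + 1) ω) ∂μ - ∫ ω, ℓ (t + 1) ω j ∂μ) ≤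
      (⨆ A : {A : Finset V // A.card = nthLargest (fun t => strongIndepNumber (G t)) T n},
        ∑ i ∈ A.1 with 0 < gap μ ℓ i, 4 * 320 * Real.log T ^ 2 / gap μ ℓ i) + n +
      137 * Fintype.card V / δ ^ 3 * (1 / a) := by
  set α := nthLargest (fun t => strongIndepNumber (G t)) T n with hα
  set F : {A : Finset V // A.card = α} → ℝ := fun A =>
    ∑ i ∈ A.1 with 0 < gap μ ℓ i, 4 * 320 * Real.log T ^ 2 / gap μ ℓ i with hF
  set M := ⨆ A, F A with hM
  have hFnonneg : ∀ A, 0 ≤ F A := fun A => Finset.sum_nonneg fun i hi => by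
    have := (Finset.mem_filter.1 hi).2
    positivity
  have hM0 : 0 ≤ M := Real.iSup_nonneg hFnonneg
  have hδ0 : 0 < δ := (hburn (a + 1) (Nat.lt_succ_self a)).pos
  have ha1 : 1 ≤ a := Fintype.card_pos.trans_le ha
  have hαK : α ≤ Fintype.card V := nthLargest_le (fun t => strongIndepNumber_le_card _) T n
  have hround : ∀ t ∈ Finset.Ico a T,
      ∫ ω, ℓ (t + 1) ω (I (t + 1) ω) ∂μ - ∫ ω, ℓ (t + 1) ω j ∂μ ≤
        ((if α < strongIndepNumber (G (t + 1)) then (1 : ℝ) else 0) +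
          M / Real.log T * (1 / ((t + 1 : ℕ) : ℝ))) +
        137 * Fintype.card V / δ ^ 3 * (1 / ((t + 1 : ℕ) : ℝ) ^ 2) := by
    intro t ht
    obtain ⟨hat, htT⟩ := Finset.mem_Ico.1 ht
    have h := hburn (t + 1) (by omega)
    refine run.integral_playedLoss_sub_le hG hs (ha.trans hat) hj hδ h fun ω => ?_
    have hL1 := h.one_le_log
    have hNpos : (0 : ℝ) < (t + 1 : ℕ) := by positivity
    have hNT : Real.log (t + 1 : ℕ) ≤ Real.log T :=
      Real.log_le_log hNpos (by exact_mod_cast htT)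
    set N : ℝ := ((t + 1 : ℕ) : ℝ) with hN
    have hlogT : 0 < Real.log T := by linarith
    split_ifs with hbad
    · have h1 : ∑ i ∈ S (t + 1) ω with 0 < gap μ ℓ i, 1280 * Real.log N / (N * gap μ ℓ i) ≤
          Fintype.card V * (1280 * Real.log N / (N * δ)) := by
        calc _ ≤ ∑ _i ∈ (S (t + 1) ω).filter (fun i => 0 < gap μ ℓ i),
              1280 * Real.log N / (N * δ) := Finset.sum_le_sum fun i hi => by
              have := hδ i (Finset.mem_filter.1 hi).2
              gcongr
          _ ≤ _ := by
            rw [Finset.sum_const, nsmul_eq_mul]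
            gcongr
            exact Finset.card_le_univ _
      -- Twice the burn-in inequality, with $2\sqrt{\ln K}\le\sqrt N$ and $\delta^2\le\delta$.
      have h2 : (Fintype.card V : ℝ) * (1280 * Real.log N / (N * δ)) ≤ 1 := by
        have hle := h.le_sqrt
        have hbig := h.mul_card_le
        have hKpos : (2 : ℝ) ≤ Fintype.card V := by exact_mod_cast h.two_le_card
        have h3 : 2 * √(Real.log (Fintype.card V)) ≤ √N := by
          refine Real.le_sqrt_of_sq_le ?_
          rw [mul_pow, Real.sq_sqrt (Real.log_nonneg (by linarith))]
          have h4 := Real.log_le_self (x := (Fintype.card V : ℝ)) (by linarith)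
          have h5 : δ * N ≤ N := mul_le_of_le_one_left hNpos.le h.le_one
          change _ ≤ δ * N at hbig
          linarith
        have h6 : 2 * (√N * √(Real.log (Fintype.card V)) * δ ^ 2) ≤ N * δ := by
          have h7 : δ ^ 2 ≤ δ := by nlinarith [h.le_one]
          calc 2 * (√N * √(Real.log (Fintype.card V)) * δ ^ 2)
              = √N * (2 * √(Real.log (Fintype.card V))) * δ ^ 2 := by ring
            _ ≤ √N * √N * δ := by gcongr
            _ = N * δ := by rw [Real.mul_self_sqrt hNpos.le]
        rw [mul_div_assoc', div_le_one (by positivity)]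
        change _ ≤ √N * _ * _ at hle
        linarith
      have h3 : 0 ≤ M / Real.log T * (1 / N) := by positivity
      linarith
    -- The supremum is over sets of exactly `α` arms, so the exploration set is enlarged, which `α ≤
    -- K` permits; the extra terms are nonnegative.
    · obtain ⟨A, hSA, hA⟩ := Finset.exists_superset_card_eq
        (((run.isExplorationSet t (ha.trans hat) ω).card_le).trans (not_lt.1 hbad)) hαK
      have h1 : F ⟨A, hA⟩ ≤ M := le_ciSup (Set.finite_range F).bddAbove _
      calc ∑ i ∈ S (t + 1) ω with 0 < gap μ ℓ i, 1280 * Real.log N / (N * gap μ ℓ i)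
          ≤ ∑ i ∈ A with 0 < gap μ ℓ i, 1280 * Real.log N / (N * gap μ ℓ i) := by
            refine Finset.sum_le_sum_of_subset_of_nonneg (Finset.filter_subset_filter _ hSA)
              fun i hi _ => ?_
            have := (Finset.mem_filter.1 hi).2
            positivity
        _ ≤ ∑ i ∈ A with 0 < gap μ ℓ i,
              4 * 320 * Real.log T ^ 2 / gap μ ℓ i * (1 / Real.log T * (1 / N)) := by
            refine Finset.sum_le_sum fun i hi => ?_
            have hg := (Finset.mem_filter.1 hi).2
            calc 1280 * Real.log N / (N * gap μ ℓ i)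
                ≤ 1280 * Real.log T / (N * gap μ ℓ i) := by gcongr
              _ = _ := by
                field_simp
                norm_num
        _ = F ⟨A, hA⟩ / Real.log T * (1 / N) := by
            rw [← Finset.sum_mul]
            simp only [hF]
            ring
        _ ≤ _ := by
            rw [zero_add]
            gcongr
  refine (Finset.sum_le_sum hround).trans ?_
  rw [Finset.sum_add_distrib, Finset.sum_add_distrib, ← Finset.mul_sum, ← Finset.mul_sum]
  have h1 : ∑ t ∈ Finset.Ico a T, (if α < strongIndepNumber (G (t + 1)) then (1 : ℝ) else 0) ≤
      n := by
    have h2 := card_nthLargest_lt_le (fun t => strongIndepNumber (G t)) T n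
    calc _ ≤ ∑ t ∈ Finset.range T, (if α < strongIndepNumber (G (t + 1)) then (1 : ℝ) else 0) :=
          Finset.sum_le_sum_of_subset_of_nonneg (fun t ht => by
            simp only [Finset.mem_Ico, Finset.mem_range] at ht ⊢
            exact ht.2) fun t _ _ => by positivity
      _ ≤ n := by exact_mod_cast h2
  have h2 : M / Real.log T * ∑ t ∈ Finset.Ico a T, 1 / ((t + 1 : ℕ) : ℝ) ≤ M := by
    have hlogT : 0 ≤ Real.log T := Real.log_natCast_nonneg _
    calc _ ≤ M / Real.log T * Real.log T := by
          gcongr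
          exact sum_Ico_one_div_le_log ha1 T
      _ ≤ M := by
          -- If $\ln T=0$, the quotient by it is 0 by convention.
          rcases hlogT.eq_or_lt with h0 | h0
          · simpa [← h0] using hM0
          · exact (div_mul_cancel₀ _ h0.ne').le
  have h3 := mul_le_mul_of_nonneg_left (sum_Ico_one_div_sq_le ha1 T)
    (show 0 ≤ 137 * Fintype.card V / δ ^ 3 by positivity)
  linarith

/-- The regret bound for independent and identically distributed losses. -/
theorem pseudoRegret_le_strongIndepNumber (run : IsRun 1 4 320 μ ℱ G ℓ S I)
    (hG : ∀ t i, (G t).Adj i i) (hs : IsStochastic μ ℱ ℓ) {δ X : ℝ}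
    (hδ : δ ∈ Set.range (gap μ ℓ)) (hδ0 : 0 < δ) (hδ' : ∀ i, 0 < gap μ ℓ i → δ ≤ gap μ ℓ i)
    (hX : X = Real.log (20 * 320 ^ 2 * (Fintype.card V : ℝ) ^ (5 / 2 : ℝ) / δ ^ 4)) (T n : ℕ) :
    pseudoRegret μ ℓ I T ≤
      (⨆ A : {A : Finset V // A.card = nthLargest (fun t => strongIndepNumber (G t)) T n},
        ∑ i ∈ A.1 with 0 < gap μ ℓ i, 4 * 320 * Real.log T ^ 2 / gap μ ℓ i) + n +
      181 * 320 * (Fintype.card V : ℝ) ^ (3 / 2 : ℝ) / δ ^ 2 * X ^ 2 := by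
  obtain ⟨i₀, hi₀⟩ := hδ
  obtain ⟨j, hj⟩ := exists_eq_ciInf_of_finite (f := armMean μ ℓ)
  have hj0 : gap μ ℓ j = 0 := sub_eq_zero.2 hj
  have hK : 2 ≤ Fintype.card V := by
    have : i₀ ≠ j := by
      rintro rfl
      rw [hj0] at hi₀
      exact hδ0.ne hi₀
    exact Fintype.one_lt_card_iff_nontrivial.2 ⟨⟨i₀, j, this⟩⟩
  have hK' : (2 : ℝ) ≤ Fintype.card V := by exact_mod_cast hK
  have hδ1 : δ ≤ 1 := hi₀ ▸ run.gap_le_one hs i₀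
  have hmean : ∀ t i, ∫ ω, ℓ (t + 1) ω i ∂μ = armMean μ ℓ i := fun t i =>
    ((hs.identDistrib t).comp (measurable_pi_apply i)).integral_eq
  obtain ⟨R, hR⟩ : ∃ R, R = 3840 * Fintype.card V * X /
    (δ ^ 2 * √(Real.log (Fintype.card V))) := ⟨_, rfl⟩
  obtain ⟨hX1, -, hlow⟩ := burnIn_bounds hK' hδ0 hδ1 hX hR
  set u : ℝ := Fintype.card V / δ ^ 2 with hu
  have huK : (Fintype.card V : ℝ) ≤ u :=
    le_div_self (by linarith) (by positivity) (pow_le_one₀ hδ0.le hδ1)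
  set a := ⌊R ^ 2⌋₊ with ha
  have ha1 : (a : ℝ) ≤ R ^ 2 := Nat.floor_le (by positivity)
  have ha2 : R ^ 2 < a + 1 := Nat.lt_floor_add_one _
  have ha3 : 137 * u ^ 2 ≤ a := by nlinarith
  have hKa : Fintype.card V ≤ a := by
    have : (Fintype.card V : ℝ) ≤ a := by nlinarith
    exact_mod_cast this
  have hburn : ∀ N, a < N → IsPastBurnIn V N δ := fun N hN =>
    isPastBurnIn_of_le hK hδ0 hδ1 hX hR (by
      have : (a : ℝ) + 1 ≤ N := by exact_mod_cast hN
      linarith)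
  have hearly := run.sum_regret_le_sqrt (by norm_num) hK hG hs.mem_Icc (min T a) j
  have hlate := run.sum_regret_late_le hG hs hj0 hδ' hKa hburn T n
  have hsplit : ∑ t ∈ Finset.range T,
      (∫ ω, ℓ (t + 1) ω (I (t + 1) ω) ∂μ - ∫ ω, ℓ (t + 1) ω j ∂μ) =
      ∑ t ∈ Finset.range (min T a),
        (∫ ω, ℓ (t + 1) ω (I (t + 1) ω) ∂μ - ∫ ω, ℓ (t + 1) ω j ∂μ) +
      ∑ t ∈ Finset.Ico a T,
        (∫ ω, ℓ (t + 1) ω (I (t + 1) ω) ∂μ - ∫ ω, ℓ (t + 1) ω j ∂μ) := by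
    rcases le_total T a with h | h
    · rw [min_eq_left h, Finset.Ico_eq_empty (by omega), Finset.sum_empty, add_zero]
    · rw [min_eq_right h, Finset.sum_range_add_sum_Ico _ h]
  have htail : 137 * Fintype.card V / δ ^ 3 * (1 / (a : ℝ)) ≤ 1 := by
    have h1 : 137 * Fintype.card V / δ ^ 3 ≤ 137 * u ^ 2 := by
      have h2 : u ^ 2 = Fintype.card V ^ 2 / δ ^ 4 := by rw [hu]; ring
      have h3 : δ ^ 4 ≤ δ ^ 3 := pow_le_pow_of_le_one hδ0.le hδ1 (by norm_num)
      rw [h2, mul_div_assoc]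
      gcongr
      nlinarith
    have h4 : (0 : ℝ) < a := by nlinarith
    rw [mul_one_div, div_le_one h4]
    linarith
  have hpow : (Fintype.card V : ℝ) ^ (3 / 2 : ℝ) = Fintype.card V * √(Fintype.card V : ℝ) := by
    rw [Real.sqrt_eq_rpow, ← Real.rpow_one_add' (by linarith) (by norm_num)]
    norm_num
  have hs0 : 0 < √(Real.log (Fintype.card V)) :=
    Real.sqrt_pos.2 (Real.log_pos (by linarith))
  set s := √(Real.log (Fintype.card V)) with hsdef
  have hk1 : 1 ≤ √(Fintype.card V : ℝ) := Real.one_le_sqrt.2 (by linarith)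
  have hR0 : 0 ≤ R := by nlinarith
  have hearly2 : (Fintype.card V : ℝ) + 21 / 5 * (s * √(Fintype.card V : ℝ) * √((min T a : ℕ) : ℝ))
      + 1 ≤ 181 * 320 * (Fintype.card V : ℝ) ^ (3 / 2 : ℝ) / δ ^ 2 * X ^ 2 := by
    have h1 : √((min T a : ℕ) : ℝ) ≤ R := by
      rw [Real.sqrt_le_left hR0]
      have : ((min T a : ℕ) : ℝ) ≤ a := by exact_mod_cast min_le_right _ _
      linarith
    -- The factor $1/\sqrt{\ln K}$ in `R` cancels the one of the worst-case bound.
    have h2 : s * √(Fintype.card V : ℝ) * R = 3840 * (u * √(Fintype.card V : ℝ) * X) := by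
      rw [hR, hu]
      field_simp
    have h3 : s * √(Fintype.card V : ℝ) * √((min T a : ℕ) : ℝ) ≤
        s * √(Fintype.card V : ℝ) * R := by gcongr
    have h4 : 181 * 320 * (Fintype.card V : ℝ) ^ (3 / 2 : ℝ) / δ ^ 2 * X ^ 2 =
        57920 * (u * √(Fintype.card V : ℝ) * X) * X := by
      rw [hpow, hu]
      ring
    have h5 : u ≤ u * √(Fintype.card V : ℝ) * X := by
      rw [mul_assoc]
      exact le_mul_of_one_le_right (by linarith) (one_le_mul_of_one_le_of_one_le hk1 hX1)
    have h6 : 57920 * (u * √(Fintype.card V : ℝ) * X) ≤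
        57920 * (u * √(Fintype.card V : ℝ) * X) * X :=
      le_mul_of_one_le_right (by linarith) hX1
    rw [h4]
    linarith
  refine run.pseudoRegret_le hs.mem_Icc fun i => ?_
  -- In expectation an optimal arm is the strongest comparator.
  have hij : ∑ t ∈ Finset.range T,
      (∫ ω, ℓ (t + 1) ω (I (t + 1) ω) ∂μ - ∫ ω, ℓ (t + 1) ω i ∂μ) ≤
      ∑ t ∈ Finset.range T,
        (∫ ω, ℓ (t + 1) ω (I (t + 1) ω) ∂μ - ∫ ω, ℓ (t + 1) ω j ∂μ) := by
    refine Finset.sum_le_sum fun t _ => ?_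
    rw [hmean, hmean, hj]
    have := ciInf_le (Set.finite_range (armMean μ ℓ)).bddBelow i
    linarith
  linarith

/-- There is no regret if all arms are optimal. -/
lemma pseudoRegret_le_zero (run : IsRun 1 4 320 μ ℱ G ℓ S I) (hs : IsStochastic μ ℱ ℓ)
    (h : ∀ i, gap μ ℓ i = 0) (T : ℕ) : pseudoRegret μ ℓ I T ≤ 0 := by
  refine run.pseudoRegret_le hs.mem_Icc fun i => (Finset.sum_eq_zero fun t _ => ?_).le
  rw [run.integral_playedLoss_sub_eq hs t (h i)]
  simp [h]

end IsRun

end Regret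

/-! ### The smallest positive gap -/

section MinGap

variable {V : Type*} {Δ : V → ℝ}

lemma minGap_mem [Finite V] (h : ∃ i, 0 < Δ i) : 0 < minGap Δ ∧ ∃ i, Δ i = minGap Δ := by
  obtain ⟨i, hi⟩ := h
  have hne : {d | 0 < d ∧ ∃ i, Δ i = d}.Nonempty := ⟨Δ i, hi, i, rfl⟩
  exact hne.csInf_mem ((Set.finite_range Δ).subset fun _ hd => hd.2)

lemma minGap_le {i : V} (hi : 0 < Δ i) : minGap Δ ≤ Δ i :=
  csInf_le ⟨0, fun _ hd => hd.1.le⟩ ⟨hi, i, rfl⟩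

end MinGap

end FeedbackGraph

/-! ### The theorem -/

open FeedbackGraph in
theorem theorem3 {V : Type*} {Ω : Type*} [Fintype V] [Nonempty V] {mΩ : MeasurableSpace Ω}
    (μ : Measure Ω) [IsProbabilityMeasure μ] (ℱ : Filtration ℕ mΩ)
    (G : ℕ → Digraph V) (hG : ∀ t i, (G t).Adj i i)
    (S : ℕ → Ω → Finset V) (I : ℕ → Ω → V) (T : ℕ) (hT : 1 ≤ T)
    (K β : ℝ) (hK : K = Fintype.card V) (hβ : β = 320) :
    (∀ ℓ : ℕ → V → ℝ, (∀ t i, ℓ t i ∈ Set.Icc (0 : ℝ) 1) →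
      IsRun 1 4 β μ ℱ G (fun t _ => ℓ t) S I →
      pseudoRegret μ (fun t _ => ℓ t) I T ≤
        9 * √(Real.log K) * √(Real.log (K * T)) *
            √(∑ t ∈ Finset.Icc 1 T, (indepNumber (G t) : ℝ)) + 2 * K) ∧
    (∀ ℓ : ℕ → Ω → V → ℝ, IsStochastic μ ℱ ℓ →
      IsRun 1 4 β μ ℱ G ℓ S I →
      ∀ Δ : V → ℝ, Δ = gap μ ℓ →
      pseudoRegret μ ℓ I T ≤
        (⨅ n : Fin (T + 1),
          ((⨆ A : {A : Finset V //
                A.card = nthLargest (fun t => strongIndepNumber (G t)) T n},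
              ∑ i ∈ A.1 with 0 < Δ i, 4 * β * Real.log T ^ 2 / Δ i) + ((n : ℕ) : ℝ))) +
        2 * Real.log T + (∑ i with 0 < Δ i, 16 * K / Δ i) +
        181 * β * K ^ (3 / 2 : ℝ) / minGap Δ ^ 2 *
          Real.log (20 * β ^ 2 * K ^ (5 / 2 : ℝ) / minGap Δ ^ 4) ^ 2) := by
  subst hK hβ
  refine ⟨fun ℓ hℓ run => run.pseudoRegret_le_sum_indepNumber (by norm_num) hG
    (fun t _ => hℓ (t + 1)) T, fun ℓ hs run Δ hΔ => ?_⟩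
  -- Of the terms $2\ln T$ and $\sum16K/\Delta_i$ only the nonnegativity is used.
  have h1 : 0 ≤ 2 * Real.log T := by
    have := Real.log_natCast_nonneg T
    linarith
  have h2 : 0 ≤ ∑ i with 0 < Δ i, 16 * (Fintype.card V : ℝ) / Δ i :=
    Finset.sum_nonneg fun i hi => by
      have := (Finset.mem_filter.1 hi).2
      positivity
  rw [add_assoc, add_assoc, ← sub_le_iff_le_add]
  refine le_ciInf fun n => ?_
  by_cases h : ∃ i, 0 < Δ i
  · obtain ⟨hpos, hmem⟩ := minGap_mem h
    subst hΔ
    have := run.pseudoRegret_le_strongIndepNumber hG hs hmem hpos (fun _ => minGap_le) rfl T n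
    linarith
  -- All arms are optimal: the regret is at most 0. Here `minGap` is the infimum of the empty set,
  -- which is 0, so the last term is a quotient by zero and vanishes.
  · have h0 : ∀ i, gap μ ℓ i = 0 := fun i =>
      le_antisymm (not_lt.1 fun hi => h ⟨i, hΔ ▸ hi⟩) (gap_nonneg ℓ i)
    have h3 := run.pseudoRegret_le_zero hs h0 T
    have h4 : 0 ≤ ⨆ A : {A : Finset V //
        A.card = nthLargest (fun t => strongIndepNumber (G t)) T n},
        ∑ i ∈ A.1 with 0 < Δ i, 4 * (320 : ℝ) * Real.log T ^ 2 / Δ i :=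
      Real.iSup_nonneg fun A => Finset.sum_nonneg fun i hi => by
        have := (Finset.mem_filter.1 hi).2
        positivity
    have h5 : 0 ≤ 181 * (320 : ℝ) * (Fintype.card V : ℝ) ^ (3 / 2 : ℝ) / minGap Δ ^ 2 *
        Real.log (20 * 320 ^ 2 * (Fintype.card V : ℝ) ^ (5 / 2 : ℝ) / minGap Δ ^ 4) ^ 2 := by
      positivity
    have h6 : (0 : ℝ) ≤ (n : ℕ) := Nat.cast_nonneg _
    linarith
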